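/- Let $n\ge 2$ and let $W=W(B_n)$ be the group of signed permutations of $\{\pm e_1,\dots,\pm e_n\}$, acting on $E=\mathbb R^n$. A reflection subgroup of $W$ is a subgroup generated by elements acting on $E$ as reflections; its parabolic closure is the subgroup of all elements of $W$ that fix pointwise the fixed space of the subgroup in $E$. A Coxeter element of a reflection subgroup $R$ is the product, in some order, of the elements of a Coxeter generating set of $R$, i.e. of the set of reflections of $R$ in the roots of a simple system of the root system of $R$. The signed cycle type of $w\in W$ is the pair of partitions formed by the lengths of the positive and of the negative cycles of $w$ (a cycle is negative if an odd number of the $e_i$ in it are sent to some $-e_j$). A triple partition of $n$ is a triple $\lambda=(\lambda^1,\lambda^2,\lambda^3)$ of (possibly empty) partitions whose parts sum to $n$ in total; write $\lambda^3>1$ if all parts of $\lambda^3$ are greater than $1$ (in particular if $\lambda^3=\emptyset$). Let $$W_\lambda=\prod_i W(A_{\lambda^1_i-1})\times\prod_i W(B_{\lambda^2_i})\times\prod_i W(D_{\lambda^3_i})\le W,$$ the factors acting on consecutive disjoint blocks of coordinates of sizes $\lambda^1_i,\lambda^2_i,\lambda^3_i$, where on a block of size $k$ the group $W(A_{k-1})$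 consists of all permutations, $W(B_k)$ of all signed permutations, and $W(D_k)$ of all signed permutations with an even number of minus signs. (1) For each triple partition $\lambda$ of $n$ with $\lambda^3>1$, $W_\lambda$ is a reflection subgroup of $W$, and every reflection subgroup of $W$ is conjugate in $W$ to $W_\lambda$ for exactly one such $\lambda$. (2) For each such $\lambda$, with $\lambda^1$ a partition of $m$, the parabolic closure of $W_\lambda$ has type $W(B_{n-m})\times\prod_i W(A_{\lambda^1_i-1})$; that is, it is conjugate in $W$ to $W_{(\lambda^1,(n-m),\emptyset)}$ (to $W_{(\lambda^1,\emptyset,\emptyset)}$ if $m=n$). (3) For each such $\lambda$, $W_\lambda$ has Coxeter elements, and all of them have signed cycle type $(\lambda^1,\ \lambda^2\cup(\lambda^3-1)\cup 1^{\ell(\lambda^3)})$, where $\cup$ joins the parts of partitions, $\lambda^3-1$ is obtained from $\lambda^3$ by decreasing every part by $1$, and $1^{\ell(\lambda^3)}$ has as many parts, all equal to $1$, as $\lambda^3$ has parts. (4) There is a well-defined map $\gamma$ from the conjugacy classes of reflection subgroups of $W$ to the conjugacy classes of elements of $W$ that sends the class of $R$ to the class of the Coxeter elements of $R$. It is surjective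 but not injective. -/

import Mathlib

open scoped NNReal

/-! ### The group `W(B_n)` of signed permutations and its reflection representation -/

/-- Signed permutations of `{± e_1, …, ± e_n}`, i.e. the elements of the Coxeter group `W(B_n)`.
The element `w` sends `e_i` to `w.sign i • e_(w.perm i)`, see `SignedPerm.rep_single`. -/
@[ext]
structure SignedPerm (n : ℕ) where
  /-- the permutation of the lines `⟨e_i⟩` -/
  perm : Equiv.Perm (Fin n)
  /-- the sign of `w e_i` -/
  sign : Fin n → ℤˣ

namespace SignedPerm

variable {n : ℕ}

/-- Composition of signed permutations: first `w`, then `v`. -/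
instance : Mul (SignedPerm n) :=
  ⟨fun v w => ⟨v.perm * w.perm, fun i => w.sign i * v.sign (w.perm i)⟩⟩

instance : One (SignedPerm n) := ⟨⟨1, fun _ => 1⟩⟩

instance : Inv (SignedPerm n) := ⟨fun w => ⟨w.perm⁻¹, fun i => w.sign (w.perm⁻¹ i)⟩⟩

@[simp] theorem mul_perm (v w : SignedPerm n) : (v * w).perm = v.perm * w.perm := rfl
@[simp] theorem mul_sign (v w : SignedPerm n) (i : Fin n) :
    (v * w).sign i = w.sign i * v.sign (w.perm i) := rfl
@[simp] theorem one_perm : (1 : SignedPerm n).perm = 1 := rfl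
@[simp] theorem one_sign (i : Fin n) : (1 : SignedPerm n).sign i = 1 := rfl
@[simp] theorem inv_perm (w : SignedPerm n) : (w⁻¹).perm = w.perm⁻¹ := rfl
@[simp] theorem inv_sign (w : SignedPerm n) (i : Fin n) :
    (w⁻¹).sign i = w.sign (w.perm⁻¹ i) := rfl

instance : Group (SignedPerm n) :=
  Group.ofLeftAxioms
    (fun a b c => by
      ext i
      · simp
      · simp [mul_assoc])
    (fun a => by
      ext i
      · simp
      · simp)
    (fun a => by
      ext i
      · simp
      · simp)

/-- The reflection representation `E = ℝ^n` of `W(B_n)`, with the standard scalar product. -/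
noncomputable def rep (n : ℕ) : Representation ℝ (SignedPerm n) (EuclideanSpace ℝ (Fin n)) where
  toFun w :=
    { toFun := fun x =>
        WithLp.toLp 2 (fun j => ((w.sign (w.perm⁻¹ j) : ℤ) : ℝ) * x (w.perm⁻¹ j))
      map_add' := fun x y => by
        ext j
        simp [mul_add]
      map_smul' := fun c x => by
        ext j
        simp [mul_left_comm] }
  map_one' := by
    ext x j
    simp
    rfl
  map_mul' v w := by
    ext x j
    simp [mul_comm, mul_left_comm]
    rfl

theorem rep_single (w : SignedPerm n) (i : Fin n) :
    rep n w (EuclideanSpace.single i 1)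
      = ((w.sign i : ℤ) : ℝ) • EuclideanSpace.single (w.perm i) 1 := by
  ext j
  by_cases h : j = w.perm i
  · subst h
    simp [rep]
  · have h2 : w.perm.symm j ≠ i := fun h3 => h (by simp [← h3])
    simp [rep, h, h2]

/-! ### Signed cycle type -/

/-- The cycles of `w` on `{1, …, n}` (as sets), fixed points included. -/
def cycles (w : SignedPerm n) : Finset (Finset (Fin n)) :=
  Finset.univ.image fun i => Finset.univ.filter fun j => w.perm.SameCycle i j

/-- The signed cycle type of `w`: the lengths of the positive cycles and the lengths of the
negative cycles.  The sign of a cycle is the parity of the number of its `e_i` that are sent to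
some `-e_j`. -/
def cycleType (w : SignedPerm n) : Multiset ℕ × Multiset ℕ :=
  (((cycles w).filter fun o => Even (o.filter fun i => w.sign i = -1).card).val.map Finset.card,
   ((cycles w).filter fun o => Odd (o.filter fun i => w.sign i = -1).card).val.map Finset.card)

/-! ### Reflection subgroups, parabolic closures -/

/-- `w` acts on `E` as the reflection in the hyperplane orthogonal to `v`
(only meaningful for `v ≠ 0`). -/
def ReflectsIn (w : SignedPerm n) (v : EuclideanSpace ℝ (Fin n)) : Prop :=
  ∀ x, rep n w x = (Submodule.span ℝ {v})ᗮ.reflection x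

/-- `w` acts on `E` as a reflection. -/
def IsReflection (w : SignedPerm n) : Prop :=
  ∃ v : EuclideanSpace ℝ (Fin n), v ≠ 0 ∧ w.ReflectsIn v

/-- A reflection subgroup is a subgroup generated by a set of reflections. -/
def IsReflectionSubgroup (R : Subgroup (SignedPerm n)) : Prop :=
  ∃ Y : Set (SignedPerm n), (∀ w ∈ Y, w.IsReflection) ∧ R = Subgroup.closure Y

/-- Conjugacy of subgroups of `W(B_n)`. -/
def ConjSubgroups (R R' : Subgroup (SignedPerm n)) : Prop :=
  ∃ g : SignedPerm n, R' = R.map (MulAut.conj g).toMonoidHom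

/-- The space of fixed points in `E` of a set `X` of elements. -/
def fixedSpace (X : Set (SignedPerm n)) : Submodule ℝ (EuclideanSpace ℝ (Fin n)) where
  carrier := {v | ∀ w ∈ X, rep n w v = v}
  add_mem' := fun ha hb w hw => by rw [map_add, ha w hw, hb w hw]
  zero_mem' := fun w _ => map_zero _
  smul_mem' := fun c x hx w hw => by rw [map_smul, hx w hw]

/-- The parabolic subgroup `W_V` of the elements that fix the subspace `V` of `E` pointwise. -/
def parabolic (V : Submodule ℝ (EuclideanSpace ℝ (Fin n))) : Subgroup (SignedPerm n) where
  carrier := {w | ∀ v ∈ V, rep n w v = v}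
  mul_mem' := fun {a b} ha hb v hv => by
    rw [map_mul, Module.End.mul_apply, hb v hv, ha v hv]
  one_mem' := fun v _ => by rw [map_one, Module.End.one_apply]
  inv_mem' := fun {a} ha v hv => by
    have h : rep n a⁻¹ (rep n a v) = v := by
      rw [← Module.End.mul_apply, ← map_mul, inv_mul_cancel, map_one, Module.End.one_apply]
    rwa [ha v hv] at h

/-- The parabolic closure of a set `X` of elements. -/
def parabolicClosure (X : Set (SignedPerm n)) : Subgroup (SignedPerm n) :=
  parabolic (fixedSpace X)

/-! ### Coxeter elements of reflection subgroups -/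

/-- The (unit) root system of `R`: the unit normal vectors of the reflecting hyperplanes of `R`. -/
def unitRoots (R : Subgroup (SignedPerm n)) : Set (EuclideanSpace ℝ (Fin n)) :=
  {v | ‖v‖ = 1 ∧ ∃ w ∈ R, w.ReflectsIn v}

/-- `D` is a simple system in the root system `P`: a linearly independent set of roots such that
every root is, up to sign, a linear combination of `D` with nonnegative coefficients. -/
def IsSimpleSystem (P D : Set (EuclideanSpace ℝ (Fin n))) : Prop :=
  D ⊆ P ∧ LinearIndepOn ℝ id D ∧
    ∀ v ∈ P, v ∈ Submodule.span ℝ≥0 D ∨ -v ∈ Submodule.span ℝ≥0 D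

/-- The Coxeter generating sets of the finite reflection group `R` (acting on `E`): the sets of
simple reflections of `R`, with respect to a simple system of its roots.  Equivalently, the sets
of reflections in the walls of a chamber of `R`. -/
def IsCoxeterGeneratingSet (R : Subgroup (SignedPerm n)) (S : Set (SignedPerm n)) : Prop :=
  ∃ D, IsSimpleSystem (unitRoots R) D ∧ S = {w | ∃ v ∈ D, w.ReflectsIn v}

/-- A Coxeter element of `R` is the product of the elements of a Coxeter generating set of `R`,
each taken once, in some order. -/
def IsCoxeterElement (R : Subgroup (SignedPerm n)) (c : SignedPerm n) : Prop :=
  ∃ l : List (SignedPerm n), l.Nodup ∧ IsCoxeterGeneratingSet R {w | w ∈ l} ∧ c = l.prod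

/-- Conjugacy, as an equivalence relation on the reflection subgroups. -/
instance reflectionSubgroupSetoid (n : ℕ) :
    Setoid {R : Subgroup (SignedPerm n) // IsReflectionSubgroup R} where
  r R R' := ConjSubgroups R.1 R'.1
  iseqv :=
    { refl := fun R => ⟨1, by ext x; simp⟩
      symm := fun {R R'} h => by
        obtain ⟨g, hg⟩ := h
        exact ⟨g⁻¹, by rw [hg]; ext x; simp [Subgroup.mem_map, mul_assoc]⟩
      trans := fun {R R' R''} h h' => by
        obtain ⟨g, hg⟩ := h
        obtain ⟨g', hg'⟩ := h'
        exact ⟨g' * g, by rw [hg', hg]; ext x; simp [Subgroup.mem_map, mul_assoc]⟩ }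

/-- The set of conjugacy classes of reflection subgroups of `W(B_n)`. -/
abbrev ReflectionClasses (n : ℕ) : Type := Quotient (reflectionSubgroupSetoid n)

/-- `f` is the map that sends the class of a reflection subgroup `R` to the class of the Coxeter
elements of `R`: every reflection subgroup `R` has Coxeter elements, and `f [R] = [c]` for each
Coxeter element `c` of `R`. There is at most one such map. -/
def IsCoxeterClassMap (f : ReflectionClasses n → ConjClasses (SignedPerm n)) : Prop :=
  ∀ R : {R : Subgroup (SignedPerm n) // IsReflectionSubgroup R},
    (∃ c, IsCoxeterElement R.1 c) ∧
      ∀ c, IsCoxeterElement R.1 c → f (Quotient.mk _ R) = ConjClasses.mk c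

/-! ### The subgroups attached to labelled set partitions of `{1, …, n}` -/

/-- The three kinds of factors. -/
inductive Kind where
  | A | B | D
  deriving DecidableEq

/-- Let `{1, …, n}` be partitioned into the fibres (blocks) of `b`, the block over `k` being of
kind `t k`. This is the direct product over all blocks of the following groups, where `m` is the
size of the block: all permutations of the block, without signs (`W(A_(m-1))`), for kind `A`;
all signed permutations of the block (`W(B_m)`) for kind `B`; all signed permutations of the block
with an even number of minus signs (`W(D_m)`) for kind `D`. -/
def blockSubgroup {ι : Type*} [DecidableEq ι] (b : Fin n → ι) (t : ι → Kind) :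
    Subgroup (SignedPerm n) where
  carrier := {w | (∀ i, b (w.perm i) = b i) ∧ (∀ i, t (b i) = Kind.A → w.sign i = 1) ∧
    ∀ k, t k = Kind.D → ∏ i ∈ Finset.univ.filter (fun i => b i = k), w.sign i = 1}
  one_mem' := by simp
  mul_mem' := by
    rintro v w ⟨hv1, hv2, hv3⟩ ⟨hw1, hw2, hw3⟩
    refine ⟨fun i => by simp [hv1, hw1], fun i hi => ?_, fun k hk => ?_⟩
    · simp [hw2 i hi, hv2 (w.perm i) (by rw [hw1]; exact hi)]
    · simp only [mul_sign, Finset.prod_mul_distrib, hw3 k hk, one_mul]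
      rw [← hv3 k hk]
      exact Finset.prod_equiv w.perm (by simp [hw1]) (by simp)
  inv_mem' := by
    rintro w ⟨hw1, hw2, hw3⟩
    have h1 : ∀ i, b (w.perm⁻¹ i) = b i := fun i => by
      have := hw1 (w.perm⁻¹ i)
      rw [show w.perm (w.perm⁻¹ i) = i from w.perm.apply_symm_apply i] at this
      exact this.symm
    refine ⟨h1, fun i hi => hw2 _ (by rw [h1]; exact hi), fun k hk => ?_⟩
    rw [← hw3 k hk]
    exact Finset.prod_equiv w.perm⁻¹ (by simpa using fun i => by rw [← h1 i]; rfl) (by simp)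

end SignedPerm

/-! ### `r`-partitions -/

/-- An `r`-partition of `n`: a sequence of `r` partitions (multisets of positive integers) whose
parts sum to `n` in total. -/
@[ext]
structure RPartition (r n : ℕ) where
  /-- the partitions `λ^1, …, λ^r` (indexed from `0`) -/
  parts : Fin r → Multiset ℕ
  parts_pos : ∀ j, ∀ i ∈ parts j, 0 < i
  parts_sum : ∑ j, (parts j).sum = n

namespace RPartition

variable {n : ℕ}

/-- The parts of `λ^1`, then those of `λ^2`, then those of `λ^3`, each in non-increasing order, as
a composition of `n`, which cuts `{1, …, n}` into consecutive blocks. -/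
def composition (p : RPartition 3 n) : Composition n where
  blocks := (p.parts 0).sort (· ≥ ·) ++ (p.parts 1).sort (· ≥ ·) ++ (p.parts 2).sort (· ≥ ·)
  blocks_pos := by
    intro i hi
    simp only [List.mem_append, Multiset.mem_sort] at hi
    rcases hi with (hi | hi) | hi
    · exact p.parts_pos 0 i hi
    · exact p.parts_pos 1 i hi
    · exact p.parts_pos 2 i hi
  blocks_sum := by
    have h := p.parts_sum
    rw [Fin.sum_univ_three] at h
    simp only [← Multiset.sum_coe, ← Multiset.coe_add, Multiset.sort_eq, Multiset.sum_add]
    exact h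

/-- The blocks coming from `λ^1`, `λ^2`, `λ^3` are of kind `A`, `B`, `D`, respectively. -/
def kind (p : RPartition 3 n) (k : Fin p.composition.length) : SignedPerm.Kind :=
  if (k : ℕ) < (p.parts 0).card then SignedPerm.Kind.A
  else if (k : ℕ) < (p.parts 0).card + (p.parts 1).card then SignedPerm.Kind.B
  else SignedPerm.Kind.D

/-- The subgroup `W_λ = ∏ W(A_(λ^1_i - 1)) × ∏ W(B_(λ^2_i)) × ∏ W(D_(λ^3_i))` of `W(B_n)`. -/
def subgroup (p : RPartition 3 n) : Subgroup (SignedPerm n) :=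
  SignedPerm.blockSubgroup p.composition.index p.kind

/-- The triple partition `(λ^1, (n - m), ∅)`, where `λ^1` is a partition of `m`; the second
partition is empty for `n = m`. -/
def closure (p : RPartition 3 n) : RPartition 3 n where
  parts := ![p.parts 0, ({n - (p.parts 0).sum} : Multiset ℕ).filter (0 < ·), 0]
  parts_pos := by
    intro j i hi
    fin_cases j
    · exact p.parts_pos 0 i hi
    · change i ∈ ({n - (p.parts 0).sum} : Multiset ℕ).filter (0 < ·) at hi
      exact (Multiset.mem_filter.mp hi).2
    · simp at hi
  parts_sum := by
    have h := p.parts_sum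
    rw [Fin.sum_univ_three] at h
    rw [Fin.sum_univ_three]
    by_cases h0 : 0 < n - (p.parts 0).sum
    · simp [Multiset.filter_singleton, h0]
      omega
    · simp [Multiset.filter_singleton, h0]
      omega

end RPartition

/-! A reflection of `W` is either the sign change `flip i` of one coordinate or a transposition `sw
i j σ` with a sign, whose root is `e_i - σ e_j`. The reflections in a reflection subgroup `R` thus
form a signed graph on the coordinates, with a loop at `i` for each `flip i`, and closure under
conjugation makes it rigid. Connected components are complete; call them blocks. If a block has a
loop, it has all loops and both signs on every pair (type `B`). If it has no loop but both signs on
one pair, it has both signs on every pair (type `D`). Otherwise the signs have the form `ε_i ε_j`,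
and conjugation by the diagonal element `ε` makes them all trivial (type `A`). This is
`IsReflectionSubgroup.exists_conj_blockSubgroup`. Conversely, blocks and kinds can be read off from
the reflections, so the block sizes of each kind are conjugacy invariants
(`blockType_eq_of_conjSubgroups`). A block of kind `D` with one element has to be excluded, because
it gives the same trivial group as one of kind `A`.

The fixed space of a block subgroup consists of the vectors that are constant on the blocks of kind
`A` and zero elsewhere. Its pointwise stabiliser keeps the `A` factors and merges all other blocks
into one of kind `B`.

For Coxeter elements, a functional that is positive on a simple system orders the coordinates of
each block by height. After a diagonal sign change normalising the group, the simple system is the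
standard one for these heights (`IsCoxeterElement.exists_isSimpleList`). In the absence of kind `D`,
a product of the simple reflections has the blocks as its cycles: a vector fixed by a product of
reflections in linearly independent roots is fixed by each factor, and this applies to the indicator
vector of a cycle. The sign of a cycle is decided by the single flip in a block of kind `B`. In a
block of kind `D` of size `k`, the two reflections at the fork of the Dynkin diagram have product
`flip i * flip j` and commute with all but at most one of the other factors. Hence the Coxeter
element is conjugate to one of `B_(k-1) × B_1` (`IsSimpleList.exists_split`), which explains both
the formula for the cycle type and the failure of injectivity.

Finally, signed cycle types separate the conjugacy classes of `W` (`isConj_of_cycleType_eq`). So `γ`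
is well defined, and the triples with `λ^3 = ∅` already reach every class. -/

namespace SignedPerm

variable {n : ℕ}

/-! ### Reflections -/

/-- The sign change in the coordinate `i`. -/
def flip (i : Fin n) : SignedPerm n := ⟨1, fun m => if m = i then -1 else 1⟩

/-- The reflection that sends `e_i` to `σ e_j` and `e_j` to `σ e_i` (for `i ≠ j`). -/
def sw (i j : Fin n) (σ : ℤˣ) : SignedPerm n :=
  ⟨Equiv.swap i j, fun m => if m = i ∨ m = j then σ else 1⟩

@[simp] theorem flip_perm (i : Fin n) : (flip i).perm = 1 := rfl
@[simp] theorem flip_sign (i m : Fin n) : (flip i).sign m = if m = i then -1 else 1 := rfl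
@[simp] theorem sw_perm (i j : Fin n) (σ : ℤˣ) : (sw i j σ).perm = Equiv.swap i j := rfl
@[simp] theorem sw_sign (i j m : Fin n) (σ : ℤˣ) :
    (sw i j σ).sign m = if m = i ∨ m = j then σ else 1 := rfl

/-- The standard basis vector `e_i`. -/
noncomputable abbrev bv (i : Fin n) : EuclideanSpace ℝ (Fin n) := EuclideanSpace.single i 1

/-- The vector `e_i - σ e_j`. -/
noncomputable def rt (i j : Fin n) (σ : ℤˣ) : EuclideanSpace ℝ (Fin n) :=
  bv i - ((σ : ℤ) : ℝ) • bv j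

theorem rt_apply (i j m : Fin n) (σ : ℤˣ) :
    rt i j σ m = (if m = i then 1 else 0) - ((σ : ℤ) : ℝ) * (if m = j then 1 else 0) := by
  simp [rt]

theorem bv_ne_zero (i : Fin n) : (bv i : EuclideanSpace ℝ (Fin n)) ≠ 0 := by
  intro h
  have := congrArg (fun y => y i) h
  simp at this

theorem rt_ne_zero {i j : Fin n} (h : i ≠ j) (σ : ℤˣ) : rt i j σ ≠ 0 := by
  intro h0
  have := congrArg (fun y => y i) h0
  simp [rt_apply, h] at this

theorem rep_apply (w : SignedPerm n) (x : EuclideanSpace ℝ (Fin n)) (j : Fin n) :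
    rep n w x j = ((w.sign (w.perm⁻¹ j) : ℤ) : ℝ) * x (w.perm⁻¹ j) := rfl

theorem rep_apply_perm (w : SignedPerm n) (x : EuclideanSpace ℝ (Fin n)) (i : Fin n) :
    rep n w x (w.perm i) = ((w.sign i : ℤ) : ℝ) * x i := by
  simp [rep_apply]

theorem units_cast_sq (a : ℤˣ) : ((a : ℤ) : ℝ) * ((a : ℤ) : ℝ) = 1 := by
  rcases Int.units_eq_one_or a with rfl | rfl <;> simp

theorem rep_injective : Function.Injective (rep n) := by
  intro v w h
  have key : ∀ i, v.perm i = w.perm i ∧ v.sign i = w.sign i := by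
    intro i
    have h1 : rep n v (bv i) = rep n w (bv i) := by rw [h]
    rw [rep_single, rep_single] at h1
    have h2 := congrArg (fun y => y (v.perm i)) h1
    by_cases h3 : v.perm i = w.perm i
    · refine ⟨h3, ?_⟩
      simp [h3] at h2
      exact_mod_cast h2
    · simp [h3] at h2
  ext i
  · rw [(key i).1]
  · rw [(key i).2]

theorem reflectsIn_iff (w : SignedPerm n) (v : EuclideanSpace ℝ (Fin n)) :
    w.ReflectsIn v ↔ ∀ x, rep n w x = x - (2 * (inner ℝ v x / ‖v‖ ^ 2)) • v := by
  refine forall_congr' fun x => ?_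
  rw [Submodule.reflection_orthogonal_apply, Submodule.reflection_singleton_apply]
  simp [two_mul, add_smul, two_smul]

theorem ReflectsIn.unique {v w : SignedPerm n} {a : EuclideanSpace ℝ (Fin n)}
    (hv : v.ReflectsIn a) (hw : w.ReflectsIn a) : v = w :=
  rep_injective (LinearMap.ext fun x => by rw [hv x, hw x])

theorem reflectsIn_smul {w : SignedPerm n} {v : EuclideanSpace ℝ (Fin n)} {c : ℝ} (hc : c ≠ 0) :
    w.ReflectsIn (c • v) ↔ w.ReflectsIn v := by
  unfold ReflectsIn
  simp only [Submodule.span_singleton_smul_eq (IsUnit.mk0 c hc)]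

theorem rep_flip (i : Fin n) (x : EuclideanSpace ℝ (Fin n)) :
    rep n (flip i) x = x - (2 * x i) • bv i := by
  ext m
  rw [rep_apply, flip_perm, inv_one, Equiv.Perm.one_apply]
  by_cases h : m = i
  · subst h; simp; ring
  · simp [h]

theorem rep_sw {i j : Fin n} (h : i ≠ j) (σ : ℤˣ) (x : EuclideanSpace ℝ (Fin n)) :
    rep n (sw i j σ) x = x - (x i - ((σ : ℤ) : ℝ) * x j) • rt i j σ := by
  have hs := units_cast_sq σ
  ext m
  rw [rep_apply]
  by_cases hi : m = i
  · subst hi; simp [rt_apply, h]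
  · by_cases hj : m = j
    · subst hj; simp [rt_apply, hi]; linear_combination x m * hs
    · simp [rt_apply, hi, hj, Equiv.swap_apply_of_ne_of_ne]

theorem reflectsIn_flip (i : Fin n) : (flip i).ReflectsIn (bv i) := by
  rw [reflectsIn_iff]
  intro x
  rw [rep_flip]
  simp [EuclideanSpace.inner_single_left]

theorem inner_rt (i j : Fin n) (σ : ℤˣ) (x : EuclideanSpace ℝ (Fin n)) :
    inner ℝ (rt i j σ) x = x i - ((σ : ℤ) : ℝ) * x j := by
  simp [rt, inner_sub_left, inner_smul_left, EuclideanSpace.inner_single_left]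

theorem norm_rt_sq {i j : Fin n} (h : i ≠ j) (σ : ℤˣ) : ‖rt i j σ‖ ^ 2 = 2 := by
  rw [← real_inner_self_eq_norm_sq, inner_rt]
  simp [rt_apply, h, h.symm]
  linear_combination units_cast_sq σ

theorem reflectsIn_sw {i j : Fin n} (h : i ≠ j) (σ : ℤˣ) : (sw i j σ).ReflectsIn (rt i j σ) := by
  rw [reflectsIn_iff]
  intro x
  rw [rep_sw h, norm_rt_sq h, inner_rt]
  congr 2
  ring

theorem isReflection_flip (i : Fin n) : (flip i).IsReflection := ⟨_, bv_ne_zero i, reflectsIn_flip i⟩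

theorem isReflection_sw {i j : Fin n} (h : i ≠ j) (σ : ℤˣ) : (sw i j σ).IsReflection :=
  ⟨_, rt_ne_zero h σ, reflectsIn_sw h σ⟩

/-- If `v i ≠ 0`, then `e_i - w e_i` is a nonzero multiple of `v`. Since `w e_i` is plus or minus a
basis vector, `v` is proportional to `e_i` or to some `e_i - σ e_j`, and the root determines the
reflection. -/
theorem ReflectsIn.classify {w : SignedPerm n} {v : EuclideanSpace ℝ (Fin n)} (hv : v ≠ 0)
    (h : w.ReflectsIn v) :
    (∃ i, ∃ c : ℝ, c ≠ 0 ∧ w = flip i ∧ v = c • bv i) ∨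
      ∃ i j σ, ∃ c : ℝ, i ≠ j ∧ c ≠ 0 ∧ w = sw i j σ ∧ v = c • rt i j σ := by
  obtain ⟨i, hi⟩ : ∃ i, v i ≠ 0 := by
    by_contra! h0
    exact hv (by ext i; simp [h0 i])
  have hn : ‖v‖ ^ 2 ≠ 0 := by simpa using hv
  have h1 := (reflectsIn_iff w v).1 h (bv i)
  rw [rep_single] at h1
  set d : ℝ := 2 * (inner ℝ v (bv i) / ‖v‖ ^ 2) with hd
  have hd0 : d ≠ 0 := by
    simp [hd, EuclideanSpace.inner_single_right, hi, hv]
  have hvd : v = d⁻¹ • (bv i - ((w.sign i : ℤ) : ℝ) • bv (w.perm i)) := by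
    rw [h1]
    simp [smul_smul, hd0]
  by_cases hp : w.perm i = i
  · rcases Int.units_eq_one_or (w.sign i) with hs | hs
    · rw [hp, hs] at hvd
      simp at hvd
      exact absurd hvd hv
    · left
      have hv2 : v = (d⁻¹ * 2) • bv i := by
        rw [hvd, hp, hs, mul_smul, two_smul]
        simp
      refine ⟨i, d⁻¹ * 2, by simpa using hd0, ?_, hv2⟩
      rw [hv2, reflectsIn_smul (by simpa using hd0)] at h
      exact h.unique (reflectsIn_flip i)
  · right
    refine ⟨i, w.perm i, w.sign i, d⁻¹, fun h => hp h.symm, inv_ne_zero hd0, ?_, hvd⟩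
    have h2 := h
    rw [hvd, reflectsIn_smul (inv_ne_zero hd0)] at h2
    exact h2.unique (reflectsIn_sw (fun h => hp h.symm) _)

theorem IsReflection.classify {w : SignedPerm n} (h : w.IsReflection) :
    (∃ i, w = flip i) ∨ ∃ i j σ, i ≠ j ∧ w = sw i j σ := by
  obtain ⟨v, hv, h⟩ := h
  rcases h.classify hv with ⟨i, c, -, h, -⟩ | ⟨i, j, σ, c, hij, -, h, -⟩
  · exact Or.inl ⟨i, h⟩
  · exact Or.inr ⟨i, j, σ, hij, h⟩

/-! ### Conjugation of reflections -/

theorem sw_comm (i j : Fin n) (σ : ℤˣ) : sw i j σ = sw j i σ := by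
  ext m
  · simp [Equiv.swap_comm]
  · simp [or_comm]

/-- The sign of the pair is multiplied by the signs of `g` at its two ends. This rule governs all
later normalisations of signs. -/
theorem conj_sw (g : SignedPerm n) {i j : Fin n} (h : i ≠ j) (σ : ℤˣ) :
    g * sw i j σ * g⁻¹ = sw (g.perm i) (g.perm j) (g.sign i * σ * g.sign j) := by
  rw [mul_inv_eq_iff_eq_mul]
  ext m
  · simp [Equiv.swap_apply_def]
    split_ifs <;> simp_all
  · have h1 := Int.units_mul_self (g.sign m)
    by_cases hi : m = i
    · subst hi
      simp only [mul_sign, sw_sign, sw_perm, true_or, if_true, Equiv.swap_apply_left]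
      rw [← mul_assoc, ← mul_assoc, h1, one_mul]
    · by_cases hj : m = j
      · subst hj
        simp only [mul_sign, sw_sign, sw_perm, or_true, if_true, Equiv.swap_apply_right]
        rw [mul_left_comm, h1, mul_one, mul_comm]
      · simp [hi, hj, Equiv.swap_apply_of_ne_of_ne]

theorem conj_flip (g : SignedPerm n) (i : Fin n) : g * flip i * g⁻¹ = flip (g.perm i) := by
  rw [mul_inv_eq_iff_eq_mul]
  ext m
  · simp
  · by_cases hi : m = i <;> simp [hi]

/-! ### Reflections in block subgroups -/

section block

variable {ι : Type*} [DecidableEq ι] (b : Fin n → ι) (t : ι → Kind)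

theorem mem_blockSubgroup {b : Fin n → ι} {t : ι → Kind} {w : SignedPerm n} :
    w ∈ blockSubgroup b t ↔ (∀ i, b (w.perm i) = b i) ∧ (∀ i, t (b i) = Kind.A → w.sign i = 1) ∧
    ∀ k, t k = Kind.D → ∏ i ∈ Finset.univ.filter (fun i => b i = k), w.sign i = 1 := Iff.rfl

theorem flip_mem_blockSubgroup {b : Fin n → ι} {t : ι → Kind} {i : Fin n} :
    flip i ∈ blockSubgroup b t ↔ t (b i) = Kind.B := by
  rw [mem_blockSubgroup]
  constructor
  · rintro ⟨-, h2, h3⟩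
    rcases h : t (b i) with _ | _ | _
    · simpa using h2 i h
    · rfl
    · have := h3 (b i) h
      simp [Finset.prod_ite_eq'] at this
  · intro h
    refine ⟨by simp, fun m hm => ?_, fun k hk => ?_⟩
    · have : m ≠ i := by rintro rfl; simp [h] at hm
      simp [this]
    · have : b i ≠ k := by rintro rfl; simp [h] at hk
      simp [Finset.prod_ite_eq', this]

/-- Both signs `σ` occur in the same block, where they cancel. -/
theorem prod_sw_sign {i j : Fin n} (hij : i ≠ j) (σ : ℤˣ) (b : Fin n → ι) (hb : b i = b j)
    (k : ι) : ∏ m ∈ Finset.univ.filter (fun m => b m = k), (sw i j σ).sign m = 1 := by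
  have : ∀ m, (sw i j σ).sign m = (if m = i then σ else 1) * (if m = j then σ else 1) := by
    intro m
    by_cases hi : m = i
    · subst hi; simp [hij]
    · simp [hi]
  simp only [this, Finset.prod_mul_distrib]
  simp only [Finset.prod_ite_eq', Finset.mem_filter, Finset.mem_univ, true_and, hb]
  split_ifs
  · exact Int.units_mul_self σ
  · rfl

theorem sw_mem_blockSubgroup {b : Fin n → ι} {t : ι → Kind} {i j : Fin n} (hij : i ≠ j)
    {σ : ℤˣ} : sw i j σ ∈ blockSubgroup b t ↔ b i = b j ∧ (t (b i) = Kind.A → σ = 1) := by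
  rw [mem_blockSubgroup]
  constructor
  · rintro ⟨h1, h2, h3⟩
    refine ⟨by simpa using (h1 i).symm, fun h => by simpa using h2 i h⟩
  · rintro ⟨hb, hA⟩
    refine ⟨fun m => ?_, fun m hm => ?_, fun k _ => prod_sw_sign hij σ b hb k⟩
    · by_cases hi : m = i
      · subst hi; simp [hb]
      · by_cases hj : m = j
        · subst hj; simp [hb]
        · simp [Equiv.swap_apply_of_ne_of_ne hi hj]
    · by_cases h : m = i ∨ m = j
      · have : b m = b i := by rcases h with rfl | rfl <;> simp [hb]
        simp [h, hA (this ▸ hm)]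
      · simp [h]

end block

end SignedPerm

namespace SignedPerm

variable {n : ℕ}

/-! ### Reflection subgroups are conjugate to block subgroups -/

theorem sw_one_mul_sw_neg_one {i j : Fin n} (h : i ≠ j) :
    sw i j 1 * sw i j (-1) = flip i * flip j := by
  ext m
  · simp
  · by_cases hi : m = i
    · subst hi; simp [h]
    · by_cases hj : m = j
      · subst hj; simp [hi]
      · simp [hi, hj]

section block

variable {ι : Type*} [DecidableEq ι] {b : Fin n → ι} {t : ι → Kind}

/-- Induction on the number of moved coordinates plus the number of minus signs. A transposition
with `σ = 1` shrinks the support of the permutation without touching signs. Once the permutation is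
trivial, minus signs are removed one at a time in blocks of kind `B` and in pairs in blocks of kind
`D`. -/
theorem mem_closure_reflections_of_mem_blockSubgroup (N : ℕ) :
    ∀ w ∈ blockSubgroup b t,
      w.perm.support.card + (Finset.univ.filter fun i => w.sign i = -1).card = N →
      w ∈ Subgroup.closure {r | r ∈ blockSubgroup b t ∧ r.IsReflection} := by
  induction N using Nat.strong_induction_on with
  | _ N ih =>
  intro w hw hN
  set H := Subgroup.closure {r | r ∈ blockSubgroup b t ∧ r.IsReflection} with hH
  have hsub : ∀ {r}, r ∈ blockSubgroup b t → r.IsReflection → r ∈ H :=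
    fun h1 h2 => Subgroup.subset_closure ⟨h1, h2⟩
  have hHle : H ≤ blockSubgroup b t := (Subgroup.closure_le _).2 fun r hr => hr.1
  by_cases hp : w.perm = 1
  · by_cases hs : ∀ i, w.sign i = 1
    · have : w = 1 := by ext i <;> simp [hp, hs]
      rw [this]
      exact one_mem _
    · push Not at hs
      obtain ⟨i, hi⟩ := hs
      replace hi : w.sign i = -1 := (Int.units_eq_one_or _).resolve_left hi
      -- Multiplying by a diagonal `r` whose minus signs all occur in `w` only deletes minus signs,
      -- among them the one at `i`.
      have red : ∀ r ∈ H, r.perm = 1 → r.sign i = -1 → (∀ m, r.sign m = -1 → w.sign m = -1) →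
          w ∈ H := by
        intro r hr hrp hri hrm
        rw [← Subgroup.mul_mem_cancel_left H hr]
        refine ih _ ?_ (r * w) (mul_mem (hHle hr) hw) rfl
        rw [← hN]
        simp only [mul_perm, hrp, hp, mul_one, mul_sign, Equiv.Perm.one_apply]
        refine Nat.add_lt_add_left (Finset.card_lt_card ?_) _
        rw [Finset.ssubset_iff_of_subset]
        · exact ⟨i, by simpa using hi, by simp [hi, hri]⟩
        · intro m hm
          simp only [Finset.mem_filter, Finset.mem_univ, true_and] at hm ⊢
          rcases Int.units_eq_one_or (r.sign m) with h | h
          · simpa [h] using hm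
          · exact hrm m h
      rcases hk : t (b i) with _ | _ | _
      · rw [hw.2.1 i hk] at hi
        exact absurd hi (by decide)
      · refine red (flip i) (hsub (flip_mem_blockSubgroup.2 hk) (isReflection_flip i)) rfl (by simp) ?_
        intro m hm
        by_cases h : m = i
        · rw [h, hi]
        · simp [h] at hm
      -- The product of the signs over a block of kind `D` is `1`, so the minus sign at `i` is not
      -- the only one.
      · obtain ⟨j, hij, hbj, hj⟩ : ∃ j, i ≠ j ∧ b i = b j ∧ w.sign j = -1 := by
          by_contra! hcon
          have h1 := hw.2.2 (b i) hk
          rw [Finset.prod_eq_single i] at h1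
          · rw [hi] at h1
            exact absurd h1 (by decide)
          · intro m hm hmi
            exact (Int.units_eq_one_or _).resolve_right
              (hcon m hmi.symm (Finset.mem_filter.1 hm).2.symm)
          · simp
        have h1 : ∀ σ, sw i j σ ∈ H := fun σ =>
          hsub ((sw_mem_blockSubgroup hij).2 ⟨hbj, by simp [hk]⟩) (isReflection_sw hij σ)
        refine red (flip i * flip j) ?_ (by simp) (by simp [hij]) ?_
        · rw [← sw_one_mul_sw_neg_one hij]
          exact mul_mem (h1 _) (h1 _)
        · intro m hm
          by_cases hmi : m = i
          · rw [hmi, hi]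
          · by_cases hmj : m = j
            · rw [hmj, hj]
            · simp [hmi, hmj] at hm
  · obtain ⟨i, hi⟩ : ∃ i, w.perm i ≠ i := by
      by_contra! h
      exact hp (Equiv.ext h)
    have hr : sw i (w.perm i) 1 ∈ H :=
      hsub ((sw_mem_blockSubgroup hi.symm).2 ⟨(hw.1 i).symm, fun _ => rfl⟩)
        (isReflection_sw hi.symm 1)
    rw [← Subgroup.mul_mem_cancel_left H hr]
    refine ih _ ?_ _ (mul_mem (hHle hr) hw) rfl
    rw [← hN]
    have := Equiv.Perm.card_support_swap_mul hi
    simpa using this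

theorem isReflectionSubgroup_blockSubgroup : IsReflectionSubgroup (blockSubgroup b t) :=
  ⟨{r | r ∈ blockSubgroup b t ∧ r.IsReflection}, fun _ h => h.2,
    le_antisymm (fun w hw => mem_closure_reflections_of_mem_blockSubgroup _ w hw rfl)
      ((Subgroup.closure_le _).2 fun _ hr => hr.1)⟩

end block

theorem mem_map_conj {R : Subgroup (SignedPerm n)} {g w : SignedPerm n} :
    w ∈ R.map (MulAut.conj g).toMonoidHom ↔ g⁻¹ * w * g ∈ R := by
  rw [Subgroup.mem_map]
  constructor
  · rintro ⟨x, hx, rfl⟩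
    simpa [mul_assoc] using hx
  · intro h
    exact ⟨_, h, by simp [mul_assoc]⟩

theorem conj_mem_map_conj {R : Subgroup (SignedPerm n)} {g w : SignedPerm n} :
    g * w * g⁻¹ ∈ R.map (MulAut.conj g).toMonoidHom ↔ w ∈ R := by
  rw [mem_map_conj]
  simp [mul_assoc]

theorem IsReflection.conj {w : SignedPerm n} (h : w.IsReflection) (g : SignedPerm n) :
    (g * w * g⁻¹).IsReflection := by
  rcases h.classify with ⟨i, rfl⟩ | ⟨i, j, σ, hij, rfl⟩
  · rw [conj_flip]
    exact isReflection_flip _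
  · rw [conj_sw g hij]
    exact isReflection_sw (fun h => hij (g.perm.injective h)) _

/-- Both groups are generated by reflections, so comparing them reduces to the two families `flip`
and `sw`. -/
theorem IsReflectionSubgroup.eq_of_forall {R R' : Subgroup (SignedPerm n)}
    (hR : IsReflectionSubgroup R) (hR' : IsReflectionSubgroup R')
    (h : ∀ w : SignedPerm n, w.IsReflection → (w ∈ R ↔ w ∈ R')) : R = R' := by
  obtain ⟨Y, hY, rfl⟩ := hR
  obtain ⟨Y', hY', rfl⟩ := hR'
  refine le_antisymm ((Subgroup.closure_le _).2 fun w hw => ?_)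
    ((Subgroup.closure_le _).2 fun w hw => ?_)
  · exact (h w (hY w hw)).1 (Subgroup.subset_closure hw)
  · exact (h w (hY' w hw)).2 (Subgroup.subset_closure hw)

theorem IsReflectionSubgroup.conj {R : Subgroup (SignedPerm n)} (hR : IsReflectionSubgroup R)
    (g : SignedPerm n) : IsReflectionSubgroup (R.map (MulAut.conj g).toMonoidHom) := by
  obtain ⟨Y, hY, rfl⟩ := hR
  refine ⟨(MulAut.conj g).toMonoidHom '' Y, ?_, by rw [MonoidHom.map_closure]⟩
  rintro _ ⟨w, hw, rfl⟩
  exact (hY w hw).conj g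

theorem sw_trans_mem {R : Subgroup (SignedPerm n)} {i j k : Fin n} {σ τ : ℤˣ}
    (hjk : j ≠ k) (hik : i ≠ k) (h1 : sw i j σ ∈ R) (h2 : sw j k τ ∈ R) : sw i k (σ * τ) ∈ R := by
  have h : sw i j σ * sw j k τ * (sw i j σ)⁻¹ ∈ R := mul_mem (mul_mem h1 h2) (inv_mem h1)
  rw [conj_sw _ hjk] at h
  simpa [Equiv.swap_apply_of_ne_of_ne hik.symm hjk.symm, hik.symm, hjk.symm] using h

/-- The coordinates that are permuted transitively by the reflections of `R`. -/
def linked (R : Subgroup (SignedPerm n)) : Setoid (Fin n) where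
  r i j := i = j ∨ ∃ σ, sw i j σ ∈ R
  iseqv :=
    { refl := fun i => Or.inl rfl
      symm := by
        rintro i j (rfl | ⟨σ, h⟩)
        · exact Or.inl rfl
        · exact Or.inr ⟨σ, by rwa [sw_comm]⟩
      trans := by
        rintro i j k (rfl | ⟨σ, h⟩) (rfl | ⟨τ, h'⟩)
        · exact Or.inl rfl
        · exact Or.inr ⟨τ, h'⟩
        · exact Or.inr ⟨σ, h⟩
        · by_cases hik : i = k
          · exact Or.inl hik
          by_cases hjk : j = k
          · subst hjk; exact Or.inr ⟨σ, h⟩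
          exact Or.inr ⟨σ * τ, sw_trans_mem hjk hik h h'⟩ }

theorem flip_mem_of_linked {R : Subgroup (SignedPerm n)} {i j : Fin n} (h : (linked R) i j)
    (hi : flip i ∈ R) : flip j ∈ R := by
  rcases h with rfl | ⟨σ, h⟩
  · exact hi
  · have h' : sw i j σ * flip i * (sw i j σ)⁻¹ ∈ R := mul_mem (mul_mem h hi) (inv_mem h)
    rw [conj_flip] at h'
    simpa using h'

theorem sw_neg_mem_of_flip_mem {R : Subgroup (SignedPerm n)} {i j : Fin n} {σ : ℤˣ} (hij : i ≠ j)
    (hi : flip i ∈ R) (h : sw i j σ ∈ R) : sw i j (-σ) ∈ R := by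
  have h' : flip i * sw i j σ * (flip i)⁻¹ ∈ R := mul_mem (mul_mem hi h) (inv_mem hi)
  rw [conj_sw _ hij] at h'
  simpa [hij.symm] using h'

/-- The freedom of sign on the pair `i`, `j` is carried along paths: first to all pairs containing
`i`, then through `i` to any pair of the component. -/
theorem sw_mem_of_unbalanced {R : Subgroup (SignedPerm n)} {i j : Fin n}
    (h : ∀ σ, sw i j σ ∈ R) {k l : Fin n} (hk : (linked R) i k) (hl : (linked R) i l)
    (hkl : k ≠ l) (σ : ℤˣ) : sw k l σ ∈ R := by
  have key : ∀ m, (linked R) i m → i ≠ m → ∀ σ, sw i m σ ∈ R := by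
    intro m hm him σ
    by_cases hjm : j = m
    · exact hjm ▸ h σ
    rcases hm with rfl | ⟨τ, hτ⟩
    · exact absurd rfl him
    have h1 : sw j m (1 * τ) ∈ R := sw_trans_mem him hjm (sw_comm i j 1 ▸ h 1) hτ
    -- The pair `j`, `m` has sign `τ`, so starting with `σ * τ` on `i`, `j` leaves `σ` on `i`, `m`.
    have := sw_trans_mem hjm him (h (σ * τ)) h1
    rwa [one_mul, mul_assoc, Int.units_mul_self, mul_one] at this
  by_cases hik : i = k
  · subst hik; exact key l hl hkl σ
  by_cases hil : i = l
  · subst hil; rw [sw_comm]; exact key k hk hik σ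
  have := sw_trans_mem hil hkl (sw_comm i k _ ▸ key k hk hik 1) (key l hl hil σ)
  rwa [one_mul] at this

/-- The blocks are the classes of `linked R`, labelled by a representative. In a block of kind `A`
each pair carries exactly one sign; with `ε i` the sign of the pair formed by the representative and
`i`, transitivity gives `ε i * ε j` for the pair `i`, `j`. Conjugation by the diagonal element `ε`
then makes every such sign `1`. -/
theorem IsReflectionSubgroup.exists_conj_blockSubgroup {R : Subgroup (SignedPerm n)}
    (hR : IsReflectionSubgroup R) :
    ∃ (b : Fin n → Fin n) (t : Fin n → Kind),
      (∀ i, t (b i) = Kind.D → ∃ j, i ≠ j ∧ b i = b j) ∧ ConjSubgroups R (blockSubgroup b t) := by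
  classical
  let b : Fin n → Fin n := fun i => (Quotient.mk (linked R) i).out
  have hb1 : ∀ i, (linked R) (b i) i := fun i => Quotient.mk_out (s := linked R) i
  have hb2 : ∀ i j, b i = b j ↔ (linked R) i j := by
    intro i j
    simp only [b]
    rw [Quotient.out_inj, Quotient.eq]
  have hbb : ∀ i, b (b i) = b i := fun i => (hb2 _ _).2 (hb1 i)
  -- It is enough to test loops and double signs at the representative, as both properties spread
  -- over the component.
  let unb : Fin n → Prop := fun r => ∃ j, r ≠ j ∧ ∀ σ, sw r j σ ∈ R
  let t : Fin n → Kind := fun r => if flip r ∈ R then Kind.B else if unb r then Kind.D else Kind.A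
  have htB : ∀ r, t r = Kind.B ↔ flip r ∈ R := by
    intro r; simp only [t]; split_ifs <;> simp_all
  have htA : ∀ r, t r = Kind.A ↔ ¬ flip r ∈ R ∧ ¬ unb r := by
    intro r; simp only [t]; split_ifs <;> simp_all
  have htD : ∀ r, t r = Kind.D → unb r := by
    intro r; simp only [t]; split_ifs <;> simp_all
  let ε : Fin n → ℤˣ := fun i => if t (b i) = Kind.A ∧ b i ≠ i ∧ sw (b i) i (-1) ∈ R then -1 else 1
  let g : SignedPerm n := ⟨1, ε⟩
  have hεn : ∀ i, t (b i) ≠ Kind.A → ε i = 1 := fun i h => by simp [ε, h]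
  -- the unique reflection between the base point and `i` in a block of kind `A`
  have hε : ∀ i, t (b i) = Kind.A → b i ≠ i → ∀ σ, sw (b i) i σ ∈ R ↔ σ = ε i := by
    intro i hA hi σ
    have hun : ¬ ∀ σ, sw (b i) i σ ∈ R := fun h => ((htA _).1 hA).2 ⟨i, hi, h⟩
    have hex : ∃ σ, sw (b i) i σ ∈ R := by
      rcases hb1 i with h | h
      · exact absurd h hi
      · exact h
    have h2 : ∀ σ : ℤˣ, σ = 1 ∨ σ = -1 := Int.units_eq_one_or
    obtain ⟨τ, hτ⟩ := hex
    by_cases h : sw (b i) i (-1) ∈ R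
    · have h1 : sw (b i) i 1 ∉ R := fun h1 => hun fun σ => by rcases h2 σ with rfl | rfl <;> assumption
      have : ε i = -1 := by simp [ε, hA, hi, h]
      rw [this]
      rcases h2 σ with rfl | rfl
      · simp [h1]
      · simp [h]
    · have h1 : sw (b i) i 1 ∈ R := by rcases h2 τ with rfl | rfl <;> tauto
      have : ε i = 1 := by simp [ε, h]
      rw [this]
      rcases h2 σ with rfl | rfl
      · simp [h1]
      · simp [h]
  have hεb : ∀ i, b i = i → ε i = 1 := fun i h => by simp [ε, h]
  have hA : ∀ i j, i ≠ j → b i = b j → t (b i) = Kind.A → ∀ σ, sw i j σ ∈ R ↔ σ = ε i * ε j := by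
    intro i j hij hbij hA
    have fwd : ∀ σ, sw i j σ ∈ R → σ = ε i * ε j := by
      intro σ h
      by_cases hi : b i = i
      · rw [hεb i hi, one_mul]
        have : b j ≠ j := by rw [← hbij, hi]; exact hij
        exact (hε j (hbij ▸ hA) this σ).1 (by rwa [← hbij, hi])
      · by_cases hj : b j = j
        · rw [hεb j hj, mul_one]
          refine (hε i hA hi σ).1 ?_
          rw [hbij, hj, sw_comm]
          exact h
        · have h1 := (hε i hA hi _).2 rfl
          have := sw_trans_mem hij (by rw [hbij]; exact hj) h1 h
          rw [hbij, hε j (hbij ▸ hA) hj] at this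
          rw [← this, ← mul_assoc, Int.units_mul_self, one_mul]
    refine fun σ => ⟨fwd σ, ?_⟩
    rintro rfl
    rcases (hb2 i j).1 hbij with h | ⟨τ, hτ⟩
    · exact absurd h hij
    · rwa [← fwd τ hτ]
  refine ⟨b, t, ?_, g, ?_⟩
  · intro i hi
    obtain ⟨j, hj, hs⟩ := htD _ hi
    by_cases hbi : b i = i
    · refine ⟨j, hbi ▸ hj, ?_⟩
      rw [hb2]
      exact Or.inr ⟨1, hbi ▸ hs 1⟩
    · exact ⟨b i, Ne.symm hbi, (hbb i).symm⟩
  · refine isReflectionSubgroup_blockSubgroup.eq_of_forall (hR.conj g) fun w hw => ?_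
    -- `g` is a diagonal involution, so the two directions of conjugation agree and `conj_sw`
    -- applies.
    have hginv : g⁻¹ = g := by ext <;> simp [g]
    rw [mem_map_conj]
    have hconj : g⁻¹ * w * g = g * w * g⁻¹ := by rw [hginv]
    rw [hconj]
    rcases hw.classify with ⟨i, rfl⟩ | ⟨i, j, σ, hij, rfl⟩
    · rw [conj_flip, flip_mem_blockSubgroup, htB]
      exact ⟨flip_mem_of_linked (hb1 i), flip_mem_of_linked ((linked R).symm (hb1 i))⟩
    · rw [conj_sw _ hij, sw_mem_blockSubgroup hij]
      change _ ↔ sw i j (ε i * σ * ε j) ∈ R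
      constructor
      · rintro ⟨hbij, hσ⟩
        by_cases hk : t (b i) = Kind.A
        · rw [hσ hk, mul_one, hA i j hij hbij hk]
        · rw [hεn i hk, hεn j (hbij ▸ hk), one_mul, mul_one]
          rcases hk' : t (b i) with _ | _ | _
          · exact absurd hk' hk
          · have hf : flip i ∈ R := flip_mem_of_linked (hb1 i) ((htB _).1 hk')
            rcases (hb2 i j).1 hbij with h | ⟨τ, hτ⟩
            · exact absurd h hij
            · rcases eq_or_ne σ τ with rfl | hne
              · exact hτ
              · rw [Int.units_ne_iff_eq_neg.1 hne]
                exact sw_neg_mem_of_flip_mem hij hf hτ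
          · obtain ⟨m, -, hs⟩ := htD _ hk'
            exact sw_mem_of_unbalanced hs (hb1 i) (hbij ▸ hb1 j) hij σ
      · intro h
        have hbij : b i = b j := (hb2 i j).2 (Or.inr ⟨_, h⟩)
        refine ⟨hbij, fun hk => ?_⟩
        rw [hA i j hij hbij hk] at h
        have h' := congrArg (fun u => ε i * u * ε j) h
        have e1 := Int.units_mul_self (ε i)
        have e2 := Int.units_mul_self (ε j)
        simp only [← mul_assoc, e1, one_mul] at h'
        rwa [mul_assoc, e2, mul_one] at h'

end SignedPerm

namespace SignedPerm

variable {n : ℕ}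

/-! ### Block types -/

theorem exists_equiv_of_card_fiber {α β γ : Type*} [Fintype α] [Fintype β] [DecidableEq γ]
    (f : α → γ) (g : β → γ)
    (h : ∀ c, (Finset.univ.filter fun a => f a = c).card = (Finset.univ.filter fun a => g a = c).card) :
    ∃ e : α ≃ β, ∀ a, g (e a) = f a := by
  have h' : ∀ c, Nonempty ({a // f a = c} ≃ {a // g a = c}) := by
    intro c
    rw [← Fintype.card_eq, Fintype.card_subtype, Fintype.card_subtype]
    exact h c
  refine ⟨Equiv.ofFiberEquiv fun c => (h' c).some, fun a => ?_⟩
  exact Equiv.ofFiberEquiv_map _ a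

section block

variable {ι ι' : Type*} [DecidableEq ι] [DecidableEq ι']

/-- The block with index `k`. -/
def fiber (b : Fin n → ι) (k : ι) : Finset (Fin n) := Finset.univ.filter fun i => b i = k

omit [DecidableEq ι'] in
@[simp] theorem mem_fiber {b : Fin n → ι} {k : ι} {i : Fin n} : i ∈ fiber b k ↔ b i = k := by
  simp [fiber]

/-- The sizes of the (nonempty) blocks of kind `κ`. -/
def blockType (b : Fin n → ι) (t : ι → Kind) (κ : Kind) : Multiset ℕ :=
  ((Finset.univ.image b).filter fun k => t k = κ).val.map fun k => (fiber b k).card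

variable {b : Fin n → ι} {t : ι → Kind} {b' : Fin n → ι'} {t' : ι' → Kind}

theorem blockType_eq_of_perm (g : Equiv.Perm (Fin n))
    (hb : ∀ i j, b i = b j ↔ b' (g i) = b' (g j)) (ht : ∀ i, t' (b' (g i)) = t (b i)) (κ : Kind) :
    blockType b t κ = blockType b' t' κ := by
  -- The total choice function `r` below needs an inhabited codomain.
  rcases isEmpty_or_nonempty (Fin n) with hn | hn
  · simp [blockType, Finset.univ_eq_empty]
  have hex : ∀ k ∈ (Finset.univ.image b).filter fun k => t k = κ, ∃ i, b i = k := by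
    intro k hk
    simpa using (Finset.mem_filter.1 hk).1
  choose! r hr using hex
  refine Multiset.map_eq_map_of_bij_of_nodup _ _ (Finset.nodup _) (Finset.nodup _)
    (fun k _ => b' (g (r k))) ?_ ?_ ?_ ?_
  · intro k hk
    have hk' := ((Finset.mem_filter (s := Finset.univ.image b)).1 hk).2
    simp [ht, hr k hk, hk']
  · intro k hk k' hk' h
    rw [← hr k hk, ← hr k' hk']
    exact (hb _ _).2 h
  · intro k' hk'
    simp only [Finset.mem_val, Finset.mem_filter, Finset.mem_image, Finset.mem_univ, true_and] at hk'
    obtain ⟨⟨i, rfl⟩, hi⟩ := hk'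
    obtain ⟨i, rfl⟩ := g.surjective i
    have hk : b i ∈ (Finset.univ.image b).filter fun k => t k = κ := by
      simp [← ht, hi]
    exact ⟨b i, hk, ((hb _ _).1 (hr _ hk))⟩
  · intro k hk
    refine Finset.card_bij (fun i _ => g i) ?_ (fun _ _ _ _ h => g.injective h) ?_
    · intro i hi
      rw [mem_fiber] at hi ⊢
      rw [← hb, hi, hr k hk]
    · intro j hj
      obtain ⟨i, rfl⟩ := g.surjective j
      refine ⟨i, ?_, rfl⟩
      rw [mem_fiber] at hj ⊢
      rw [← hb, hr k hk] at hj
      exact hj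

omit [DecidableEq ι'] in
theorem card_filter_eq_count_blockType (b : Fin n → ι) (t : ι → Kind) (c : Kind × ℕ) :
    ((Finset.univ : Finset (Finset.univ.image b)).filter fun k =>
      (t k.1, (fiber b k.1).card) = c).card = (blockType b t c.1).count c.2 := by
  rw [blockType, Multiset.count_map, ← Finset.filter_val, Finset.card_val, Finset.filter_filter]
  refine Finset.card_bij (fun k _ => k.1) ?_ (fun _ _ _ _ h => Subtype.ext h) ?_
  · rintro ⟨k, hk⟩ h
    rw [Finset.mem_filter] at h ⊢
    exact ⟨hk, congrArg Prod.fst h.2, (congrArg Prod.snd h.2).symm⟩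
  · intro k hk
    rw [Finset.mem_filter] at hk
    refine ⟨⟨k, hk.1⟩, ?_, rfl⟩
    rw [Finset.mem_filter]
    exact ⟨Finset.mem_univ _, Prod.ext hk.2.1 hk.2.2.symm⟩

/-- Two matchings by fibre sizes: first the nonempty blocks are matched by kind and size, then the
coordinates inside matched blocks. -/
theorem exists_perm_of_blockType_eq (h : ∀ κ, blockType b t κ = blockType b' t' κ) :
    ∃ g : Equiv.Perm (Fin n),
      (∀ i j, b i = b j ↔ b' (g i) = b' (g j)) ∧ ∀ i, t' (b' (g i)) = t (b i) := by
  let f : {k // k ∈ Finset.univ.image b} → Kind × ℕ := fun k => (t k, (fiber b k).card)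
  let f' : {k // k ∈ Finset.univ.image b'} → Kind × ℕ := fun k => (t' k, (fiber b' k).card)
  obtain ⟨e, he⟩ := exists_equiv_of_card_fiber f f' fun c => by
    have h1 := card_filter_eq_count_blockType b t c
    have h2 := card_filter_eq_count_blockType b' t' c
    rw [← h] at h2
    exact h1.trans h2.symm
  let β : Fin n → {k // k ∈ Finset.univ.image b} := fun i => ⟨b i, by simp⟩
  let β' : Fin n → {k // k ∈ Finset.univ.image b'} := fun i => ⟨b' i, by simp⟩
  obtain ⟨g, hg⟩ := exists_equiv_of_card_fiber (fun i => e (β i)) β' fun c => by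
    obtain ⟨k, rfl⟩ := e.surjective c
    have h1 : (Finset.univ.filter fun i => e (β i) = e k) = fiber b k := by
      ext i; simp [β, Subtype.ext_iff]
    have h2 : (Finset.univ.filter fun i => β' i = e k) = fiber b' (e k) := by
      ext i; simp [β', Subtype.ext_iff]
    rw [h1, h2]
    exact (congrArg Prod.snd (he k)).symm
  refine ⟨g, fun i j => ?_, fun i => ?_⟩
  · have h1 : b' (g i) = b' (g j) ↔ β' (g i) = β' (g j) := by simp [β', Subtype.ext_iff]
    rw [h1, hg, hg, e.injective.eq_iff]
    simp [β]
  · have h1 := congrArg Prod.fst (he (β i))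
    rw [← hg] at h1
    exact h1

theorem conjSubgroups_blockSubgroup_of_perm (g : Equiv.Perm (Fin n))
    (hb : ∀ i j, b i = b j ↔ b' (g i) = b' (g j)) (ht : ∀ i, t' (b' (g i)) = t (b i)) :
    ConjSubgroups (blockSubgroup b t) (blockSubgroup b' t') := by
  refine ⟨⟨g, 1⟩, ?_⟩
  refine isReflectionSubgroup_blockSubgroup.eq_of_forall
    (isReflectionSubgroup_blockSubgroup.conj _) fun w hw => ?_
  rw [mem_map_conj]
  obtain ⟨w, rfl⟩ : ∃ w', w = (⟨g, 1⟩ : SignedPerm n) * w' * (⟨g, 1⟩ : SignedPerm n)⁻¹ :=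
    ⟨(⟨g, 1⟩ : SignedPerm n)⁻¹ * w * ⟨g, 1⟩, by simp [mul_assoc]⟩
  have hw' : w.IsReflection := by
    have := hw.conj (⟨g, 1⟩ : SignedPerm n)⁻¹
    simpa [mul_assoc] using this
  rw [show (⟨g, 1⟩ : SignedPerm n)⁻¹ * (⟨g, 1⟩ * w * (⟨g, 1⟩ : SignedPerm n)⁻¹) * ⟨g, 1⟩ = w by
    simp [mul_assoc]]
  rcases hw'.classify with ⟨i, rfl⟩ | ⟨i, j, σ, hij, rfl⟩
  · rw [conj_flip, flip_mem_blockSubgroup, flip_mem_blockSubgroup, ht]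
  · rw [conj_sw _ hij, sw_mem_blockSubgroup hij,
      sw_mem_blockSubgroup (fun h => hij (g.injective h))]
    simp [hb, ht]

theorem conjSubgroups_of_blockType_eq (h : ∀ κ, blockType b t κ = blockType b' t' κ) :
    ConjSubgroups (blockSubgroup b t) (blockSubgroup b' t') := by
  obtain ⟨g, hg, hg'⟩ := exists_perm_of_blockType_eq h
  exact conjSubgroups_blockSubgroup_of_perm g hg hg'

/-- The right side refers only to reflections of the group, so the kind is intrinsic. The hypothesis
`hD` is essential: a one-element block of kind `D` would satisfy the right side. -/
theorem kind_eq_A_iff (hD : ∀ i, t (b i) = Kind.D → ∃ j, i ≠ j ∧ b i = b j) (i : Fin n) :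
    t (b i) = Kind.A ↔
      flip i ∉ blockSubgroup b t ∧ ¬ ∃ j, i ≠ j ∧ ∀ σ, sw i j σ ∈ blockSubgroup b t := by
  rw [flip_mem_blockSubgroup]
  constructor
  · intro h
    refine ⟨by simp [h], ?_⟩
    rintro ⟨j, hij, hs⟩
    have := ((sw_mem_blockSubgroup hij).1 (hs (-1))).2 h
    exact absurd this (by decide)
  · rintro ⟨h1, h2⟩
    rcases hk : t (b i) with _ | _ | _
    · rfl
    · exact absurd hk h1
    · obtain ⟨j, hij, hb⟩ := hD i hk
      exact absurd ⟨j, hij, fun σ => (sw_mem_blockSubgroup hij).2 ⟨hb, by simp [hk]⟩⟩ h2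

/-- Two coordinates share a block when some signed transposition of them lies in the group, and the
kinds are visible from the flips and the pairs with both signs. Neither criterion depends on the
signs of the conjugating `g`, so `g.perm` matches the blocks. -/
theorem blockType_eq_of_conjSubgroups (hD : ∀ i, t (b i) = Kind.D → ∃ j, i ≠ j ∧ b i = b j)
    (hD' : ∀ i, t' (b' i) = Kind.D → ∃ j, i ≠ j ∧ b' i = b' j)
    (h : ConjSubgroups (blockSubgroup b t) (blockSubgroup b' t')) (κ : Kind) :
    blockType b t κ = blockType b' t' κ := by
  obtain ⟨g, hg⟩ := h
  have hfl : ∀ i, flip (g.perm i) ∈ blockSubgroup b' t' ↔ flip i ∈ blockSubgroup b t := by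
    intro i
    rw [hg, ← conj_flip, conj_mem_map_conj]
  have hsw : ∀ i j σ, i ≠ j → (sw (g.perm i) (g.perm j) (g.sign i * σ * g.sign j) ∈
      blockSubgroup b' t' ↔ sw i j σ ∈ blockSubgroup b t) := by
    intro i j σ hij
    rw [hg, ← conj_sw g hij, conj_mem_map_conj]
  have hunit : ∀ (x y σ : ℤˣ), x * (x * σ * y) * y = σ := by
    intro x y σ
    rw [← mul_assoc, ← mul_assoc, Int.units_mul_self, one_mul, mul_assoc, Int.units_mul_self,
      mul_one]
  have hall : ∀ i j, i ≠ j → ((∀ σ, sw (g.perm i) (g.perm j) σ ∈ blockSubgroup b' t') ↔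
      ∀ σ, sw i j σ ∈ blockSubgroup b t) := by
    intro i j hij
    constructor
    · intro h σ
      exact (hsw i j σ hij).1 (h _)
    · intro h σ
      have := (hsw i j (g.sign i * σ * g.sign j) hij).2 (h _)
      rwa [hunit] at this
  have hb : ∀ i j, b i = b j ↔ b' (g.perm i) = b' (g.perm j) := by
    intro i j
    by_cases hij : i = j
    · simp [hij]
    have hij' : g.perm i ≠ g.perm j := fun h => hij (g.perm.injective h)
    constructor
    · intro h
      have h1 := (hsw i j 1 hij).2 ((sw_mem_blockSubgroup hij).2 ⟨h, fun _ => rfl⟩)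
      exact ((sw_mem_blockSubgroup hij').1 h1).1
    · intro h
      -- The inner sign is the one that conjugation by `g` turns into `1`.
      have h1 : sw (g.perm i) (g.perm j) (g.sign i * (g.sign i * 1 * g.sign j) * g.sign j) ∈
          blockSubgroup b' t' := by
        rw [hunit]
        exact (sw_mem_blockSubgroup hij').2 ⟨h, fun _ => rfl⟩
      exact ((sw_mem_blockSubgroup hij).1 ((hsw i j _ hij).1 h1)).1
  refine blockType_eq_of_perm g.perm hb (fun i => ?_) κ
  have hA : t' (b' (g.perm i)) = Kind.A ↔ t (b i) = Kind.A := by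
    rw [kind_eq_A_iff hD, kind_eq_A_iff hD', hfl]
    refine and_congr Iff.rfl (not_congr ?_)
    constructor
    · rintro ⟨j, hj, hs⟩
      obtain ⟨j, rfl⟩ := g.perm.surjective j
      have hij : i ≠ j := fun h => hj (h ▸ rfl)
      exact ⟨j, hij, (hall i j hij).1 hs⟩
    · rintro ⟨j, hj, hs⟩
      exact ⟨g.perm j, fun h => hj (g.perm.injective h), (hall i j hj).2 hs⟩
  have hB : t' (b' (g.perm i)) = Kind.B ↔ t (b i) = Kind.B := by
    rw [← flip_mem_blockSubgroup, ← flip_mem_blockSubgroup, hfl]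
  rcases h : t (b i) with _ | _ | _ <;> rcases h' : t' (b' (g.perm i)) with _ | _ | _ <;>
    simp_all

end block

end SignedPerm

/-! ### The block type of `W_λ` is `λ` -/

namespace RPartition

open SignedPerm

variable {n : ℕ}

theorem fiber_index (p : RPartition 3 n) (k : Fin p.composition.length) :
    (fiber p.composition.index k).card = p.composition.blocksFun k := by
  have : fiber p.composition.index k = Finset.univ.map (p.composition.embedding k).toEmbedding := by
    ext i
    rw [mem_fiber, eq_comm, ← Composition.mem_range_embedding_iff']
    simp
  rw [this]
  simp

theorem ofFn_kind_blocksFun (p : RPartition 3 n) :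
    List.ofFn (fun k => (p.kind k, p.composition.blocksFun k)) =
      ((p.parts 0).sort (· ≥ ·)).map (fun m => (Kind.A, m)) ++
        ((p.parts 1).sort (· ≥ ·)).map (fun m => (Kind.B, m)) ++
          ((p.parts 2).sort (· ≥ ·)).map (fun m => (Kind.D, m)) := by
  refine List.ext_getElem ?_ fun k h1 h2 => ?_
  · simp [Composition.length, composition]
  · simp only [List.getElem_ofFn, kind, Composition.blocksFun, composition, List.get_eq_getElem]
    simp only [List.getElem_append, List.length_append, List.length_map, Multiset.length_sort,
      List.getElem_map]
    split_ifs <;> first | rfl | omega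

/-- The parts of kind `κ`. -/
def partsOf (p : RPartition 3 n) : Kind → Multiset ℕ
  | Kind.A => p.parts 0
  | Kind.B => p.parts 1
  | Kind.D => p.parts 2

/-- The parts are positive, so every block is nonempty and each part is counted by `blockType`. -/
theorem blockType_eq (p : RPartition 3 n) (κ : Kind) :
    blockType p.composition.index p.kind κ = p.partsOf κ := by
  have himg : Finset.univ.image p.composition.index = Finset.univ := by
    ext k
    simp only [Finset.mem_image, Finset.mem_univ, true_and, iff_true]
    exact ⟨p.composition.embedding k ⟨0, p.composition.one_le_blocksFun k⟩,
      p.composition.index_embedding _ _⟩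
  have h1 : blockType p.composition.index p.kind κ =
      ((Finset.univ.val.map fun k => (p.kind k, p.composition.blocksFun k)).filter
        fun x => x.1 = κ).map Prod.snd := by
    rw [blockType, himg, Multiset.filter_map, Multiset.map_map, Finset.filter_val]
    simp only [fiber_index]
    rfl
  rw [h1, Fin.univ_val_map, ofFn_kind_blocksFun]
  simp only [← Multiset.coe_add, ← Multiset.map_coe, Multiset.sort_eq, Multiset.filter_add,
    Multiset.map_add, Multiset.filter_map, Multiset.map_map]
  rcases κ with _ | _ | _ <;> simp [partsOf]

theorem ext_of_partsOf {p q : RPartition 3 n} (h : ∀ κ, p.partsOf κ = q.partsOf κ) : p = q := by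
  ext1
  funext j
  fin_cases j
  · exact h Kind.A
  · exact h Kind.B
  · exact h Kind.D

end RPartition

namespace SignedPerm

variable {n : ℕ}

section block

variable {ι : Type*} [DecidableEq ι] {b : Fin n → ι} {t : ι → Kind}

theorem sum_blockType (b : Fin n → ι) (t : ι → Kind) (κ : Kind) :
    (blockType b t κ).sum = (Finset.univ.filter fun i => t (b i) = κ).card := by
  rw [Finset.card_eq_sum_card_fiberwise (f := b)
    (t := (Finset.univ.image b).filter fun k => t k = κ) (by intro i hi; simpa using hi)]
  rw [blockType, ← Finset.sum_eq_multiset_sum]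
  refine Finset.sum_congr rfl fun k hk => ?_
  congr 1
  ext i
  have := (Finset.mem_filter.1 hk).2
  simp only [mem_fiber, Finset.mem_filter, Finset.mem_univ, true_and]
  constructor
  · rintro rfl; exact ⟨this, rfl⟩
  · exact fun h => h.2

theorem pos_of_mem_blockType {κ : Kind} {s : ℕ} (h : s ∈ blockType b t κ) : 0 < s := by
  simp only [blockType, Multiset.mem_map, Finset.mem_val, Finset.mem_filter, Finset.mem_image,
    Finset.mem_univ, true_and] at h
  obtain ⟨_, ⟨⟨i, rfl⟩, -⟩, rfl⟩ := h
  exact Finset.card_pos.2 ⟨i, by simp⟩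

/-- This turns the condition `λ^3 > 1` into the form in which the arguments about block subgroups
use it. -/
theorem forall_one_lt_blockType_iff :
    (∀ s ∈ blockType b t Kind.D, 1 < s) ↔
      ∀ i, t (b i) = Kind.D → ∃ j, i ≠ j ∧ b i = b j := by
  constructor
  · intro h i hi
    have h1 : 1 < (fiber b (b i)).card := by
      refine h _ ?_
      rw [blockType]
      refine Multiset.mem_map_of_mem _ ?_
      simp [hi]
    obtain ⟨j, hj, hne⟩ := Finset.exists_mem_ne h1 i
    exact ⟨j, hne.symm, (mem_fiber.1 hj).symm⟩
  · intro h s hs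
    simp only [blockType, Multiset.mem_map, Finset.mem_val, Finset.mem_filter, Finset.mem_image,
      Finset.mem_univ, true_and] at hs
    obtain ⟨_, ⟨⟨i, rfl⟩, hi⟩, rfl⟩ := hs
    obtain ⟨j, hne, hj⟩ := h i hi
    exact Finset.one_lt_card.2 ⟨i, by simp, j, by simp [hj], hne⟩

/-! ### Parabolic closures -/

/-- All blocks of the kinds `B` and `D` are merged into one. -/
def mergeBlocks (b : Fin n → ι) (t : ι → Kind) (i : Fin n) : Option ι :=
  if t (b i) = Kind.A then some (b i) else none

/-- The merged block is of kind `B`, the others are of kind `A`. -/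
def mergeKind : Option ι → Kind
  | none => Kind.B
  | some _ => Kind.A

omit [DecidableEq ι] in
theorem mergeKind_mergeBlocks (i : Fin n) :
    mergeKind (mergeBlocks b t i) = Kind.A ↔ t (b i) = Kind.A := by
  rw [mergeBlocks]
  split_ifs with h <;> simp [mergeKind, h]

theorem eq_of_mem_fixedSpace {v : EuclideanSpace ℝ (Fin n)}
    (hv : v ∈ fixedSpace (blockSubgroup b t : Set (SignedPerm n))) {i j : Fin n} (hij : i ≠ j)
    (hb : b i = b j) {σ : ℤˣ} (hσ : t (b i) = Kind.A → σ = 1) : v i = ((σ : ℤ) : ℝ) * v j := by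
  have h := hv (sw i j σ) ((sw_mem_blockSubgroup hij).2 ⟨hb, hσ⟩)
  rw [rep_sw hij, sub_eq_self, smul_eq_zero] at h
  exact sub_eq_zero.1 (h.resolve_right (rt_ne_zero hij σ))

/-- For kind `B` the flip forces `v i = -v i`. For kind `D` a partner `j` gives both `v i = v j` and
`v i = -v j`. -/
theorem eq_zero_of_mem_fixedSpace (hD : ∀ i, t (b i) = Kind.D → ∃ j, i ≠ j ∧ b i = b j)
    {v : EuclideanSpace ℝ (Fin n)}
    (hv : v ∈ fixedSpace (blockSubgroup b t : Set (SignedPerm n))) {i : Fin n}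
    (hi : t (b i) ≠ Kind.A) : v i = 0 := by
  rcases hk : t (b i) with _ | _ | _
  · exact absurd hk hi
  · have h := hv (flip i) (flip_mem_blockSubgroup.2 hk)
    rw [rep_flip, sub_eq_self, smul_eq_zero] at h
    have := h.resolve_right (bv_ne_zero i)
    linarith
  · obtain ⟨j, hij, hb⟩ := hD i hk
    have h1 := eq_of_mem_fixedSpace hv hij hb (σ := 1) (by simp)
    have h2 := eq_of_mem_fixedSpace hv hij hb (σ := -1) (by simp [hk])
    simp at h1 h2
    linarith

/-- The indicator vector of a block of kind `A` is fixed by the group. An element fixing all these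
vectors preserves each such block without signs, and hence preserves the set of remaining
coordinates. Conversely, fixed vectors are constant on blocks of kind `A` and zero elsewhere, so
nothing further is imposed on the remaining coordinates. -/
theorem parabolicClosure_blockSubgroup
    (hD : ∀ i, t (b i) = Kind.D → ∃ j, i ≠ j ∧ b i = b j) :
    parabolicClosure (blockSubgroup b t : Set (SignedPerm n)) =
      blockSubgroup (mergeBlocks b t) mergeKind := by
  ext w
  constructor
  · intro hw
    have key : ∀ k, t k = Kind.A → ∀ i,
        ((w.sign i : ℤ) : ℝ) * (if b i = k then 1 else 0) = if b (w.perm i) = k then 1 else 0 := by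
      intro k hk i
      let u : EuclideanSpace ℝ (Fin n) := WithLp.toLp 2 fun i => if b i = k then 1 else 0
      have hu : u ∈ fixedSpace (blockSubgroup b t : Set (SignedPerm n)) := by
        intro v hv
        ext m
        obtain ⟨m, rfl⟩ := v.perm.surjective m
        rw [rep_apply_perm]
        simp only [u, hv.1 m]
        split_ifs with h
        · simp [hv.2.1 m (h ▸ hk)]
        · simp
      have h := congrArg (fun y => y (w.perm i)) (hw u hu)
      simp only [rep_apply_perm] at h
      exact h
    have h1 : ∀ i, t (b i) = Kind.A → b (w.perm i) = b i ∧ w.sign i = 1 := by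
      intro i hi
      have h := key (b i) hi i
      by_cases hb : b (w.perm i) = b i
      · refine ⟨hb, ?_⟩
        simp [hb] at h
        exact_mod_cast h
      · simp [hb] at h
    have h2 : ∀ i, t (b i) ≠ Kind.A → t (b (w.perm i)) ≠ Kind.A := by
      intro i hi h3
      have h := key (b (w.perm i)) h3 i
      have hb : b i ≠ b (w.perm i) := fun h => hi (h ▸ h3)
      simp [hb] at h
    refine ⟨fun i => ?_, fun i hi => (h1 i (mergeKind_mergeBlocks i |>.1 hi)).2, ?_⟩
    · by_cases hi : t (b i) = Kind.A
      · simp [mergeBlocks, (h1 i hi).1]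
      · simp [mergeBlocks, h2 i hi, hi]
    · rintro (_ | k) hk <;> simp [mergeKind] at hk
  · intro hw v hv
    ext m
    obtain ⟨i, rfl⟩ := w.perm.surjective m
    rw [rep_apply_perm]
    have h1 := hw.1 i
    by_cases hi : t (b i) = Kind.A
    · rw [hw.2.1 i (mergeKind_mergeBlocks i |>.2 hi)]
      have hb : b i = b (w.perm i) := by
        simp only [mergeBlocks, hi, if_true] at h1
        split_ifs at h1
        exact (Option.some.inj h1).symm
      by_cases hij : i = w.perm i
      · rw [← hij]; simp
      · rw [eq_of_mem_fixedSpace hv hij hb (fun _ => rfl)]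
        simp
    · have hi' : t (b (w.perm i)) ≠ Kind.A := by
        rw [ne_eq, ← mergeKind_mergeBlocks (b := b) (t := t), h1, mergeKind_mergeBlocks]
        exact hi
      rw [eq_zero_of_mem_fixedSpace hD hv hi, eq_zero_of_mem_fixedSpace hD hv hi', mul_zero]

theorem blockType_merge_A :
    blockType (mergeBlocks b t) mergeKind Kind.A = blockType b t Kind.A := by
  have h : (Finset.univ.image (mergeBlocks b t)).filter (fun k => mergeKind k = Kind.A) =
      ((Finset.univ.image b).filter fun k => t k = Kind.A).map Function.Embedding.some := by
    ext k
    simp only [Finset.mem_filter, Finset.mem_image, Finset.mem_univ, true_and, Finset.mem_map,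
      Function.Embedding.some_apply]
    constructor
    · rintro ⟨⟨i, rfl⟩, hi⟩
      rw [mergeKind_mergeBlocks] at hi
      exact ⟨b i, ⟨⟨i, rfl⟩, hi⟩, by simp [mergeBlocks, hi]⟩
    · rintro ⟨_, ⟨⟨i, rfl⟩, hi⟩, rfl⟩
      exact ⟨⟨i, by simp [mergeBlocks, hi]⟩, rfl⟩
  rw [blockType, h, Finset.map_val, Multiset.map_map]
  refine Multiset.map_congr rfl fun k hk => ?_
  have hk' := ((Finset.mem_filter (s := Finset.univ.image b)).1 hk).2
  simp only [Function.comp, Function.Embedding.some_apply]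
  congr 1
  ext i
  simp only [mem_fiber, mergeBlocks]
  constructor
  · intro h
    split_ifs at h
    exact Option.some.inj h
  · rintro rfl
    simp [hk']

theorem blockType_merge_D : blockType (mergeBlocks b t) mergeKind Kind.D = 0 := by
  rw [blockType]
  have : (Finset.univ.image (mergeBlocks b t)).filter (fun k => mergeKind k = Kind.D) = ∅ := by
    refine Finset.filter_eq_empty_iff.2 fun k _ => ?_
    cases k <;> simp [mergeKind]
  simp [this]

/-- Only nonempty blocks are recorded, so the filter drops the size `0` that arises when all blocks
are of kind `A`. -/
theorem blockType_merge_B : blockType (mergeBlocks b t) mergeKind Kind.B =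
    ({n - (blockType b t Kind.A).sum} : Multiset ℕ).filter (0 < ·) := by
  have hc : (fiber (mergeBlocks b t) none).card = n - (blockType b t Kind.A).sum := by
    rw [sum_blockType]
    have h := Finset.card_filter_add_card_filter_not (s := (Finset.univ : Finset (Fin n)))
      (fun i => t (b i) = Kind.A)
    have h2 : fiber (mergeBlocks b t) none = Finset.univ.filter fun i => ¬ t (b i) = Kind.A := by
      ext i
      simp [mergeBlocks]
    rw [h2]
    simp only [Finset.card_univ, Fintype.card_fin] at h
    omega
  rw [← hc, Multiset.filter_singleton, blockType]
  split_ifs with h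
  · have : (Finset.univ.image (mergeBlocks b t)).filter (fun k => mergeKind k = Kind.B) =
        {none} := by
      ext k
      simp only [Finset.mem_filter, Finset.mem_image, Finset.mem_univ, true_and,
        Finset.mem_singleton]
      constructor
      · rintro ⟨-, hk⟩
        cases k
        · rfl
        · simp [mergeKind] at hk
      · rintro rfl
        obtain ⟨i, hi⟩ := Finset.card_pos.1 h
        exact ⟨⟨i, mem_fiber.1 hi⟩, rfl⟩
    simp [this]
  · have : (Finset.univ.image (mergeBlocks b t)).filter (fun k => mergeKind k = Kind.B) = ∅ := by
      refine Finset.filter_eq_empty_iff.2 fun k hk hk' => ?_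
      cases k
      · simp only [Finset.mem_image, Finset.mem_univ, true_and] at hk
        obtain ⟨i, hi⟩ := hk
        exact h (Finset.card_pos.2 ⟨i, by simp [hi]⟩)
      · simp [mergeKind] at hk'
    simp [this]

end block

end SignedPerm

/-! ### Parabolic closures and classification in terms of triple partitions -/

namespace RPartition

open SignedPerm

variable {n : ℕ}

theorem exists_ne_index_of_kind_eq_D {p : RPartition 3 n} (hp : ∀ k ∈ p.parts 2, 1 < k) :
    ∀ i, p.kind (p.composition.index i) = Kind.D →
      ∃ j, i ≠ j ∧ p.composition.index i = p.composition.index j := by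
  rw [← forall_one_lt_blockType_iff, blockType_eq]
  exact hp

theorem conjSubgroups_parabolicClosure {p : RPartition 3 n} (hp : ∀ k ∈ p.parts 2, 1 < k) :
    ConjSubgroups (parabolicClosure (p.subgroup : Set (SignedPerm n))) p.closure.subgroup := by
  rw [subgroup, parabolicClosure_blockSubgroup (exists_ne_index_of_kind_eq_D hp)]
  refine conjSubgroups_of_blockType_eq fun κ => ?_
  rw [blockType_eq]
  rcases κ with _ | _ | _
  · rw [blockType_merge_A, blockType_eq]; rfl
  · rw [blockType_merge_B, blockType_eq]; rfl
  · rw [blockType_merge_D]; rfl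

/-- The triple partition given by the block sizes of a labelled set partition. -/
def ofBlocks {ι : Type*} [DecidableEq ι] (b : Fin n → ι) (t : ι → Kind) : RPartition 3 n where
  parts := ![blockType b t Kind.A, blockType b t Kind.B, blockType b t Kind.D]
  parts_pos := by
    intro j i hi
    fin_cases j <;> exact pos_of_mem_blockType hi
  parts_sum := by
    rw [Fin.sum_univ_three]
    change (blockType b t Kind.A).sum + (blockType b t Kind.B).sum + (blockType b t Kind.D).sum = n
    simp only [sum_blockType]
    rw [← Finset.card_union_of_disjoint, ← Finset.card_union_of_disjoint]
    · rw [← Finset.filter_or, ← Finset.filter_or, Finset.filter_true_of_mem]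
      · simp
      · intro i _
        rcases t (b i) <;> simp
    · rw [← Finset.filter_or, Finset.disjoint_filter]
      rintro i - (h | h) <;> simp [h]
    · rw [Finset.disjoint_filter]
      rintro i - h
      simp [h]

theorem partsOf_ofBlocks {ι : Type*} [DecidableEq ι] (b : Fin n → ι) (t : ι → Kind) (κ : Kind) :
    (ofBlocks b t).partsOf κ = blockType b t κ := by
  cases κ <;> rfl

theorem eq_of_conjSubgroups {p q : RPartition 3 n} (hp : ∀ k ∈ p.parts 2, 1 < k)
    (hq : ∀ k ∈ q.parts 2, 1 < k) (h : ConjSubgroups p.subgroup q.subgroup) : p = q := by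
  refine ext_of_partsOf fun κ => ?_
  rw [← blockType_eq, ← blockType_eq]
  exact blockType_eq_of_conjSubgroups (exists_ne_index_of_kind_eq_D hp)
    (exists_ne_index_of_kind_eq_D hq) h κ

theorem conjSubgroups_symm {R R' : Subgroup (SignedPerm n)} (h : ConjSubgroups R R') :
    ConjSubgroups R' R := by
  obtain ⟨g, rfl⟩ := h
  refine ⟨g⁻¹, ?_⟩
  ext w
  rw [mem_map_conj, mem_map_conj]
  simp [mul_assoc]

theorem conjSubgroups_trans {R R' R'' : Subgroup (SignedPerm n)} (h : ConjSubgroups R R')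
    (h' : ConjSubgroups R' R'') : ConjSubgroups R R'' := by
  obtain ⟨g, rfl⟩ := h
  obtain ⟨g', rfl⟩ := h'
  refine ⟨g' * g, ?_⟩
  ext w
  rw [mem_map_conj, mem_map_conj, mem_map_conj]
  simp [mul_assoc]

theorem existsUnique_conjSubgroups {R : Subgroup (SignedPerm n)} (hR : IsReflectionSubgroup R) :
    ∃! p : RPartition 3 n, (∀ k ∈ p.parts 2, 1 < k) ∧ ConjSubgroups R p.subgroup := by
  obtain ⟨b, t, hD, hc⟩ := hR.exists_conj_blockSubgroup
  refine ⟨ofBlocks b t, ⟨forall_one_lt_blockType_iff.2 hD, conjSubgroups_trans hc ?_⟩, ?_⟩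
  · refine conjSubgroups_of_blockType_eq fun κ => ?_
    rw [blockType_eq, partsOf_ofBlocks]
  · rintro q ⟨hq, hq'⟩
    refine eq_of_conjSubgroups hq (forall_one_lt_blockType_iff.2 hD)
      (conjSubgroups_trans (conjSubgroups_symm hq') (conjSubgroups_trans hc ?_))
    refine conjSubgroups_of_blockType_eq fun κ => ?_
    rw [blockType_eq, partsOf_ofBlocks]

end RPartition

namespace SignedPerm

variable {n : ℕ}

/-! ### The signed cycle type is a complete conjugacy invariant -/

/-- The cycle of `w` through `i`. -/
def cyc (w : SignedPerm n) (i : Fin n) : Finset (Fin n) :=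
  Finset.univ.filter fun j => w.perm.SameCycle i j

theorem mem_cyc {w : SignedPerm n} {i j : Fin n} : j ∈ cyc w i ↔ w.perm.SameCycle i j := by
  simp [cyc]

theorem cyc_eq_cyc_iff {w : SignedPerm n} {i j : Fin n} :
    cyc w i = cyc w j ↔ w.perm.SameCycle i j := by
  constructor
  · intro h
    rw [← mem_cyc, h, mem_cyc]
  · intro h
    ext m
    rw [mem_cyc, mem_cyc]
    exact ⟨fun h' => h.symm.trans h', fun h' => h.trans h'⟩

/-- The kind `A` stands for the positive cycles, the kind `B` for the negative ones. -/
def cycKind (w : SignedPerm n) (o : Finset (Fin n)) : Kind :=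
  if ∏ i ∈ o, w.sign i = 1 then Kind.A else Kind.B

theorem prod_units_eq (s : Fin n → ℤˣ) (o : Finset (Fin n)) :
    ∏ i ∈ o, s i = (-1) ^ (o.filter fun i => s i = -1).card := by
  rw [← Finset.prod_const, Finset.prod_filter]
  refine Finset.prod_congr rfl fun i _ => ?_
  rcases Int.units_eq_one_or (s i) with h | h <;> simp [h]

theorem cycKind_eq_A_iff (w : SignedPerm n) (o : Finset (Fin n)) :
    cycKind w o = Kind.A ↔ Even (o.filter fun i => w.sign i = -1).card := by
  rw [← neg_one_pow_eq_one_iff_even (show (-1 : ℤˣ) ≠ 1 by decide), ← prod_units_eq, cycKind]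
  split_ifs with h <;> simp [h]

theorem cycKind_eq_B_iff (w : SignedPerm n) (o : Finset (Fin n)) :
    cycKind w o = Kind.B ↔ Odd (o.filter fun i => w.sign i = -1).card := by
  rw [← Nat.not_even_iff_odd, ← cycKind_eq_A_iff, cycKind]
  split_ifs <;> simp

/-- The cycles of `w`, labelled by their signs, form a labelled set partition, so the results on
block types apply to cycle types. -/
theorem blockType_cyc (w : SignedPerm n) (κ : Kind) :
    blockType (cyc w) (cycKind w) κ =
      ((cycles w).filter fun o => cycKind w o = κ).val.map Finset.card := by
  refine Multiset.map_congr rfl fun o ho => ?_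
  have ho' := ((Finset.mem_filter (s := Finset.univ.image (cyc w))).1 ho).1
  obtain ⟨i, -, rfl⟩ := Finset.mem_image.1 ho'
  congr 1
  ext j
  rw [mem_fiber, cyc_eq_cyc_iff, mem_cyc]
  exact ⟨fun h => h.symm, fun h => h.symm⟩

theorem cycleType_eq (w : SignedPerm n) :
    w.cycleType = (blockType (cyc w) (cycKind w) Kind.A, blockType (cyc w) (cycKind w) Kind.B) := by
  simp only [blockType_cyc, cycKind_eq_A_iff, cycKind_eq_B_iff]
  rfl

theorem blockType_cyc_D (w : SignedPerm n) : blockType (cyc w) (cycKind w) Kind.D = 0 := by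
  have : (cycles w).filter (fun o => cycKind w o = Kind.D) = ∅ := by
    refine Finset.filter_eq_empty_iff.2 fun o _ => ?_
    rw [cycKind]
    split_ifs <;> simp
  rw [blockType_cyc, this]
  rfl

/-- The projection to the symmetric group. -/
def permHom (n : ℕ) : SignedPerm n →* Equiv.Perm (Fin n) where
  toFun := perm
  map_one' := rfl
  map_mul' _ _ := rfl

@[simp] theorem zpow_perm (w : SignedPerm n) (k : ℤ) : (w ^ k).perm = w.perm ^ k :=
  map_zpow (permHom n) w k

@[simp] theorem pow_perm (w : SignedPerm n) (k : ℕ) : (w ^ k).perm = w.perm ^ k :=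
  map_pow (permHom n) w k

theorem cyc_conj (g w : SignedPerm n) (i : Fin n) :
    cyc (g * w * g⁻¹) (g.perm i) = (cyc w i).map g.perm.toEmbedding := by
  ext j
  obtain ⟨j, rfl⟩ := g.perm.surjective j
  rw [mem_cyc]
  simp [Equiv.Perm.sameCycle_conj, mem_cyc]

/-- Around the cycle every sign of `g` enters twice, once from each side of the conjugation, and
cancels. -/
theorem cycKind_conj (g w : SignedPerm n) (i : Fin n) :
    cycKind (g * w * g⁻¹) (cyc (g * w * g⁻¹) (g.perm i)) = cycKind w (cyc w i) := by
  have h : ∏ j ∈ cyc (g * w * g⁻¹) (g.perm i), (g * w * g⁻¹).sign j = ∏ j ∈ cyc w i, w.sign j := by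
    rw [cyc_conj, Finset.prod_map]
    have h1 : ∀ j, (g * w * g⁻¹).sign (g.perm.toEmbedding j) =
        g.sign j * w.sign j * g.sign (w.perm j) := by
      intro j
      simp [mul_assoc]
    simp only [h1, Finset.prod_mul_distrib]
    have h2 : ∏ j ∈ cyc w i, g.sign (w.perm j) = ∏ j ∈ cyc w i, g.sign j :=
      Finset.prod_equiv w.perm (fun j => by simp [mem_cyc]) (fun _ _ => rfl)
    rw [h2, mul_right_comm, Int.units_mul_self, one_mul]
  rw [cycKind, h]
  rfl

theorem cycleType_conj (g w : SignedPerm n) : (g * w * g⁻¹).cycleType = w.cycleType := by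
  have h := blockType_eq_of_perm (b := cyc w) (t := cycKind w) (b' := cyc (g * w * g⁻¹))
    (t' := cycKind (g * w * g⁻¹)) g.perm
    (fun i j => by
      rw [cyc_conj, cyc_conj]
      exact (Finset.map_injective _).eq_iff.symm)
    (cycKind_conj g w)
  rw [cycleType_eq, cycleType_eq, h, h]

theorem card_cyc (w : SignedPerm n) (r : Fin n) :
    (cyc w r).card = Function.minimalPeriod (w.perm • ·) r := by
  classical
  rw [MulAction.minimalPeriod_eq_card, ← Set.toFinset_card]
  congr 1
  ext j
  rw [mem_cyc, Set.mem_toFinset]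
  simp only [Equiv.Perm.SameCycle, MulAction.mem_orbit_iff, Subgroup.exists_zpowers]
  rfl

theorem zpow_apply_eq_self_iff (w : SignedPerm n) (r : Fin n) (m : ℤ) :
    (w ^ m).perm r = r ↔ ((cyc w r).card : ℤ) ∣ m := by
  rw [card_cyc, ← MulAction.zpow_smul_eq_iff_minimalPeriod_dvd, zpow_perm]
  rfl

theorem pow_sign (w : SignedPerm n) (k : ℕ) (r : Fin n) :
    (w ^ k).sign r = ∏ j ∈ Finset.range k, w.sign ((w.perm ^ j) r) := by
  induction k with
  | zero => simp
  | succ k ih => rw [pow_succ', mul_sign, ih, Finset.prod_range_succ, pow_perm]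

/-- One full turn starting at `r` visits every point of the cycle once and collects all its signs.
-/
theorem pow_card_cyc_sign (w : SignedPerm n) (r : Fin n) :
    (w ^ (cyc w r).card).sign r = ∏ i ∈ cyc w r, w.sign i := by
  have hinj : Set.InjOn (fun j => (w.perm ^ j) r) (Finset.range (cyc w r).card) := by
    intro j hj k hk h
    have h1 : (w ^ ((j : ℤ) - k)).perm r = r := by
      rw [zpow_perm, sub_eq_neg_add, zpow_add, zpow_neg, zpow_natCast, zpow_natCast,
        Equiv.Perm.mul_apply, Equiv.Perm.inv_eq_iff_eq]
      exact h
    rw [zpow_apply_eq_self_iff] at h1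
    simp only [Finset.coe_range, Set.mem_Iio] at hj hk
    have := Int.eq_zero_of_abs_lt_dvd h1 (by rw [abs_lt]; omega)
    omega
  have himg : (Finset.range (cyc w r).card).image (fun j => (w.perm ^ j) r) = cyc w r := by
    refine Finset.eq_of_subset_of_card_le ?_ ?_
    · intro j hj
      obtain ⟨k, -, rfl⟩ := Finset.mem_image.1 hj
      rw [mem_cyc]
      exact ⟨k, by simp⟩
    · rw [Finset.card_image_of_injOn hinj, Finset.card_range]
  rw [pow_sign]
  conv_rhs => rw [← himg]
  rw [Finset.prod_image hinj]

/-- An exponent that fixes `r` is a multiple of the cycle length, so one full turn suffices, and its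
sign is that of the cycle. The subgroup `H` passes from one turn to all integer multiples. -/
theorem zpow_sign_eq {w w' : SignedPerm n} {r r' : Fin n} (hc : (cyc w r).card = (cyc w' r').card)
    (hs : ∏ i ∈ cyc w r, w.sign i = ∏ i ∈ cyc w' r', w'.sign i) {m : ℤ}
    (hm : (w ^ m).perm r = r) : (w ^ m).sign r = (w' ^ m).sign r' := by
  let H : Subgroup (SignedPerm n × SignedPerm n) :=
    { carrier := {u | u.1.perm r = r ∧ u.2.perm r' = r' ∧ u.1.sign r = u.2.sign r'}
      one_mem' := by simp
      mul_mem' := by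
        rintro u v ⟨h1, h2, h3⟩ ⟨h4, h5, h6⟩
        simp [h1, h2, h3, h4, h5, h6]
      inv_mem' := by
        rintro u ⟨h1, h2, h3⟩
        have h1' : u.1.perm⁻¹ r = r := Equiv.Perm.inv_eq_iff_eq.2 h1.symm
        have h2' : u.2.perm⁻¹ r' = r' := Equiv.Perm.inv_eq_iff_eq.2 h2.symm
        exact ⟨h1', h2', by
          rw [Prod.fst_inv, Prod.snd_inv, inv_sign, inv_sign, h1', h2', h3]⟩ }
  obtain ⟨q, rfl⟩ := (zpow_apply_eq_self_iff w r m).1 hm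
  have h : ((w, w') ^ (cyc w r).card : SignedPerm n × SignedPerm n) ∈ H := by
    refine ⟨?_, ?_, ?_⟩
    · have := (zpow_apply_eq_self_iff w r (cyc w r).card).2 dvd_rfl
      simpa using this
    · have := (zpow_apply_eq_self_iff w' r' (cyc w r).card).2 (by rw [hc])
      simpa using this
    · change (w ^ (cyc w r).card).sign r = (w' ^ (cyc w r).card).sign r'
      rw [pow_card_cyc_sign, hc, pow_card_cyc_sign, hs]
  have h2 := H.zpow_mem h q
  rw [← zpow_natCast, ← zpow_mul] at h2
  exact h2.2.2

/-- A bijection `g` matches the cycles by length and sign. Choose a base point `r` in each cycle of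
`w` and send `w ^ k r` to `w' ^ k (g r)`, with the sign collected along both orbits. The exponent is
defined only up to multiples of the cycle length, which has no effect because matched cycles have
the same length and sign. -/
theorem isConj_of_cycleType_eq {w w' : SignedPerm n} (h : w.cycleType = w'.cycleType) :
    IsConj w w' := by
  rw [cycleType_eq, cycleType_eq, Prod.mk.injEq] at h
  obtain ⟨g, hg, hg'⟩ := exists_perm_of_blockType_eq (b := cyc w) (t := cycKind w) (b' := cyc w')
    (t' := cycKind w') fun κ => by
      rcases κ with _ | _ | _
      · exact h.1
      · exact h.2
      · rw [blockType_cyc_D, blockType_cyc_D]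
  have hcard : ∀ i, (cyc w i).card = (cyc w' (g i)).card := by
    intro i
    refine Finset.card_bij (fun j _ => g j) ?_ (fun _ _ _ _ h => g.injective h) ?_
    · intro j hj
      rw [mem_cyc, ← cyc_eq_cyc_iff] at hj ⊢
      exact (hg _ _).1 hj
    · intro j hj
      obtain ⟨j, rfl⟩ := g.surjective j
      refine ⟨j, ?_, rfl⟩
      rw [mem_cyc, ← cyc_eq_cyc_iff] at hj ⊢
      exact (hg _ _).2 hj
  have hsign : ∀ i, ∏ j ∈ cyc w i, w.sign j = ∏ j ∈ cyc w' (g i), w'.sign j := by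
    intro i
    have := hg' i
    simp only [cycKind] at this
    split_ifs at this with h1 h2 h2
    · rw [h1, h2]
    · rw [(Int.units_eq_one_or _).resolve_left h1, (Int.units_eq_one_or _).resolve_left h2]
  let S : Setoid (Fin n) := Equiv.Perm.SameCycle.setoid w.perm
  let r : Fin n → Fin n := fun i => (Quotient.mk S i).out
  have hr : ∀ i, w.perm.SameCycle (r i) i := fun i => Quotient.mk_out (s := S) i
  have hr' : ∀ i j, w.perm.SameCycle i j → r i = r j := by
    intro i j hij
    have : Quotient.mk S i = Quotient.mk S j := Quotient.sound hij
    simp only [r, this]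
  choose k hk using id hr
  have hper : ∀ i (m : ℤ), (w ^ m).perm i = i ↔ (w' ^ m).perm (g i) = g i := by
    intro i m
    rw [zpow_apply_eq_self_iff, zpow_apply_eq_self_iff, hcard]
  -- transport along the orbits does not depend on the exponent
  have hind : ∀ i (m l : ℤ), (w ^ m).perm i = (w ^ l).perm i →
      (w' ^ m).perm (g i) = (w' ^ l).perm (g i) ∧
        (w ^ m).sign i * (w' ^ m).sign (g i) = (w ^ l).sign i * (w' ^ l).sign (g i) := by
    intro i m l hml
    have h1 : (w ^ (m - l)).perm i = i := by
      rw [sub_eq_neg_add, zpow_add, zpow_neg, mul_perm, inv_perm, Equiv.Perm.mul_apply, hml,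
        Equiv.Perm.inv_eq_iff_eq]
    have h2 := (hper i _).1 h1
    have h3 := zpow_sign_eq (hcard i) (hsign i) h1
    have e : m = l + (m - l) := by ring
    have hw : w ^ m = w ^ l * w ^ (m - l) := by rw [← zpow_add, ← e]
    have hw' : w' ^ m = w' ^ l * w' ^ (m - l) := by rw [← zpow_add, ← e]
    constructor
    · rw [hw', mul_perm, Equiv.Perm.mul_apply, h2]
    · rw [hw, hw', mul_sign, mul_sign, h1, h2, h3, mul_mul_mul_comm, Int.units_mul_self, one_mul]
  let π : Fin n → Fin n := fun i => (w' ^ k i).perm (g (r i))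
  let ε : Fin n → ℤˣ := fun i => (w ^ k i).sign (r i) * (w' ^ k i).sign (g (r i))
  have hπinj : Function.Injective π := by
    intro i j hij
    have h1 : w'.perm.SameCycle (g (r i)) (g (r j)) := by
      refine Equiv.Perm.SameCycle.trans (y := π i) ⟨k i, by simp [π]⟩ ?_
      rw [hij]
      exact Equiv.Perm.SameCycle.symm ⟨k j, by simp [π]⟩
    rw [← cyc_eq_cyc_iff, ← hg, cyc_eq_cyc_iff] at h1
    have h2 : r i = r j := hr' _ _ (((hr i).symm.trans h1).trans (hr j))
    have h3 : (w' ^ (k i - k j)).perm (g (r i)) = g (r i) := by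
      rw [sub_eq_neg_add, zpow_add, zpow_neg, mul_perm, inv_perm, Equiv.Perm.mul_apply,
        Equiv.Perm.inv_eq_iff_eq]
      simp only [π] at hij
      rw [hij, h2]
    rw [← hper, sub_eq_neg_add, zpow_add, zpow_neg, mul_perm, inv_perm, Equiv.Perm.mul_apply,
      Equiv.Perm.inv_eq_iff_eq, zpow_perm, zpow_perm, hk, h2, hk] at h3
    exact h3
  let c : SignedPerm n := ⟨Equiv.ofBijective π (Finite.injective_iff_bijective.1 hπinj), ε⟩
  have hcp : ∀ i, c.perm i = (w' ^ k i).perm (g (r i)) := fun i => rfl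
  have hcs : ∀ i, c.sign i = (w ^ k i).sign (r i) * (w' ^ k i).sign (g (r i)) := fun i => rfl
  have hstep : ∀ i, c.perm (w.perm i) = w'.perm (c.perm i) ∧
      w.sign i * c.sign (w.perm i) = c.sign i * w'.sign (c.perm i) := by
    intro i
    have hri : r (w.perm i) = r i := hr' _ _ (Equiv.Perm.SameCycle.symm ⟨1, by simp⟩)
    -- The chosen exponent of `w i` and `1 + k i` may differ, but they lead to the same point, so
    -- `hind` applies.
    have h1 : (w ^ k (w.perm i)).perm (r i) = (w ^ (1 + k i)).perm (r i) := by
      rw [zpow_add, zpow_one, mul_perm, Equiv.Perm.mul_apply, zpow_perm, zpow_perm, hk, ← hri, hk]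
    obtain ⟨h2, h3⟩ := hind _ _ _ h1
    constructor
    · rw [hcp, hcp, hri, h2, zpow_add, zpow_one]
      rfl
    · rw [hcs, hcs, hcp, hri, h3, zpow_add, zpow_add, zpow_one, zpow_one, mul_sign, mul_sign,
        zpow_perm w, hk]
      have := Int.units_mul_self (w.sign i)
      calc _ = w.sign i * w.sign i * ((w ^ k i).sign (r i) * (w' ^ k i).sign (g (r i)) *
            w'.sign ((w' ^ k i).perm (g (r i)))) := by
              simp only [mul_assoc, mul_left_comm, mul_comm]
        _ = _ := by rw [this, one_mul]
  rw [isConj_iff]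
  refine ⟨c, ?_⟩
  rw [mul_inv_eq_iff_eq_mul]
  ext i
  · exact congrArg Fin.val (hstep i).1
  · exact congrArg Units.val (hstep i).2

end SignedPerm

namespace SignedPerm

variable {n : ℕ}

/-! ### Simple systems -/

section block

variable {ι : Type*} [DecidableEq ι] {b : Fin n → ι} {t : ι → Kind} {x : Fin n → ℝ}

/-- With respect to the heights `x`, the index `j` is the next one below `i` in its block. -/
def Adj (b : Fin n → ι) (x : Fin n → ℝ) (i j : Fin n) : Prop :=
  b i = b j ∧ x j < x i ∧ ∀ m, b m = b i → x m ≤ x j ∨ x i ≤ x m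

/-- The index `i` is the lowest one in its block. -/
def Last (b : Fin n → ι) (x : Fin n → ℝ) (i : Fin n) : Prop := ∀ m, b m = b i → x i ≤ x m

/-- Different indices of a block have different heights. -/
def InjOnBlocks (b : Fin n → ι) (x : Fin n → ℝ) : Prop := ∀ i j, b i = b j → x i = x j → i = j

omit [DecidableEq ι] in
theorem Adj.not_last {i j : Fin n} (h : Adj b x i j) : ¬ Last b x i :=
  fun hl => absurd (hl j h.1.symm) (not_le.2 h.2.1)

omit [DecidableEq ι] in
theorem Adj.ne {i j : Fin n} (h : Adj b x i j) : i ≠ j := by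
  rintro rfl
  exact lt_irrefl _ h.2.1

omit [DecidableEq ι] in
theorem Last.eq (hx : InjOnBlocks b x) {i j : Fin n} (hi : Last b x i) (hj : Last b x j)
    (h : b i = b j) : i = j :=
  hx i j h (le_antisymm (hi j h.symm) (hj i h))

theorem exists_adj {i : Fin n} (h : ¬ Last b x i) : ∃ j, Adj b x i j := by
  rw [Last] at h
  push Not at h
  obtain ⟨m, hm, hlt⟩ := h
  obtain ⟨j, hj, hmax⟩ := Finset.exists_max_image
    (Finset.univ.filter fun j => b j = b i ∧ x j < x i) x ⟨m, by simp [hm, hlt]⟩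
  simp only [Finset.mem_filter, Finset.mem_univ, true_and] at hj hmax
  refine ⟨j, hj.1.symm, hj.2, fun k hk => ?_⟩
  by_cases h : x k < x i
  · exact Or.inl (hmax k ⟨hk, h⟩)
  · exact Or.inr (not_lt.1 h)

theorem exists_last (b : Fin n → ι) (x : Fin n → ℝ) (i : Fin n) :
    ∃ l, b l = b i ∧ Last b x l := by
  obtain ⟨l, hl, hmin⟩ := Finset.exists_min_image (fiber b (b i)) x ⟨i, by simp⟩
  rw [mem_fiber] at hl
  exact ⟨l, hl, fun m hm => hmin m (by simp [hm, hl])⟩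

theorem Last.exists_adj (hx : InjOnBlocks b x) {i j : Fin n} (hi : Last b x i) (hij : i ≠ j)
    (hb : b i = b j) : ∃ p, Adj b x p i := by
  obtain ⟨p, hp, hmin⟩ := Finset.exists_min_image
    (Finset.univ.filter fun j => b j = b i ∧ i ≠ j) x ⟨j, by simp [hb, hij]⟩
  simp only [Finset.mem_filter, Finset.mem_univ, true_and] at hp hmin
  refine ⟨p, hp.1, lt_of_le_of_ne (hi p hp.1) fun h => hp.2 (hx i p hp.1.symm h), fun m hm => ?_⟩
  by_cases h : i = m
  · exact Or.inl (by rw [h])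
  · exact Or.inr (hmin m ⟨hm.trans hp.1, h⟩)

open Classical in
/-- The next index below `i` in its block. -/
noncomputable def nx (b : Fin n → ι) (x : Fin n → ℝ) (i : Fin n) : Fin n :=
  if h : ∃ j, Adj b x i j then h.choose else i

open Classical in
/-- The next index above `i` in its block. -/
noncomputable def pv (b : Fin n → ι) (x : Fin n → ℝ) (i : Fin n) : Fin n :=
  if h : ∃ j, Adj b x j i then h.choose else i

theorem adj_nx {i : Fin n} (h : ¬ Last b x i) : Adj b x i (nx b x i) := by
  have := exists_adj h
  rw [nx, dif_pos this]
  exact this.choose_spec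

theorem Last.adj_pv (hx : InjOnBlocks b x)
    (hD : ∀ i, t (b i) = Kind.D → ∃ j, i ≠ j ∧ b i = b j) {i : Fin n} (hi : Last b x i)
    (h : t (b i) = Kind.D) : Adj b x (pv b x i) i := by
  obtain ⟨j, hij, hb⟩ := hD i h
  have := hi.exists_adj hx hij hb
  rw [pv, dif_pos this]
  exact this.choose_spec

open Classical in
/-- The simple root attached to the index `i`. The lowest indices of the blocks of kind `A` are
treated here as in the blocks of kind `B`, which yields a basis of `E`. -/
noncomputable def simpleRoot (b : Fin n → ι) (t : ι → Kind) (x : Fin n → ℝ) (i : Fin n) :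
    EuclideanSpace ℝ (Fin n) :=
  if Last b x i then if t (b i) = Kind.D then rt (pv b x i) i (-1) else bv i
  else rt i (nx b x i) 1

open Classical in
/-- The reflection in `simpleRoot b t x i`. -/
noncomputable def simpleRefl (b : Fin n → ι) (t : ι → Kind) (x : Fin n → ℝ) (i : Fin n) :
    SignedPerm n :=
  if Last b x i then if t (b i) = Kind.D then sw (pv b x i) i (-1) else flip i
  else sw i (nx b x i) 1

/-- The indices that are attached to simple roots of `blockSubgroup b t`. -/
def simpleIndices (b : Fin n → ι) (t : ι → Kind) (x : Fin n → ℝ) : Set (Fin n) :=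
  {i | Last b x i → t (b i) ≠ Kind.A}

variable (hx : InjOnBlocks b x) (hD : ∀ i, t (b i) = Kind.D → ∃ j, i ≠ j ∧ b i = b j)

include hx hD

theorem reflectsIn_simpleRefl (i : Fin n) :
    (simpleRefl b t x i).ReflectsIn (simpleRoot b t x i) := by
  unfold simpleRefl simpleRoot
  split_ifs with h1 h2
  · exact reflectsIn_sw (h1.adj_pv hx hD h2).ne _
  · exact reflectsIn_flip i
  · exact reflectsIn_sw (adj_nx h1).ne _

theorem simpleRoot_ne_zero (i : Fin n) : simpleRoot b t x i ≠ 0 := by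
  unfold simpleRoot
  split_ifs with h1 h2
  · exact rt_ne_zero (h1.adj_pv hx hD h2).ne _
  · exact bv_ne_zero i
  · exact rt_ne_zero (adj_nx h1).ne _

theorem simpleRefl_mem {i : Fin n} (hi : i ∈ simpleIndices b t x) :
    simpleRefl b t x i ∈ blockSubgroup b t := by
  unfold simpleRefl
  split_ifs with h1 h2
  · have := h1.adj_pv hx hD h2
    rw [sw_mem_blockSubgroup this.ne]
    exact ⟨this.1, fun h => absurd (this.1 ▸ h) (by simp [h2])⟩
  · rw [flip_mem_blockSubgroup]
    have h3 := hi h1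
    rcases h : t (b i) with _ | _ | _ <;> simp_all
  · have := adj_nx h1
    rw [sw_mem_blockSubgroup this.ne]
    exact ⟨this.1, fun _ => rfl⟩

/-- Pair the roots with the functionals `ω i` that sum the coordinates at height at least `x i` in
the block of `i`. The diagonal entries are nonzero. An off-diagonal entry can be nonzero only when
the root belongs to a lowest index and `ω i` does not, so the matrix is triangular: coefficients at
lowest indices vanish first, then the others. -/
theorem linearIndependent_simpleRoot : LinearIndependent ℝ (simpleRoot b t x) := by
  classical
  let S : Fin n → Finset (Fin n) := fun i => Finset.univ.filter fun m => b m = b i ∧ x i ≤ x m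
  let ω : Fin n → EuclideanSpace ℝ (Fin n) → ℝ := fun i y => ∑ m ∈ S i, y m
  have hωrt : ∀ i j k σ, ω i (rt j k σ) =
      (if j ∈ S i then 1 else 0) - ((σ : ℤ) : ℝ) * (if k ∈ S i then 1 else 0) := by
    intro i j k σ
    simp only [ω, rt_apply, Finset.sum_sub_distrib, ← Finset.mul_sum, Finset.sum_ite_eq']
  have hS : ∀ i m, m ∈ S i ↔ b m = b i ∧ x i ≤ x m := by simp [S]
  have hSl : ∀ i m, Last b x m → (m ∈ S i ↔ m = i) := by
    intro i m hm
    rw [hS]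
    constructor
    · rintro ⟨h1, h2⟩
      exact hx m i h1 (le_antisymm (hm i h1.symm) h2)
    · rintro rfl
      exact ⟨rfl, le_rfl⟩
  have hadj : ∀ i j k, Adj b x j k → (j ∈ S i ↔ j = i ∨ k ∈ S i) := by
    intro i j k h
    rw [hS, hS]
    constructor
    · rintro ⟨h1, h2⟩
      rcases h.2.2 i h1.symm with h3 | h3
      · exact Or.inr ⟨h.1.symm.trans h1, h3⟩
      · exact Or.inl (hx j i h1 (le_antisymm h3 h2))
    · rintro (rfl | ⟨h1, h2⟩)
      · exact ⟨rfl, le_rfl⟩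
      · exact ⟨h.1.trans h1, h2.trans h.2.1.le⟩
  have hself : ∀ i, ω i (simpleRoot b t x i) ≠ 0 := by
    intro i
    unfold simpleRoot
    split_ifs with h1 h2
    · have h := h1.adj_pv hx hD h2
      have h3 := (hSl i i h1).2 rfl
      have h4 := (hadj i _ i h).2 (Or.inr h3)
      rw [hωrt]
      simp [h3, h4]
    · simp [ω, (hSl i i h1).2 rfl]
    · have h := adj_nx h1
      rw [hωrt]
      have h3 := (hadj i i _ h).2 (Or.inl rfl)
      have h4 : nx b x i ∉ S i := fun h5 => absurd ((hS _ _).1 h5).2 (not_le.2 h.2.1)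
      simp [h3, h4]
  have hother : ∀ i m, m ≠ i → ω i (simpleRoot b t x m) ≠ 0 → Last b x m ∧ ¬ Last b x i := by
    intro i m hmi
    unfold simpleRoot
    split_ifs with h1 h2
    · have h := h1.adj_pv hx hD h2
      intro h0
      refine ⟨h1, ?_⟩
      by_cases hi : i = pv b x m
      · rw [hi]; exact h.not_last
      · have h3 : m ∉ S i := fun h5 => hmi ((hSl i m h1).1 h5)
        have h4 : pv b x m ∉ S i := by
          rw [hadj i _ m h]
          rintro (h5 | h5)
          · exact hi h5.symm
          · exact h3 h5
        rw [hωrt] at h0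
        simp [h3, h4] at h0
    · have h3 : m ∉ S i := fun h5 => hmi ((hSl i m h1).1 h5)
      simp [ω, h3]
    · have h := hadj i m _ (adj_nx h1)
      rw [hωrt]
      simp [h, hmi]
  rw [Fintype.linearIndependent_iff]
  intro a ha
  have key : ∀ i, ∑ m, a m * ω i (simpleRoot b t x m) = 0 := by
    intro i
    have h1 : ω i (∑ m, a m • simpleRoot b t x m) = ∑ m, a m * ω i (simpleRoot b t x m) := by
      simp only [ω, WithLp.ofLp_sum, Finset.sum_apply, WithLp.ofLp_smul, Pi.smul_apply, smul_eq_mul,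
        Finset.mul_sum]
      rw [Finset.sum_comm]
    rw [← h1, ha]
    simp [ω]
  have single : ∀ i, (∀ m, m ≠ i → a m * ω i (simpleRoot b t x m) = 0) → a i = 0 := by
    intro i h
    have h1 := key i
    rw [Finset.sum_eq_single i (fun m _ hm => h m hm) (by simp)] at h1
    exact (mul_eq_zero.1 h1).resolve_right (hself i)
  have hlast : ∀ i, Last b x i → a i = 0 := by
    intro i hi
    refine single i fun m hm => ?_
    by_contra h0
    exact (hother i m hm (right_ne_zero_of_mul h0)).2 hi
  intro i
  refine single i fun m hm => ?_
  by_cases hl : Last b x m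
  · rw [hlast m hl, zero_mul]
  · by_contra h0
    exact hl (hother i m hm (right_ne_zero_of_mul h0)).1

omit hx hD in
/-- The unit vector in the direction of `simpleRoot b t x i`. -/
noncomputable def unitSimpleRoot (b : Fin n → ι) (t : ι → Kind) (x : Fin n → ℝ) (i : Fin n) :
    EuclideanSpace ℝ (Fin n) :=
  ‖simpleRoot b t x i‖⁻¹ • simpleRoot b t x i

theorem reflectsIn_unitSimpleRoot_iff {i : Fin n} {w : SignedPerm n} :
    w.ReflectsIn (unitSimpleRoot b t x i) ↔ w = simpleRefl b t x i := by
  rw [unitSimpleRoot, reflectsIn_smul (inv_ne_zero (norm_ne_zero_iff.2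
    (simpleRoot_ne_zero hx hD i)))]
  refine ⟨fun h => h.unique (reflectsIn_simpleRefl hx hD i), ?_⟩
  rintro rfl
  exact reflectsIn_simpleRefl hx hD i

omit hx hD in
theorem nonneg_smul_mem {K : Submodule ℝ≥0 (EuclideanSpace ℝ (Fin n))}
    {y : EuclideanSpace ℝ (Fin n)} (h : y ∈ K) {c : ℝ} (hc : 0 ≤ c) : c • y ∈ K :=
  K.smul_mem ⟨c, hc⟩ h

omit hx hD in
theorem smul_mem_or_neg_mem {K : Submodule ℝ≥0 (EuclideanSpace ℝ (Fin n))}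
    {y : EuclideanSpace ℝ (Fin n)} (h : y ∈ K ∨ -y ∈ K) (c : ℝ) : c • y ∈ K ∨ -(c • y) ∈ K := by
  rcases le_total 0 c with hc | hc
  · rcases h with h | h
    · exact Or.inl (nonneg_smul_mem h hc)
    · right
      rw [← smul_neg]
      exact nonneg_smul_mem h hc
  · rcases h with h | h
    · right
      rw [← neg_smul]
      exact nonneg_smul_mem h (neg_nonneg.2 hc)
    · left
      rw [← neg_smul_neg]
      exact nonneg_smul_mem h (neg_nonneg.2 hc)

theorem simpleRoot_mem_span {i : Fin n} (hi : i ∈ simpleIndices b t x) :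
    simpleRoot b t x i ∈ Submodule.span ℝ≥0 (unitSimpleRoot b t x '' simpleIndices b t x) := by
  have h : unitSimpleRoot b t x i ∈
      Submodule.span ℝ≥0 (unitSimpleRoot b t x '' simpleIndices b t x) :=
    Submodule.subset_span ⟨i, hi, rfl⟩
  have h2 := nonneg_smul_mem h (norm_nonneg (simpleRoot b t x i))
  rwa [unitSimpleRoot, smul_inv_smul₀ (norm_ne_zero_iff.2 (simpleRoot_ne_zero hx hD i))] at h2

/-- The root telescopes over consecutive indices on the way down from `i` to `j`. -/
theorem rt_one_mem_span {j : Fin n} (i : Fin n) (hb : b i = b j) (hij : x j ≤ x i) :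
    rt i j 1 ∈ Submodule.span ℝ≥0 (unitSimpleRoot b t x '' simpleIndices b t x) := by
  have : WellFounded fun i j : Fin n => x i < x j :=
    haveI : IsTrans (Fin n) fun i j => x i < x j := ⟨fun _ _ _ => lt_trans⟩
    haveI : Std.Irrefl fun i j : Fin n => x i < x j := ⟨fun _ => lt_irrefl _⟩
    Finite.wellFounded_of_trans_of_irrefl _
  induction i using this.induction with
  | _ i ih =>
  by_cases h : i = j
  · subst h
    simp [rt]
  have hlt : x j < x i := lt_of_le_of_ne hij fun h' => h (hx i j hb h'.symm)
  have hl : ¬ Last b x i := fun hl => absurd (hl j hb.symm) (not_le.2 hlt)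
  have ha := adj_nx hl
  have h1 : x j ≤ x (nx b x i) := (ha.2.2 j hb.symm).resolve_right (not_le.2 hlt)
  have h2 := ih _ ha.2.1 (ha.1.symm.trans hb) h1
  have h3 := simpleRoot_mem_span hx hD (i := i) (fun h => absurd h hl)
  rw [simpleRoot, if_neg hl] at h3
  have h4 : rt i j 1 = rt i (nx b x i) 1 + rt (nx b x i) j 1 := by simp [rt]
  rw [h4]
  exact add_mem h3 h2

theorem bv_mem_span {i : Fin n} (hi : t (b i) = Kind.B) :
    bv i ∈ Submodule.span ℝ≥0 (unitSimpleRoot b t x '' simpleIndices b t x) := by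
  obtain ⟨l, hl, hlast⟩ := exists_last b x i
  have h1 := rt_one_mem_span hx hD (t := t) i hl.symm (hlast i hl.symm)
  have h2 := simpleRoot_mem_span hx hD (i := l) (fun _ => by simp [hl, hi])
  rw [simpleRoot, if_pos hlast, if_neg (by simp [hl, hi])] at h2
  have h3 : bv i = rt i l 1 + bv l := by simp [rt]
  rw [h3]
  exact add_mem h1 h2

/-- For kind `D`, with `l` the lowest index and `p` the one just above it, `e_i + e_j = (e_i - e_p)
+ (e_j - e_l) + (e_p + e_l)`. -/
theorem rt_neg_one_mem_span {i j : Fin n} (hi : t (b i) ≠ Kind.A) (hb : b i = b j) (hij : i ≠ j) :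
    rt i j (-1) ∈ Submodule.span ℝ≥0 (unitSimpleRoot b t x '' simpleIndices b t x) := by
  -- The higher index is not the lowest of its block, hence lies at or above `p`.
  wlog hlt : x j < x i generalizing i j
  · have h1 : x i < x j := lt_of_le_of_ne (not_lt.1 hlt) fun h => hij (hx i j hb h)
    have h2 := this (hb ▸ hi) hb.symm hij.symm h1
    have h3 : rt i j (-1) = rt j i (-1) := by simp [rt, add_comm]
    rwa [h3]
  rcases hk : t (b i) with _ | _ | _
  · exact absurd hk hi
  · have h3 : rt i j (-1) = bv i + bv j := by simp [rt]
    rw [h3]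
    exact add_mem (bv_mem_span hx hD hk) (bv_mem_span hx hD (hb ▸ hk))
  · obtain ⟨l, hl, hlast⟩ := exists_last b x i
    have hkl : t (b l) = Kind.D := by rw [hl, hk]
    have ha := hlast.adj_pv hx hD hkl
    have h1 := simpleRoot_mem_span hx hD (i := l) (fun _ => by simp [hkl])
    rw [simpleRoot, if_pos hlast, if_pos hkl] at h1
    have h2 : x (pv b x l) ≤ x i := by
      refine (ha.2.2 i ?_).resolve_left (not_le.2 ?_)
      · rw [ha.1, hl]
      · exact lt_of_le_of_lt (hlast j (by rw [hl, hb])) hlt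
    have h3 := rt_one_mem_span hx hD (t := t) i (show b i = b (pv b x l) by rw [ha.1, hl]) h2
    have h4 := rt_one_mem_span hx hD (t := t) j (show b j = b l by rw [hl, hb])
      (hlast j (by rw [hl, hb]))
    have h5 : rt i j (-1) = rt i (pv b x l) 1 + rt j l 1 + rt (pv b x l) l (-1) := by
      simp [rt]
      abel
    rw [h5]
    exact add_mem (add_mem h3 h4) h1

omit [DecidableEq ι] hx hD in
theorem exists_of_mem_unitRoots {R : Subgroup (SignedPerm n)} {v : EuclideanSpace ℝ (Fin n)}
    (hv : v ∈ unitRoots R) :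
    (∃ i, ∃ c : ℝ, c ≠ 0 ∧ flip i ∈ R ∧ v = c • bv i) ∨
      ∃ i j σ, ∃ c : ℝ, i ≠ j ∧ c ≠ 0 ∧ sw i j σ ∈ R ∧ v = c • rt i j σ := by
  obtain ⟨hn, w, hw, hr⟩ := hv
  have hv0 : v ≠ 0 := by
    rintro rfl
    simp at hn
  rcases hr.classify hv0 with ⟨i, c, hc, rfl, h⟩ | ⟨i, j, σ, c, hij, hc, rfl, h⟩
  · exact Or.inl ⟨i, c, hc, hw, h⟩
  · exact Or.inr ⟨i, j, σ, c, hij, hc, hw, h⟩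

theorem isSimpleSystem_unitSimpleRoot :
    IsSimpleSystem (unitRoots (blockSubgroup b t))
      (unitSimpleRoot b t x '' simpleIndices b t x) := by
  refine ⟨?_, ?_, ?_⟩
  · rintro _ ⟨i, hi, rfl⟩
    refine ⟨?_, simpleRefl b t x i, simpleRefl_mem hx hD hi,
      (reflectsIn_unitSimpleRoot_iff hx hD).2 rfl⟩
    rw [unitSimpleRoot, norm_smul, norm_inv, norm_norm]
    exact inv_mul_cancel₀ (norm_ne_zero_iff.2 (simpleRoot_ne_zero hx hD i))
  · have h := (linearIndependent_simpleRoot hx hD).units_smul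
      fun i => (Units.mk0 _ (norm_ne_zero_iff.2 (simpleRoot_ne_zero hx hD i)))⁻¹
    have h2 : LinearIndepOn ℝ (unitSimpleRoot b t x) (simpleIndices b t x) :=
      LinearIndependent.linearIndepOn h _
    exact h2.id_image
  · intro v hv
    rcases exists_of_mem_unitRoots hv with ⟨i, c, hc, hi, rfl⟩ | ⟨i, j, σ, c, hij, hc, hw, rfl⟩
    · refine smul_mem_or_neg_mem (Or.inl ?_) c
      exact bv_mem_span hx hD (flip_mem_blockSubgroup.1 hi)
    · refine smul_mem_or_neg_mem ?_ c
      obtain ⟨hb, hA⟩ := (sw_mem_blockSubgroup hij).1 hw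
      rcases Int.units_eq_one_or σ with rfl | rfl
      · rcases le_total (x j) (x i) with h | h
        · exact Or.inl (rt_one_mem_span hx hD i hb h)
        · right
          have h2 : -rt i j 1 = rt j i 1 := by simp [rt]
          rw [h2]
          exact rt_one_mem_span hx hD j hb.symm h
      · left
        refine rt_neg_one_mem_span hx hD (fun h => ?_) hb hij
        exact absurd (hA h) (by decide)

end block

end SignedPerm

namespace SignedPerm

variable {n : ℕ}

/-! ### Conjugacy of simple systems -/

section cone

variable {D : Set (EuclideanSpace ℝ (Fin n))} {f : EuclideanSpace ℝ (Fin n) →ₗ[ℝ] ℝ}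

theorem eq_zero_or_pos_of_mem_span (hf : ∀ d ∈ D, 0 < f d) {y : EuclideanSpace ℝ (Fin n)}
    (hy : y ∈ Submodule.span ℝ≥0 D) : y = 0 ∨ 0 < f y := by
  induction hy using Submodule.span_induction with
  | mem y h => exact Or.inr (hf y h)
  | zero => exact Or.inl rfl
  | add y z _ _ h1 h2 =>
    rcases h1 with rfl | h1
    · simpa using h2
    · rcases h2 with rfl | h2
      · simpa using Or.inr h1
      · right
        rw [map_add]
        exact add_pos h1 h2
  | smul c y _ h =>
    rcases h with rfl | h
    · simp
    · rcases eq_or_ne c 0 with rfl | hc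
      · simp
      · right
        have : f (c • y) = (c : ℝ) * f y := f.map_smul (c : ℝ) y
        rw [this]
        exact mul_pos (by positivity) h

theorem mem_span_of_pos (hf : ∀ d ∈ D, 0 < f d) {y : EuclideanSpace ℝ (Fin n)} (hy : 0 < f y)
    (h : y ∈ Submodule.span ℝ≥0 D ∨ -y ∈ Submodule.span ℝ≥0 D) : y ∈ Submodule.span ℝ≥0 D := by
  refine h.resolve_right fun h' => ?_
  rcases eq_zero_or_pos_of_mem_span hf h' with h1 | h1
  · rw [neg_eq_zero.1 h1, map_zero] at hy
    exact lt_irrefl _ hy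
  · rw [map_neg] at h1
    linarith

/-- Extend `D` to a basis and take the functional with value `1` on every basis vector. -/
theorem exists_functional (hD : LinearIndepOn ℝ id D) :
    ∃ f : EuclideanSpace ℝ (Fin n) →ₗ[ℝ] ℝ, ∀ d ∈ D, 0 < f d := by
  let B := Module.Basis.extend hD
  refine ⟨B.constr ℝ fun _ => (1 : ℝ), fun d hd => ?_⟩
  have h := B.constr_basis ℝ (fun _ => (1 : ℝ)) ⟨d, hD.subset_extend _ hd⟩
  rw [Module.Basis.extend_apply_self] at h
  rw [h]
  exact one_pos

/-- Two simple systems with the same positive roots are equal. -/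
theorem IsSimpleSystem.subset {P C : Set (EuclideanSpace ℝ (Fin n))} (hP : ∀ v ∈ P, ‖v‖ = 1)
    (hD : IsSimpleSystem P D) (hC : IsSimpleSystem P C) (hfD : ∀ d ∈ D, 0 < f d)
    (hfC : ∀ d ∈ C, 0 < f d) : D ⊆ C := by
  intro d hd
  by_contra hdC
  let T := Submodule.span ℝ≥0 (D \ {d})
  have hfT : ∀ y ∈ T, y = 0 ∨ 0 < f y := fun y hy =>
    eq_zero_or_pos_of_mem_span (fun e he => hfD e he.1) hy
  -- Every nonzero vector in the cone of `C` has a positive component `z` along the other members of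
  -- `D`: for a generator, `z = 0` would make this unit vector equal to `d`, which is not in `C`.
  -- Applied to `d` itself, this contradicts the linear independence of `D`.
  have key : ∀ y ∈ Submodule.span ℝ≥0 C,
      ∃ α : ℝ≥0, ∃ z ∈ T, y = α • d + z ∧ (y = 0 ∨ 0 < f z) := by
    intro y hy
    induction hy using Submodule.span_induction with
    | mem v h =>
      have h1 : v ∈ Submodule.span ℝ≥0 D := mem_span_of_pos hfD (hfC v h) (hD.2.2 v (hC.1 h))
      rw [← Set.insert_sdiff_self_of_mem hd, Submodule.mem_span_insert] at h1
      obtain ⟨α, z, hz, rfl⟩ := h1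
      refine ⟨α, z, hz, rfl, ?_⟩
      right
      refine (hfT z hz).resolve_left ?_
      rintro rfl
      have hn := hP _ (hC.1 h)
      rw [add_zero, NNReal.smul_def, norm_smul, hP d (hD.1 hd), mul_one] at hn
      have hα : α = 1 := by
        have h2 : ‖(α : ℝ)‖ = α := Real.norm_of_nonneg α.2
        exact_mod_cast h2.symm.trans hn
      rw [hα, one_smul, add_zero] at h
      exact hdC h
    | zero => exact ⟨0, 0, zero_mem _, by simp, Or.inl rfl⟩
    | add y y' _ _ h1 h2 =>
      obtain ⟨α, z, hz, rfl, h⟩ := h1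
      obtain ⟨α', z', hz', rfl, h'⟩ := h2
      rcases h with h | h
      · rw [h, zero_add]
        exact ⟨α', z', hz', rfl, h'⟩
      · rcases h' with h' | h'
        · rw [h', add_zero]
          exact ⟨α, z, hz, rfl, Or.inr h⟩
        · refine ⟨α + α', z + z', add_mem hz hz', by rw [add_smul]; abel, Or.inr ?_⟩
          rw [map_add]
          exact add_pos h h'
    | smul c y _ h =>
      obtain ⟨α, z, hz, rfl, h⟩ := h
      refine ⟨c * α, c • z, T.smul_mem c hz, by rw [smul_add, mul_smul], ?_⟩
      rcases h with h | h
      · left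
        rw [h, smul_zero]
      · rcases eq_or_ne c 0 with rfl | hc
        · simp
        · right
          have : f (c • z) = (c : ℝ) * f z := f.map_smul (c : ℝ) z
          rw [this]
          exact mul_pos (by positivity) h
  have hd0 : d ≠ 0 := by
    rintro rfl
    exact lt_irrefl _ (f.map_zero ▸ hfD 0 hd)
  obtain ⟨α, z, hz, hdz, h⟩ := key d (mem_span_of_pos hfC (hfD d hd) (hC.2.2 d (hD.1 hd)))
  replace h := h.resolve_left hd0
  have h1 : z ∈ Submodule.span ℝ (D \ {d}) := Submodule.span_subset_span ℝ≥0 ℝ _ hz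
  have h2 : z = (1 - (α : ℝ)) • d := by
    rw [sub_smul, one_smul, eq_sub_iff_add_eq, add_comm]
    exact hdz.symm
  by_cases hα : 1 - (α : ℝ) = 0
  · rw [hα, zero_smul] at h2
    rw [h2, map_zero] at h
    exact lt_irrefl _ h
  · have h3 : d ∈ Submodule.span ℝ (D \ {d}) := by
      have h4 := Submodule.smul_mem _ (1 - (α : ℝ))⁻¹ h1
      rwa [h2, inv_smul_smul₀ hα] at h4
    refine ((hD.2.1.mono Set.sdiff_subset).notMem_span_iff_id.2 ⟨?_, by simp⟩) h3
    rw [Set.insert_sdiff_self_of_mem hd]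
    exact hD.2.1

theorem IsSimpleSystem.eq {P C : Set (EuclideanSpace ℝ (Fin n))} (hP : ∀ v ∈ P, ‖v‖ = 1)
    (hD : IsSimpleSystem P D) (hC : IsSimpleSystem P C) (hfD : ∀ d ∈ D, 0 < f d)
    (hfC : ∀ d ∈ C, 0 < f d) : D = C :=
  (hD.subset hP hC hfD hfC).antisymm (hC.subset hP hD hfC hfD)

end cone

/-! ### Conjugates of simple systems and of Coxeter elements -/

theorem inner_rep (g : SignedPerm n) (x y : EuclideanSpace ℝ (Fin n)) :
    inner ℝ (rep n g x) (rep n g y) = inner ℝ x y := by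
  simp only [PiLp.inner_apply]
  rw [← Equiv.sum_comp g.perm]
  refine Finset.sum_congr rfl fun i _ => ?_
  rw [rep_apply_perm, rep_apply_perm]
  have := units_cast_sq (g.sign i)
  simp only [RCLike.inner_apply, conj_trivial]
  linear_combination (x i * y i) * this

theorem norm_rep (g : SignedPerm n) (x : EuclideanSpace ℝ (Fin n)) : ‖rep n g x‖ = ‖x‖ := by
  rw [← sq_eq_sq₀ (norm_nonneg _) (norm_nonneg _), ← real_inner_self_eq_norm_sq,
    ← real_inner_self_eq_norm_sq, inner_rep]

theorem rep_inv_rep (g : SignedPerm n) (x : EuclideanSpace ℝ (Fin n)) :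
    rep n g⁻¹ (rep n g x) = x := by
  rw [← Module.End.mul_apply, ← map_mul, inv_mul_cancel, map_one, Module.End.one_apply]

theorem rep_rep_inv (g : SignedPerm n) (x : EuclideanSpace ℝ (Fin n)) :
    rep n g (rep n g⁻¹ x) = x := by
  rw [← Module.End.mul_apply, ← map_mul, mul_inv_cancel, map_one, Module.End.one_apply]

theorem ReflectsIn.conj {w : SignedPerm n} {v : EuclideanSpace ℝ (Fin n)} (h : w.ReflectsIn v)
    (g : SignedPerm n) : (g * w * g⁻¹).ReflectsIn (rep n g v) := by
  rw [reflectsIn_iff] at h ⊢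
  intro x
  have h1 : inner ℝ (rep n g v) x = inner ℝ v (rep n g⁻¹ x) := by
    conv_rhs => rw [← inner_rep g, rep_rep_inv]
  rw [map_mul, map_mul, Module.End.mul_apply, Module.End.mul_apply, h, map_sub, map_smul,
    rep_rep_inv, norm_rep, h1]

theorem unitRoots_conj (R : Subgroup (SignedPerm n)) (g : SignedPerm n) :
    unitRoots (R.map (MulAut.conj g).toMonoidHom) = rep n g '' unitRoots R := by
  ext v
  constructor
  · rintro ⟨hv, w, hw, hr⟩
    refine ⟨rep n g⁻¹ v, ⟨by rw [norm_rep, hv], g⁻¹ * w * g, mem_map_conj.1 hw, ?_⟩,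
      rep_rep_inv g v⟩
    simpa using hr.conj g⁻¹
  · rintro ⟨v, ⟨hv, w, hw, hr⟩, rfl⟩
    exact ⟨by rw [norm_rep, hv], g * w * g⁻¹, conj_mem_map_conj.2 hw, hr.conj g⟩

theorem IsSimpleSystem.image_rep {P D : Set (EuclideanSpace ℝ (Fin n))} (h : IsSimpleSystem P D)
    (g : SignedPerm n) : IsSimpleSystem (rep n g '' P) (rep n g '' D) := by
  have hinj : Function.Injective (rep n g) := Function.LeftInverse.injective (rep_inv_rep g)
  refine ⟨Set.image_mono h.1, ?_, ?_⟩
  · have h1 : LinearIndepOn ℝ (fun v => rep n g v) D :=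
      LinearIndependent.map' h.2.1 (rep n g) (LinearMap.ker_eq_bot.2 hinj)
    exact h1.id_image
  · have key : ∀ y ∈ Submodule.span ℝ≥0 D, rep n g y ∈ Submodule.span ℝ≥0 (rep n g '' D) := by
      intro y hy
      have h1 := Submodule.mem_map_of_mem (f := (rep n g).restrictScalars ℝ≥0) hy
      rwa [Submodule.map_span] at h1
    rintro _ ⟨v, hv, rfl⟩
    rw [← map_neg]
    exact (h.2.2 v hv).imp (key _) (key _)

theorem coxeterSet_conj (D : Set (EuclideanSpace ℝ (Fin n))) (g w : SignedPerm n) :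
    (∃ v ∈ rep n g '' D, (g * w * g⁻¹).ReflectsIn v) ↔ ∃ v ∈ D, w.ReflectsIn v := by
  constructor
  · rintro ⟨_, ⟨v, hv, rfl⟩, h⟩
    have h2 := h.conj g⁻¹
    rw [rep_inv_rep] at h2
    exact ⟨v, hv, by simpa [mul_assoc] using h2⟩
  · rintro ⟨v, hv, h⟩
    exact ⟨_, ⟨v, hv, rfl⟩, h.conj g⟩

theorem conj_list_prod (g : SignedPerm n) (l : List (SignedPerm n)) :
    (l.map fun w => g * w * g⁻¹).prod = g * l.prod * g⁻¹ :=
  (map_list_prod (MulAut.conj g) l).symm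

theorem IsCoxeterElement.conj {R : Subgroup (SignedPerm n)} {c : SignedPerm n}
    (h : IsCoxeterElement R c) (g : SignedPerm n) :
    IsCoxeterElement (R.map (MulAut.conj g).toMonoidHom) (g * c * g⁻¹) := by
  obtain ⟨l, hl, ⟨D, hD, hS⟩, rfl⟩ := h
  refine ⟨l.map fun w => g * w * g⁻¹, hl.map (MulAut.conj g).injective,
    ⟨rep n g '' D, ?_, ?_⟩, (conj_list_prod g l).symm⟩
  · rw [unitRoots_conj]
    exact hD.image_rep g
  · ext w
    obtain ⟨w, rfl⟩ : ∃ w', w = g * w' * g⁻¹ := ⟨g⁻¹ * w * g, by simp [mul_assoc]⟩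
    have h1 : w ∈ l ↔ ∃ v ∈ D, w.ReflectsIn v := by
      have := congrArg (w ∈ ·) hS
      simpa using this
    rw [Set.mem_ofPred_eq, Set.mem_ofPred_eq, coxeterSet_conj, ← h1, List.mem_map]
    constructor
    · rintro ⟨w', hw', h⟩
      rwa [← (MulAut.conj g).injective h]
    · exact fun h => ⟨w, h, rfl⟩

/-! ### Coxeter elements of block subgroups -/

section block

variable {ι : Type*} [DecidableEq ι] {b : Fin n → ι} {t : ι → Kind} {x : Fin n → ℝ}

/-- The list `l` consists of the reflections in the standard simple roots of `blockSubgroup b t`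
with respect to the heights `x`. -/
def IsSimpleList (b : Fin n → ι) (t : ι → Kind) (x : Fin n → ℝ) (l : List (SignedPerm n)) : Prop :=
  l.Nodup ∧ ∀ w, w ∈ l ↔ ∃ i ∈ simpleIndices b t x, w = simpleRefl b t x i

theorem setOf_reflectsIn_unitSimpleRoot (hx : InjOnBlocks b x)
    (hD : ∀ i, t (b i) = Kind.D → ∃ j, i ≠ j ∧ b i = b j) (w : SignedPerm n) :
    (∃ v ∈ unitSimpleRoot b t x '' simpleIndices b t x, w.ReflectsIn v) ↔
      ∃ i ∈ simpleIndices b t x, w = simpleRefl b t x i := by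
  constructor
  · rintro ⟨_, ⟨i, hi, rfl⟩, h⟩
    exact ⟨i, hi, (reflectsIn_unitSimpleRoot_iff hx hD).1 h⟩
  · rintro ⟨i, hi, h⟩
    exact ⟨_, ⟨i, hi, rfl⟩, (reflectsIn_unitSimpleRoot_iff hx hD).2 h⟩

theorem exists_isCoxeterElement_blockSubgroup
    (hD : ∀ i, t (b i) = Kind.D → ∃ j, i ≠ j ∧ b i = b j) :
    ∃ c, IsCoxeterElement (blockSubgroup b t) c := by
  classical
  -- Any heights that separate the coordinates would do.
  let x : Fin n → ℝ := fun i => (i : ℕ)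
  have hx : InjOnBlocks b x := fun i j _ h => Fin.ext (by simpa [x] using h)
  let s : Finset (SignedPerm n) :=
    (Finset.univ.filter fun i => i ∈ simpleIndices b t x).image (simpleRefl b t x)
  refine ⟨s.toList.prod, s.toList, s.nodup_toList,
    ⟨_, isSimpleSystem_unitSimpleRoot hx hD, ?_⟩, rfl⟩
  ext w
  rw [Set.mem_ofPred_eq, Set.mem_ofPred_eq, setOf_reflectsIn_unitSimpleRoot hx hD]
  simp [s, eq_comm]

/-- For kind `D`, nonnegativity suffices: in `e_p + e_l` the upper index `p` has strictly greater
height than `l`. -/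
theorem pos_unitSimpleRoot {f : EuclideanSpace ℝ (Fin n) →ₗ[ℝ] ℝ}
    (hx : InjOnBlocks b fun i => f (bv i))
    (hD : ∀ i, t (b i) = Kind.D → ∃ j, i ≠ j ∧ b i = b j) (hpB : ∀ i, t (b i) = Kind.B → 0 < f (bv i))
    (hpD : ∀ i, t (b i) = Kind.D → 0 ≤ f (bv i)) :
    ∀ d ∈ unitSimpleRoot b t (fun i => f (bv i)) '' simpleIndices b t fun i => f (bv i),
      0 < f d := by
  rintro _ ⟨i, hi, rfl⟩
  rw [unitSimpleRoot, map_smul, smul_eq_mul]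
  refine mul_pos (inv_pos.2 (norm_pos_iff.2 (simpleRoot_ne_zero hx hD i))) ?_
  unfold simpleRoot
  split_ifs with h1 h2
  · have h := h1.adj_pv hx hD h2
    have h3 := h.2.1
    have h4 := hpD i h2
    simp only [rt, map_sub, map_smul, smul_eq_mul] at h3 ⊢
    push_cast
    linarith
  · refine hpB i ?_
    have h3 := hi h1
    rcases h : t (b i) with _ | _ | _ <;> simp_all
  · have h := (adj_nx h1).2.1
    simp only [rt, map_sub, map_smul, smul_eq_mul] at h ⊢
    push_cast
    linarith

/-- Diagonal conjugation changes only the signs of transpositions, and both signs are present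
outside the blocks of kind `A`. -/
theorem map_conj_sign_blockSubgroup {ε : Fin n → ℤˣ} (hε : ∀ i, t (b i) = Kind.A → ε i = 1) :
    (blockSubgroup b t).map (MulAut.conj (⟨1, ε⟩ : SignedPerm n)).toMonoidHom =
      blockSubgroup b t := by
  refine (isReflectionSubgroup_blockSubgroup.conj _).eq_of_forall
    isReflectionSubgroup_blockSubgroup fun w hw => ?_
  have hginv : (⟨1, ε⟩ : SignedPerm n)⁻¹ = ⟨1, ε⟩ := by ext <;> simp
  rw [mem_map_conj]
  have hconj : (⟨1, ε⟩ : SignedPerm n)⁻¹ * w * ⟨1, ε⟩ = ⟨1, ε⟩ * w * (⟨1, ε⟩ : SignedPerm n)⁻¹ := by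
    rw [hginv]
  rw [hconj]
  rcases hw.classify with ⟨i, rfl⟩ | ⟨i, j, σ, hij, rfl⟩
  · rw [conj_flip]
    rfl
  · rw [conj_sw _ hij]
    change sw i j (ε i * σ * ε j) ∈ _ ↔ _
    rw [sw_mem_blockSubgroup hij, sw_mem_blockSubgroup hij]
    refine and_congr_right fun hb => forall_congr' fun h => ?_
    rw [hε i h, hε j (hb ▸ h), one_mul, mul_one]

/-- A functional `f` positive on the simple system vanishes on no root. A diagonal sign change makes
it nonnegative on the coordinates outside kind `A`; its values on the basis vectors then serve as
heights. The transported simple system and the standard one for these heights have the same positive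
roots, so they coincide. -/
theorem IsCoxeterElement.exists_isSimpleList
    (hD : ∀ i, t (b i) = Kind.D → ∃ j, i ≠ j ∧ b i = b j) {c : SignedPerm n}
    (hc : IsCoxeterElement (blockSubgroup b t) c) :
    ∃ (x : Fin n → ℝ) (l : List (SignedPerm n)) (g : SignedPerm n),
      InjOnBlocks b x ∧ IsSimpleList b t x l ∧ l.prod = g * c * g⁻¹ := by
  obtain ⟨l, hl, ⟨D, hDs, hS⟩, rfl⟩ := hc
  obtain ⟨f, hf⟩ := exists_functional hDs.2.1
  have hmul : ∀ v ∈ unitRoots (blockSubgroup b t), f v ≠ 0 := by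
    intro v hv h0
    have hv0 : v ≠ 0 := by
      rintro rfl
      simp [unitRoots] at hv
    rcases hDs.2.2 v hv with h | h
    · rcases eq_zero_or_pos_of_mem_span hf h with h1 | h1
      · exact hv0 h1
      · exact h1.ne' h0
    · rcases eq_zero_or_pos_of_mem_span hf h with h1 | h1
      · exact hv0 (neg_eq_zero.1 h1)
      · rw [map_neg, h0, neg_zero] at h1
        exact lt_irrefl _ h1
  have hroot : ∀ (w : SignedPerm n) (v : EuclideanSpace ℝ (Fin n)), v ≠ 0 →
      w ∈ blockSubgroup b t → w.ReflectsIn v → f v ≠ 0 := by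
    intro w v hv hw hr h0
    have hn := norm_ne_zero_iff.2 hv
    refine hmul (‖v‖⁻¹ • v) ⟨?_, w, hw, (reflectsIn_smul (inv_ne_zero hn)).2 hr⟩ ?_
    · rw [norm_smul, norm_inv, norm_norm, inv_mul_cancel₀ hn]
    · rw [map_smul, h0, smul_zero]
  have hB : ∀ i, t (b i) = Kind.B → f (bv i) ≠ 0 := fun i hi =>
    hroot _ _ (bv_ne_zero i) (flip_mem_blockSubgroup.2 hi) (reflectsIn_flip i)
  have hsw : ∀ i j (σ : ℤˣ), i ≠ j → b i = b j → (t (b i) = Kind.A → σ = 1) →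
      f (bv i) ≠ ((σ : ℤ) : ℝ) * f (bv j) := by
    intro i j σ hij hb hA h0
    refine hroot _ _ (rt_ne_zero hij σ) ((sw_mem_blockSubgroup hij).2 ⟨hb, hA⟩)
      (reflectsIn_sw hij σ) ?_
    rw [rt, map_sub, map_smul, smul_eq_mul, h0, sub_self]
  let ε : Fin n → ℤˣ := fun i => if t (b i) = Kind.A ∨ 0 ≤ f (bv i) then 1 else -1
  have hεA : ∀ i, t (b i) = Kind.A → ε i = 1 := fun i h => by simp [ε, h]
  let g : SignedPerm n := ⟨1, ε⟩
  have hginv : g⁻¹ = g := by ext <;> simp [g]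
  let f' : EuclideanSpace ℝ (Fin n) →ₗ[ℝ] ℝ := f ∘ₗ rep n g⁻¹
  have hf' : ∀ i, f' (bv i) = ((ε i : ℤ) : ℝ) * f (bv i) := by
    intro i
    simp only [f', hginv, LinearMap.comp_apply]
    rw [rep_single, map_smul, smul_eq_mul]
    rfl
  -- The value `0` cannot be excluded for kind `D`, where `e_i` is not a root.
  have hnonneg : ∀ i, t (b i) ≠ Kind.A → 0 ≤ f' (bv i) := by
    intro i hi
    rw [hf']
    by_cases h : 0 ≤ f (bv i)
    · simp [ε, h]
    · have h2 : ε i = -1 := by simp [ε, hi, h]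
      rw [h2]
      push_cast
      linarith [not_le.1 h]
  have hx : InjOnBlocks b fun i => f' (bv i) := by
    intro i j hb h
    by_contra hij
    simp only [hf'] at h
    -- Equal heights would make `f` vanish on the root `e_i - ε_i ε_j e_j`.
    refine hsw i j (ε i * ε j) hij hb (fun hA => ?_) ?_
    · rw [hεA i hA, hεA j (hb ▸ hA), one_mul]
    · have := units_cast_sq (ε i)
      push_cast
      linear_combination ((ε i : ℤ) : ℝ) * h - f (bv i) * this
  have hpB : ∀ i, t (b i) = Kind.B → 0 < f' (bv i) := by
    intro i hi
    refine lt_of_le_of_ne (hnonneg i (by simp [hi])) fun h => ?_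
    rw [hf', eq_comm, mul_eq_zero] at h
    refine hB i hi (h.resolve_left ?_)
    intro h0
    have := units_cast_sq (ε i)
    rw [h0, zero_mul] at this
    exact zero_ne_one this
  have hDg : IsSimpleSystem (unitRoots (blockSubgroup b t)) (rep n g '' D) := by
    have h := hDs.image_rep g
    rwa [← unitRoots_conj, map_conj_sign_blockSubgroup hεA] at h
  have heq := hDg.eq (f := f') (fun v hv => hv.1) (isSimpleSystem_unitSimpleRoot hx hD)
    (by
      rintro _ ⟨d, hd, rfl⟩
      simp only [f', LinearMap.comp_apply, rep_inv_rep]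
      exact hf d hd)
    (pos_unitSimpleRoot hx hD hpB fun i hi => hnonneg i (by simp [hi]))
  refine ⟨_, l.map fun w => g * w * g⁻¹, g, hx, ⟨hl.map (MulAut.conj g).injective, fun w => ?_⟩,
    conj_list_prod g l⟩
  rw [← setOf_reflectsIn_unitSimpleRoot hx hD, ← heq]
  obtain ⟨w, rfl⟩ : ∃ w', w = g * w' * g⁻¹ := ⟨g⁻¹ * w * g, by simp [mul_assoc]⟩
  have h1 : w ∈ l ↔ ∃ v ∈ D, w.ReflectsIn v := by
    have := congrArg (w ∈ ·) hS
    simpa using this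
  rw [coxeterSet_conj, ← h1, List.mem_map]
  constructor
  · rintro ⟨w', hw', h⟩
    rwa [← (MulAut.conj g).injective h]
  · exact fun h => ⟨w, h, rfl⟩

end block

end SignedPerm

namespace SignedPerm

variable {n : ℕ}

/-! ### Products of reflections in linearly independent roots -/

theorem ReflectsIn.rep_rep {w : SignedPerm n} {v : EuclideanSpace ℝ (Fin n)} (h : w.ReflectsIn v)
    (y : EuclideanSpace ℝ (Fin n)) : rep n w (rep n w y) = y := by
  rw [h, h, Submodule.reflection_reflection]

theorem ReflectsIn.sub_rep_mem {w : SignedPerm n} {v : EuclideanSpace ℝ (Fin n)}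
    (h : w.ReflectsIn v) (y : EuclideanSpace ℝ (Fin n)) :
    y - rep n w y ∈ Submodule.span ℝ {v} := by
  rw [(reflectsIn_iff w v).1 h, sub_sub_cancel]
  exact Submodule.smul_mem _ _ (Submodule.mem_span_singleton_self v)

/-- Each factor moves a vector by a multiple of its own root. -/
theorem sub_rep_prod_mem {κ : Type*} {r : κ → SignedPerm n} {v : κ → EuclideanSpace ℝ (Fin n)}
    (hr : ∀ i, (r i).ReflectsIn (v i)) (l : List κ) (y : EuclideanSpace ℝ (Fin n)) :
    y - rep n (l.map r).prod y ∈ Submodule.span ℝ (v '' {i | i ∈ l}) := by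
  induction l with
  | nil => simp
  | cons i l ih =>
    rw [List.map_cons, List.prod_cons, map_mul, Module.End.mul_apply]
    set z := rep n (l.map r).prod y
    have h1 : y - z ∈ Submodule.span ℝ (v '' {m | m ∈ i :: l}) :=
      Submodule.span_mono (Set.image_mono fun m hm => List.mem_cons_of_mem _ hm) ih
    have h2 : z - rep n (r i) z ∈ Submodule.span ℝ (v '' {m | m ∈ i :: l}) := by
      refine Submodule.span_mono ?_ ((hr i).sub_rep_mem z)
      rw [Set.singleton_subset_iff]
      exact ⟨i, List.mem_cons_self, rfl⟩
    have h3 : y - rep n (r i) z = (y - z) + (z - rep n (r i) z) := by abel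
    rw [h3]
    exact add_mem h1 h2

/-- A vector fixed by a product of reflections in linearly independent roots is fixed by each of
the factors. -/
theorem rep_eq_of_rep_prod_eq {κ : Type*} {r : κ → SignedPerm n}
    {v : κ → EuclideanSpace ℝ (Fin n)} (hr : ∀ i, (r i).ReflectsIn (v i))
    (hv : LinearIndependent ℝ v) {y : EuclideanSpace ℝ (Fin n)} (l : List κ) (hl : l.Nodup)
    (hy : rep n (l.map r).prod y = y) : ∀ i ∈ l, rep n (r i) y = y := by
  induction l with
  | nil => simp
  | cons i l ih =>
    rw [List.nodup_cons] at hl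
    have h1 := sub_rep_prod_mem hr l y
    have h2 := (hr i).sub_rep_mem y
    rw [List.map_cons, List.prod_cons, map_mul, Module.End.mul_apply] at hy
    -- The first factor is an involution and can be moved to the other side. Then `y - r i y` lies
    -- in the line of `v i` and in the span of the later roots, hence is zero.
    have h3 : rep n (l.map r).prod y = rep n (r i) y := by
      rw [← (hr i).rep_rep (rep n (l.map r).prod y), hy]
    rw [h3] at h1
    have hdis : Disjoint ({i} : Set κ) {m | m ∈ l} := by
      rw [Set.disjoint_singleton_left]
      exact hl.1
    have h4 := hv.disjoint_span_image hdis
    rw [Set.image_singleton] at h4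
    have h5 := sub_eq_zero.1 (Submodule.disjoint_def.1 h4 _ h2 h1)
    intro m hm
    rcases List.mem_cons.1 hm with rfl | hm
    · exact h5.symm
    · exact ih hl.2 (h3.trans h5.symm) m hm

/-! ### Coxeter elements without blocks of kind `D` -/

section block

variable {ι : Type*} [DecidableEq ι] {b : Fin n → ι} {t : ι → Kind} {x : Fin n → ℝ}

theorem prod_fiber_mul {v w : SignedPerm n} (hw : ∀ i, b (w.perm i) = b i) (k : ι) :
    ∏ i ∈ fiber b k, (v * w).sign i =
      (∏ i ∈ fiber b k, v.sign i) * ∏ i ∈ fiber b k, w.sign i := by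
  simp only [mul_sign, Finset.prod_mul_distrib]
  rw [mul_comm]
  congr 1
  exact Finset.prod_equiv w.perm (by simp [hw]) (by simp)

/-- In the absence of kind `D`, the only simple reflections with a sign are the flips at lowest
indices, and each block has one lowest index. -/
theorem prod_fiber_simpleRefl (hx : InjOnBlocks b x) (hnD : ∀ i, t (b i) ≠ Kind.D) {l : Fin n}
    (hl : Last b x l) (i : Fin n) :
    ∏ m ∈ fiber b (b l), (simpleRefl b t x i).sign m = if i = l then -1 else 1 := by
  unfold simpleRefl
  rw [if_neg (hnD i)]
  by_cases h1 : Last b x i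
  · rw [if_pos h1]
    simp only [flip_sign, Finset.prod_ite_eq', mem_fiber]
    congr 1
    exact propext ⟨fun h => h1.eq hx hl h, congrArg b⟩
  · rw [if_neg h1, if_neg (fun h : i = l => h1 (h ▸ hl))]
    have h := adj_nx h1
    exact prod_sw_sign h.ne 1 b h.1 _

/-- A reflection shared by two indices would negate the root of one while moving vectors only along
the root of the other, so the two roots would be proportional. -/
theorem simpleRefl_injective (hx : InjOnBlocks b x)
    (hD : ∀ i, t (b i) = Kind.D → ∃ j, i ≠ j ∧ b i = b j) :
    Function.Injective (simpleRefl b t x) := by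
  intro i m him
  by_contra hne
  have hi := reflectsIn_simpleRefl hx hD i
  have hm := reflectsIn_simpleRefl hx hD m
  set v := simpleRoot b t x i with hv
  rw [← him] at hm
  have h1 := hm.sub_rep_mem v
  have h2 : rep n (simpleRefl b t x i) v = -v := by
    rw [hi, Submodule.reflection_orthogonalComplement_singleton_eq_neg]
  rw [h2, sub_neg_eq_add] at h1
  have h3 : v + v ∈ Submodule.span ℝ {v} :=
    add_mem (Submodule.mem_span_singleton_self v) (Submodule.mem_span_singleton_self v)
  have h4 := (linearIndependent_simpleRoot hx hD).disjoint_span_image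
    (Set.disjoint_singleton.2 hne)
  rw [Set.image_singleton, Set.image_singleton] at h4
  have h5 := Submodule.disjoint_def.1 h4 _ h3 h1
  rw [← two_smul ℝ v, smul_eq_zero] at h5
  exact simpleRoot_ne_zero hx hD i (h5.resolve_left two_ne_zero)

theorem exists_index_list (hx : InjOnBlocks b x)
    (hD : ∀ i, t (b i) = Kind.D → ∃ j, i ≠ j ∧ b i = b j)
    {l : List (SignedPerm n)} (h : IsSimpleList b t x l) :
    ∃ L : List (Fin n), L.Nodup ∧ l = L.map (simpleRefl b t x) ∧
      ∀ i, i ∈ L ↔ i ∈ simpleIndices b t x := by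
  have aux : ∀ l : List (SignedPerm n),
      (∀ w ∈ l, ∃ i ∈ simpleIndices b t x, w = simpleRefl b t x i) →
      ∃ L : List (Fin n), l = L.map (simpleRefl b t x) ∧ ∀ i ∈ L, i ∈ simpleIndices b t x := by
    intro l
    induction l with
    | nil => exact fun _ => ⟨[], rfl, by simp⟩
    | cons w l ih =>
      intro h
      obtain ⟨L, rfl, hL⟩ := ih fun w hw => h w (List.mem_cons_of_mem _ hw)
      obtain ⟨i, hi, rfl⟩ := h w List.mem_cons_self
      refine ⟨i :: L, rfl, fun m hm => ?_⟩
      rcases List.mem_cons.1 hm with rfl | hm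
      · exact hi
      · exact hL m hm
  obtain ⟨L, rfl, hL⟩ := aux l fun w hw => (h.2 w).1 hw
  refine ⟨L, h.1.of_map _, rfl, fun i => ⟨hL i, fun hi => ?_⟩⟩
  obtain ⟨m, hm, h'⟩ := List.mem_map.1 ((h.2 _).2 ⟨i, hi, rfl⟩)
  rwa [← simpleRefl_injective hx hD h']

omit [DecidableEq ι] in
theorem perm_prod_filter (L : List (Fin n)) (hnD : ∀ i, t (b i) ≠ Kind.D)
    [DecidablePred (Last b x)] :
    ((L.filter fun i => ¬ Last b x i).map (simpleRefl b t x)).prod.perm =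
      (L.map (simpleRefl b t x)).prod.perm := by
  induction L with
  | nil => rfl
  | cons i L ih =>
    rw [List.filter_cons]
    by_cases h : Last b x i
    · simp only [h, not_true_eq_false, decide_false, Bool.false_eq_true, if_false, List.map_cons,
        List.prod_cons, mul_perm, ih]
      simp [simpleRefl, h, hnD i]
    · simp only [h, not_false_eq_true, decide_true, if_true, List.map_cons, List.prod_cons,
        mul_perm, ih]

/-- The elements without sign changes. -/
def unsigned (n : ℕ) : Subgroup (SignedPerm n) where
  carrier := {w | ∀ i, w.sign i = 1}
  one_mem' := by simp
  mul_mem' := by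
    intro v w hv hw i
    simp [hv _, hw i]
  inv_mem' := by
    intro w hw i
    simp [hw _]

/-- The indicator vector of a cycle is fixed by the product of the transpositions, hence by each of
them. So neighbouring indices of a block lie in the same cycle. -/
theorem sameCycle_of_simpleList (hx : InjOnBlocks b x) (hnD : ∀ i, t (b i) ≠ Kind.D)
    {l : List (SignedPerm n)} (hl : IsSimpleList b t x l) {i j : Fin n} (hij : b i = b j) :
    l.prod.perm.SameCycle i j := by
  classical
  have hD : ∀ i, t (b i) = Kind.D → ∃ j, i ≠ j ∧ b i = b j := fun i h => absurd h (hnD i)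
  obtain ⟨L, hL, rfl, hLJ⟩ := exists_index_list hx hD hl
  have hadj : ∀ i, ¬ Last b x i → (L.map (simpleRefl b t x)).prod.perm.SameCycle i (nx b x i) := by
    intro i hi
    have hmem : i ∈ L := (hLJ i).2 fun h => absurd h hi
    set c := (L.map (simpleRefl b t x)).prod with hc
    let y : EuclideanSpace ℝ (Fin n) :=
      WithLp.toLp 2 fun m => if c.perm.SameCycle i m then 1 else 0
    -- Dropping the flips removes all signs and keeps the permutation.
    have hy : rep n ((L.filter fun i => ¬ Last b x i).map (simpleRefl b t x)).prod y = y := by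
      have hs : ((L.filter fun i => ¬ Last b x i).map (simpleRefl b t x)).prod ∈ unsigned n := by
        refine list_prod_mem fun w hw => ?_
        obtain ⟨m, hm, rfl⟩ := List.mem_map.1 hw
        have hm' : ¬ Last b x m := by simpa using (List.mem_filter.1 hm).2
        intro k
        simp [simpleRefl, hm']
      set d := ((L.filter fun i => ¬ Last b x i).map (simpleRefl b t x)).prod with hd
      have hdp : d.perm = c.perm := perm_prod_filter L hnD
      ext m
      obtain ⟨m, rfl⟩ := d.perm.surjective m
      rw [rep_apply_perm, hs m]
      simp [y, hdp]
    have h := rep_eq_of_rep_prod_eq (reflectsIn_simpleRefl hx hD)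
      (linearIndependent_simpleRoot hx hD) _ (hL.filter _) hy i (by simp [hmem, hi])
    have ha := adj_nx hi
    rw [simpleRefl, if_neg hi, rep_sw ha.ne, sub_eq_self, smul_eq_zero] at h
    have h1 := h.resolve_right (rt_ne_zero ha.ne 1)
    by_contra hcon
    simp [y, hcon, Equiv.Perm.SameCycle.refl] at h1
  have : WellFounded fun i j : Fin n => x i < x j :=
    haveI : IsTrans (Fin n) fun i j => x i < x j := ⟨fun _ _ _ => lt_trans⟩
    haveI : Std.Irrefl fun i j : Fin n => x i < x j := ⟨fun _ => lt_irrefl _⟩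
    Finite.wellFounded_of_trans_of_irrefl _
  have hdown : ∀ i m, b i = b m → Last b x m →
      (L.map (simpleRefl b t x)).prod.perm.SameCycle i m := by
    intro i
    induction i using this.induction with
    | _ i ih =>
    intro m hb hm
    by_cases hi : Last b x i
    · rw [hi.eq hx hm hb]
    · have ha := adj_nx hi
      exact (hadj i hi).trans (ih _ ha.2.1 m (ha.1.symm.trans hb) hm)
  obtain ⟨m, hb, hm⟩ := exists_last b x i
  exact (hdown i m hb.symm hm).trans (hdown j m (hij.symm.trans hb.symm) hm).symm

theorem zpow_perm_mem_block {w : SignedPerm n} (hw : w ∈ blockSubgroup b t) {i j : Fin n}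
    (h : w.perm.SameCycle i j) : b i = b j := by
  obtain ⟨k, rfl⟩ := h
  have := (Subgroup.zpow_mem _ hw k).1 i
  rw [zpow_perm] at this
  exact this.symm

theorem IsSimpleList.prod_mem (hx : InjOnBlocks b x)
    (hD : ∀ i, t (b i) = Kind.D → ∃ j, i ≠ j ∧ b i = b j)
    {l : List (SignedPerm n)} (hl : IsSimpleList b t x l) : l.prod ∈ blockSubgroup b t := by
  refine list_prod_mem fun w hw => ?_
  obtain ⟨i, hi, rfl⟩ := (hl.2 w).1 hw
  exact simpleRefl_mem hx hD hi

theorem prod_fiber_list_prod (L : List (SignedPerm n)) (hL : ∀ w ∈ L, ∀ i, b (w.perm i) = b i)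
    (k : ι) : ∏ i ∈ fiber b k, L.prod.sign i = (L.map fun w => ∏ i ∈ fiber b k, w.sign i).prod := by
  have hp : ∀ L : List (SignedPerm n), (∀ w ∈ L, ∀ i, b (w.perm i) = b i) →
      ∀ i, b (L.prod.perm i) = b i := by
    intro L
    induction L with
    | nil => simp
    | cons w L ih =>
      intro h i
      rw [List.prod_cons, mul_perm, Equiv.Perm.mul_apply, h w List.mem_cons_self,
        ih fun w hw => h w (List.mem_cons_of_mem _ hw)]
  induction L with
  | nil => simp
  | cons w L ih =>
    have h := fun w hw => hL w (List.mem_cons_of_mem _ hw)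
    rw [List.prod_cons, prod_fiber_mul (hp L h), ih h, List.map_cons, List.prod_cons]

/-- The cycles are exactly the blocks. A block of kind `B` gives a negative cycle because its one
flip occurs exactly once in the product. -/
theorem cycleType_of_forall_ne_D (hx : InjOnBlocks b x) (hnD : ∀ i, t (b i) ≠ Kind.D)
    {l : List (SignedPerm n)} (hl : IsSimpleList b t x l) :
    l.prod.cycleType = (blockType b t Kind.A, blockType b t Kind.B) := by
  have hD : ∀ i, t (b i) = Kind.D → ∃ j, i ≠ j ∧ b i = b j := fun i h => absurd h (hnD i)
  have hmem := hl.prod_mem hx hD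
  have hsc : ∀ i j, l.prod.perm.SameCycle i j ↔ b i = b j :=
    fun i j => ⟨zpow_perm_mem_block hmem, sameCycle_of_simpleList hx hnD hl⟩
  have hcyc : ∀ i, cyc l.prod i = fiber b (b i) := by
    intro i
    ext j
    rw [mem_cyc, mem_fiber, hsc, eq_comm]
  have hkind : ∀ i, t (b i) = cycKind l.prod (cyc l.prod i) := by
    intro i
    rw [cycKind, hcyc]
    rcases hk : t (b i) with _ | _ | _
    · rw [if_pos]
      refine Finset.prod_eq_one fun m hm => hmem.2.1 m ?_
      rw [mem_fiber.1 hm, hk]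
    · obtain ⟨m, hb, hm⟩ := exists_last b x i
      obtain ⟨L, hL, rfl, hLJ⟩ := exists_index_list hx hD hl
      have hmL : m ∈ L := (hLJ m).2 fun _ => by simp [hb, hk]
      rw [if_neg]
      rw [prod_fiber_list_prod, List.map_map, ← hb]
      · have h1 : (fun w : SignedPerm n => ∏ m' ∈ fiber b (b m), w.sign m') ∘ simpleRefl b t x =
            fun i => if i = m then -1 else 1 := funext (prod_fiber_simpleRefl hx hnD hm)
        rw [h1, ← List.prod_toFinset _ hL, Finset.prod_ite_eq', if_pos (List.mem_toFinset.2 hmL)]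
        decide
      · intro w hw i
        obtain ⟨i', hi', rfl⟩ := (hl.2 w).1 hw
        exact (simpleRefl_mem hx hD hi').1 i
    · exact absurd hk (hnD i)
  have h := blockType_eq_of_perm (b := cyc l.prod) (t := cycKind l.prod) (b' := b) (t' := t) 1
    (fun i j => by rw [cyc_eq_cyc_iff, hsc]; rfl) hkind
  rw [cycleType_eq, h, h]

end block

end SignedPerm

namespace SignedPerm

variable {n : ℕ}

/-! ### Splitting a block of kind `D` -/

theorem prod_eq_mul_of_commute {G : Type*} [Group G] {l : List G} {s : G} (hs : s ∈ l)
    (h : ∀ y ∈ l, Commute s y) : ∃ l', List.Perm (s :: l') l ∧ l.prod = s * l'.prod := by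
  obtain ⟨l₁, l₂, rfl⟩ := List.append_of_mem hs
  refine ⟨l₁ ++ l₂, List.perm_middle.symm, ?_⟩
  have h1 : Commute s l₁.prod := Commute.list_prod_right _ _ fun y hy => h y (by simp [hy])
  rw [List.prod_append, List.prod_append, List.prod_cons, ← mul_assoc, ← mul_assoc, h1.eq]

/-- Conjugation rotates the list until `r`, the only factor that may fail to commute with `s` and
`s'`, stands last. Then `s` and `s'` can be moved to the front. -/
theorem exists_isConj_prod {G : Type*} [Group G] {l : List G} (hl : l.Nodup) {s s' r : G}
    (hs : s ∈ l) (hs' : s' ∈ l) (hss : s ≠ s') (hrs : r ≠ s) (hrs' : r ≠ s')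
    (h : ∀ y ∈ l, y ≠ r → Commute s y) (h' : ∀ y ∈ l, y ≠ r → Commute s' y) :
    ∃ l', List.Perm (s :: s' :: l') l ∧ IsConj l.prod (s * s' * l'.prod) := by
  have key : ∀ m : List G, m.Nodup → s ∈ m → s' ∈ m → (∀ y ∈ m, Commute s y) →
      (∀ y ∈ m, Commute s' y) →
      ∃ l', List.Perm (s :: s' :: l') m ∧ m.prod = s * s' * l'.prod := by
    intro m _ hsm hsm' h1 h2
    obtain ⟨m₁, hp, hprod⟩ := prod_eq_mul_of_commute hsm h1
    have h3 : s' ∈ m₁ := by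
      rcases List.mem_cons.1 (hp.mem_iff.2 hsm') with h4 | h4
      · exact absurd h4.symm hss
      · exact h4
    obtain ⟨m₂, hp', hprod'⟩ := prod_eq_mul_of_commute h3 fun y hy =>
      h2 y (hp.mem_iff.1 (List.mem_cons_of_mem _ hy))
    exact ⟨m₂, (List.Perm.cons s hp').trans hp, by rw [hprod, hprod', mul_assoc]⟩
  by_cases hr : r ∈ l
  · obtain ⟨l₁, l₂, rfl⟩ := List.append_of_mem hr
    have hperm : List.Perm (r :: (l₂ ++ l₁)) (l₁ ++ r :: l₂) :=
      (List.Perm.cons r List.perm_append_comm).trans List.perm_middle.symm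
    have hnd := hperm.nodup_iff.2 hl
    rw [List.nodup_cons] at hnd
    have hmem : ∀ y ∈ l₂ ++ l₁, y ∈ l₁ ++ r :: l₂ ∧ y ≠ r := by
      intro y hy
      refine ⟨hperm.mem_iff.1 (List.mem_cons_of_mem _ hy), ?_⟩
      rintro rfl
      exact hnd.1 hy
    have hin : ∀ y ∈ l₁ ++ r :: l₂, y ≠ r → y ∈ l₂ ++ l₁ := by
      intro y hy hyr
      exact (List.mem_cons.1 (hperm.mem_iff.2 hy)).resolve_left hyr
    obtain ⟨l', hp, hprod⟩ := key (l₂ ++ l₁) hnd.2 (hin s hs hrs.symm) (hin s' hs' hrs'.symm)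
      (fun y hy => h y (hmem y hy).1 (hmem y hy).2) (fun y hy => h' y (hmem y hy).1 (hmem y hy).2)
    refine ⟨l' ++ [r], ?_, ?_⟩
    · have h1 : List.Perm (s :: s' :: (l' ++ [r])) (r :: s :: s' :: l') := by
        rw [← List.cons_append, ← List.cons_append]
        exact List.perm_append_singleton r _
      exact h1.trans ((List.Perm.cons r hp).trans hperm)
    · have h1 : s * s' * (l' ++ [r]).prod = (l₂ ++ l₁).prod * r := by
        rw [hprod, List.prod_append, List.prod_singleton, mul_assoc, mul_assoc, mul_assoc]
      rw [h1, isConj_iff]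
      exact ⟨l₂.prod, by simp [mul_assoc]⟩
  · obtain ⟨l', hp, hprod⟩ := key l hl hs hs' (fun y hy => h y hy fun e => hr (e ▸ hy))
      (fun y hy => h' y hy fun e => hr (e ▸ hy))
    exact ⟨l', hp, hprod ▸ IsConj.refl _⟩

theorem commute_sw_sw {i j k l : Fin n} (hij : i ≠ j) (hki : k ≠ i) (hkj : k ≠ j) (hli : l ≠ i)
    (hlj : l ≠ j) (σ τ : ℤˣ) : Commute (sw k l τ) (sw i j σ) := by
  have h := conj_sw (sw k l τ) hij σ
  rw [mul_inv_eq_iff_eq_mul] at h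
  unfold Commute SemiconjBy
  simpa [Equiv.swap_apply_of_ne_of_ne, hki.symm, hkj.symm, hli.symm, hlj.symm] using h

theorem commute_flip_sw {i j k : Fin n} (hij : i ≠ j) (hki : k ≠ i) (hkj : k ≠ j) (σ : ℤˣ) :
    Commute (flip k) (sw i j σ) := by
  have h := conj_sw (flip k) hij σ
  rw [mul_inv_eq_iff_eq_mul] at h
  unfold Commute SemiconjBy
  simpa [hki.symm, hkj.symm] using h

theorem commute_sw_sw_self {i j : Fin n} (hij : i ≠ j) (σ τ : ℤˣ) :
    Commute (sw i j τ) (sw i j σ) := by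
  have h := conj_sw (sw i j τ) hij σ
  rw [mul_inv_eq_iff_eq_mul] at h
  simp only [sw_perm, Equiv.swap_apply_left, Equiv.swap_apply_right, sw_sign, true_or, or_true,
    if_true] at h
  rw [mul_right_comm, Int.units_mul_self, one_mul, sw_comm j i] at h
  exact h

section block

variable {ι : Type*} [DecidableEq ι] {b : Fin n → ι} {t : ι → Kind} {x : Fin n → ℝ}

omit [DecidableEq ι] in
theorem Adj.nx_eq (hx : InjOnBlocks b x) {i j : Fin n} (h : Adj b x i j) : nx b x i = j := by
  have h' : Adj b x i (nx b x i) := by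
    rw [nx, dif_pos ⟨j, h⟩]
    exact Exists.choose_spec (⟨j, h⟩ : ∃ j, Adj b x i j)
  refine hx _ _ (h'.1.symm.trans h.1) (le_antisymm ?_ ?_)
  · exact (h.2.2 _ h'.1.symm).resolve_right (not_le.2 h'.2.1)
  · exact (h'.2.2 _ h.1.symm).resolve_right (not_le.2 h.2.1)

omit [DecidableEq ι] in
theorem Adj.left_unique (hx : InjOnBlocks b x) {i i' j : Fin n} (h : Adj b x i j)
    (h' : Adj b x i' j) : i = i' := by
  refine hx _ _ (h.1.trans h'.1.symm) (le_antisymm ?_ ?_)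
  · exact (h.2.2 _ (h'.1.trans h.1.symm)).resolve_left (not_le.2 h'.2.1)
  · exact (h'.2.2 _ (h.1.trans h'.1.symm)).resolve_left (not_le.2 h.2.1)

omit [DecidableEq ι] in
theorem Adj.pv_eq (hx : InjOnBlocks b x) {i j : Fin n} (h : Adj b x i j) : pv b x j = i := by
  have h' : Adj b x (pv b x j) j := by
    rw [pv, dif_pos ⟨i, h⟩]
    exact Exists.choose_spec (⟨i, h⟩ : ∃ i, Adj b x i j)
  exact h'.left_unique hx h

/-- The point `j` is split off its block. -/
def splitBlocks (b : Fin n → ι) (j m : Fin n) : Option ι := if m = j then none else some (b m)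

/-- The new block and the block with index `k` are of kind `B`. -/
def splitKind (t : ι → Kind) (k : ι) : Option ι → Kind
  | none => Kind.B
  | some k' => if k' = k then Kind.B else t k'

omit [DecidableEq ι] in
theorem splitBlocks_of_ne {j m : Fin n} (h : m ≠ j) : splitBlocks b j m = some (b m) := by
  simp [splitBlocks, h]

omit [DecidableEq ι] in
theorem splitBlocks_eq_iff {j m m' : Fin n} (h : m ≠ j) :
    splitBlocks b j m' = splitBlocks b j m ↔ m' ≠ j ∧ b m' = b m := by
  rw [splitBlocks_of_ne h, splitBlocks]
  split_ifs with h1 <;> simp [h1]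

omit [DecidableEq ι] in
theorem injOnBlocks_split (hx : InjOnBlocks b x) (j : Fin n) : InjOnBlocks (splitBlocks b j) x := by
  intro i m h hxe
  by_cases hm : m = j
  · subst hm
    by_contra hi
    simp [splitBlocks, hi] at h
  · exact hx i m ((splitBlocks_eq_iff hm).1 h).2 hxe

theorem splitKind_eq_D {j m : Fin n} {k : ι} (h : splitKind t k (splitBlocks b j m) = Kind.D) :
    m ≠ j ∧ b m ≠ k ∧ t (b m) = Kind.D := by
  by_cases hm : m = j
  · simp [splitBlocks, hm, splitKind] at h
  · rw [splitBlocks_of_ne hm, splitKind] at h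
    split_ifs at h with h1
    exact ⟨hm, h1, h⟩

theorem exists_ne_split {j : Fin n} (hD : ∀ i, t (b i) = Kind.D → ∃ j, i ≠ j ∧ b i = b j) :
    ∀ i, splitKind t (b j) (splitBlocks b j i) = Kind.D →
      ∃ m, i ≠ m ∧ splitBlocks b j i = splitBlocks b j m := by
  intro i hi
  obtain ⟨h1, h2, h3⟩ := splitKind_eq_D hi
  obtain ⟨m, hm, hb⟩ := hD i h3
  refine ⟨m, hm, ?_⟩
  have hmj : m ≠ j := by
    rintro rfl
    exact h2 hb
  rw [splitBlocks_eq_iff hmj]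
  exact ⟨h1, hb⟩

variable {j : Fin n} (hx : InjOnBlocks b x) (hj : Last b x j)

omit [DecidableEq ι] in
include hx hj in
theorem last_split_iff {m : Fin n} (hmj : m ≠ j) (hm : m ≠ pv b x j) :
    Last (splitBlocks b j) x m ↔ Last b x m := by
  constructor
  · intro h
    by_contra hl
    rw [Last] at hl
    push Not at hl
    obtain ⟨p, hp, hlt⟩ := hl
    by_cases hpj : p = j
    · subst hpj
      have ha : Adj b x m p := by
        refine ⟨hp.symm, hlt, fun q hq => ?_⟩
        by_cases hqp : q = p
        · exact Or.inl (by rw [hqp])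
        · exact Or.inr (h q ((splitBlocks_eq_iff hmj).2 ⟨hqp, hq⟩))
      exact hm (ha.pv_eq hx).symm
    · exact absurd (h p ((splitBlocks_eq_iff hmj).2 ⟨hpj, hp⟩)) (not_le.2 hlt)
  · exact fun h p hp => h p ((splitBlocks_eq_iff hmj).1 hp).2

omit [DecidableEq ι] hx hj in
theorem last_split_self : Last (splitBlocks b j) x j := by
  intro m hm
  by_cases h : m = j
  · rw [h]
  · simp [splitBlocks, h] at hm

omit [DecidableEq ι] in
include hx hj in
theorem last_split_of_adj {i : Fin n} (h : Adj b x i j) : Last (splitBlocks b j) x i := by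
  intro m hm
  obtain ⟨h1, h2⟩ := (splitBlocks_eq_iff h.ne).1 hm
  refine (h.2.2 m h2).resolve_left fun h3 => h1 ?_
  have h4 : b m = b j := h2.trans h.1
  exact hx m j h4 (le_antisymm h3 (hj m h4))

omit [DecidableEq ι] hx hj in
theorem adj_split {m k : Fin n} (hmj : m ≠ j) (hkj : k ≠ j) (h : Adj b x m k) :
    Adj (splitBlocks b j) x m k := by
  refine ⟨(splitBlocks_eq_iff hkj).2 ⟨hmj, h.1⟩, h.2.1, fun q hq => ?_⟩
  exact h.2.2 q ((splitBlocks_eq_iff hmj).1 hq).2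

-- Apart from `j` and its upper neighbour, no index has a simple reflection involving a neighbour
-- relation with `j`.
include hx hj in
theorem simpleRefl_split (hD : ∀ i, t (b i) = Kind.D → ∃ j, i ≠ j ∧ b i = b j) {m : Fin n}
    (hmj : m ≠ j) (hm : m ≠ pv b x j) :
    simpleRefl (splitBlocks b j) (splitKind t (b j)) x m = simpleRefl b t x m := by
  have hx' := injOnBlocks_split hx j
  unfold simpleRefl
  by_cases h : Last b x m
  · have hbm : b m ≠ b j := fun hb => hmj (h.eq hx hj hb)
    have hk : splitKind t (b j) (splitBlocks b j m) = t (b m) := by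
      rw [splitBlocks_of_ne hmj, splitKind, if_neg hbm]
    rw [if_pos h, if_pos ((last_split_iff hx hj hmj hm).2 h), hk]
    by_cases hd : t (b m) = Kind.D
    · rw [if_pos hd, if_pos hd]
      have ha := h.adj_pv hx hD hd
      have hpj : pv b x m ≠ j := by
        intro hp
        rw [hp] at ha
        exact hbm ha.1.symm
      rw [(adj_split hpj hmj ha).pv_eq hx']
    · rw [if_neg hd, if_neg hd]
  · rw [if_neg h, if_neg (fun h' => h ((last_split_iff hx hj hmj hm).1 h'))]
    have ha := adj_nx h
    have hnj : nx b x m ≠ j := by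
      intro hn
      rw [hn] at ha
      exact hm (ha.pv_eq hx).symm
    rw [(adj_split hmj hnj ha).nx_eq hx']

include hx hj in
theorem mem_simpleIndices_split {m : Fin n} (hmj : m ≠ j) (hm : m ≠ pv b x j) :
    m ∈ simpleIndices (splitBlocks b j) (splitKind t (b j)) x ↔ m ∈ simpleIndices b t x := by
  unfold simpleIndices
  rw [Set.mem_ofPred_eq, Set.mem_ofPred_eq, last_split_iff hx hj hmj hm]
  refine forall_congr' fun h => ?_
  have hbm : b m ≠ b j := fun hb => hmj (h.eq hx hj hb)
  rw [splitBlocks_of_ne hmj, splitKind, if_neg hbm]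

-- With `i` just above the lowest index `j`, the reflections `sw i j 1` and `sw i j (-1)` form the
-- fork of the diagram. Brought together by conjugation, they multiply to `flip i * flip j`. After
-- the split, these flips are the simple reflections at the lowest index `i` of the remaining block
-- and at the one-point block `{j}`, both of kind `B`.
include hx hj in
theorem IsSimpleList.exists_split (hD : ∀ i, t (b i) = Kind.D → ∃ j, i ≠ j ∧ b i = b j)
    (hjD : t (b j) = Kind.D) {l : List (SignedPerm n)} (hl : IsSimpleList b t x l) :
    ∃ l', IsSimpleList (splitBlocks b j) (splitKind t (b j)) x l' ∧ IsConj l.prod l'.prod := by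
  classical
  have ha := hj.adj_pv hx hD hjD
  set i := pv b x j with hi
  have hil : ¬ Last b x i := ha.not_last
  have hij : i ≠ j := ha.ne
  have hinj := simpleRefl_injective (t := t) hx hD
  have hsi : simpleRefl b t x i = sw i j 1 := by
    rw [simpleRefl, if_neg hil, ha.nx_eq hx]
  have hsj : simpleRefl b t x j = sw i j (-1) := by
    rw [simpleRefl, if_pos hj, if_pos hjD]
  have hiJ : i ∈ simpleIndices b t x := fun h => absurd h hil
  have hjJ : j ∈ simpleIndices b t x := fun _ => by simp [hjD]
  have hfl : ∀ m, b m = b j → flip m ∉ l := by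
    intro m hm hmem
    obtain ⟨k, hk, h⟩ := (hl.2 _).1 hmem
    have h1 := simpleRefl_mem hx hD hk
    rw [← h, flip_mem_blockSubgroup, hm, hjD] at h1
    exact absurd h1 (by decide)
  -- `r` is the simple reflection joining `i` to the next higher index, the only possible neighbour
  -- of the fork. If the block has just two elements there is none, and `flip i`, which is not in
  -- `l`, serves as a dummy.
  let r : SignedPerm n := if ∃ p, Adj b x p i then sw (pv b x i) i 1 else flip i
  have hr : ∀ σ, r ≠ sw i j σ := by
    intro σ h
    have h1 := congrArg (fun w => w.perm j) h
    simp only [r] at h1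
    split_ifs at h1 with h2
    · obtain ⟨p, hp⟩ := h2
      rw [hp.pv_eq hx] at h1
      have hpj : j ≠ p := by
        rintro rfl
        exact lt_asymm hp.2.1 ha.2.1
      simp [Equiv.swap_apply_of_ne_of_ne hpj hij.symm, hij.symm] at h1
    · simp [hij.symm] at h1
  have hcomm : ∀ σ, ∀ y ∈ l, y ≠ r → Commute (sw i j σ) y := by
    intro σ y hy hyr
    obtain ⟨m, hm, rfl⟩ := (hl.2 y).1 hy
    by_cases hmi : m = i
    · rw [hmi, hsi]
      exact commute_sw_sw_self hij _ _
    by_cases hmj : m = j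
    · rw [hmj, hsj]
      exact commute_sw_sw_self hij _ _
    unfold simpleRefl at hyr ⊢
    by_cases hml : Last b x m
    · have hbm : b m ≠ b j := fun hb => hmj (hml.eq hx hj hb)
      rw [if_pos hml]
      by_cases hd : t (b m) = Kind.D
      · rw [if_pos hd]
        have hp := hml.adj_pv hx hD hd
        refine (commute_sw_sw hij ?_ ?_ hmi hmj _ _).symm
        · intro h
          exact hbm (hp.1.symm.trans (by rw [h, ha.1]))
        · intro h
          exact hbm (hp.1.symm.trans (by rw [h]))
      · rw [if_neg hd]
        exact (commute_flip_sw hij hmi hmj _).symm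
    · rw [if_neg hml] at hyr ⊢
      have hn := adj_nx hml
      refine (commute_sw_sw hij hmi hmj ?_ ?_ _ _).symm
      · intro h
        rw [h] at hn hyr
        refine hyr ?_
        simp only [r]
        rw [if_pos ⟨m, hn⟩, hn.pv_eq hx]
      · intro h
        rw [h] at hn
        exact hmi (hn.left_unique hx ha)
  have hsmem : sw i j 1 ∈ l := (hl.2 _).2 ⟨i, hiJ, hsi.symm⟩
  have hsmem' : sw i j (-1) ∈ l := (hl.2 _).2 ⟨j, hjJ, hsj.symm⟩
  have hss : sw i j 1 ≠ sw i j (-1) := by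
    rw [← hsi, ← hsj]
    exact fun h => hij (hinj h)
  obtain ⟨l', hp, hc⟩ := exists_isConj_prod hl.1 hsmem hsmem' hss (hr 1) (hr (-1)) (hcomm 1)
    (hcomm (-1))
  rw [sw_one_mul_sw_neg_one hij] at hc
  have hsub : ∀ w ∈ l', w ∈ l := fun w hw =>
    hp.mem_iff.1 (List.mem_cons_of_mem _ (List.mem_cons_of_mem _ hw))
  have hnd := hp.nodup_iff.2 hl.1
  rw [List.nodup_cons, List.nodup_cons, List.mem_cons, not_or] at hnd
  have hri : simpleRefl (splitBlocks b j) (splitKind t (b j)) x i = flip i := by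
    rw [simpleRefl, if_pos (last_split_of_adj hx hj ha), splitBlocks_of_ne hij, splitKind,
      if_pos ha.1, if_neg (by decide)]
  have hrj : simpleRefl (splitBlocks b j) (splitKind t (b j)) x j = flip j := by
    rw [simpleRefl, if_pos last_split_self]
    simp [splitBlocks, splitKind]
  refine ⟨flip i :: flip j :: l', ⟨?_, fun w => ?_⟩, by simpa [mul_assoc] using hc⟩
  · rw [List.nodup_cons, List.nodup_cons, List.mem_cons, not_or]
    refine ⟨⟨fun h => ?_, fun h => hfl i ha.1 (hsub _ h)⟩, fun h => hfl j rfl (hsub _ h), hnd.2.2⟩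
    have h1 := congrArg (fun w => w.sign i) h
    simp [hij] at h1
  · rw [List.mem_cons, List.mem_cons]
    constructor
    · rintro (rfl | rfl | hw)
      · refine ⟨i, fun _ => ?_, hri.symm⟩
        rw [splitBlocks_of_ne hij, splitKind, if_pos ha.1]
        decide
      · refine ⟨j, fun _ => ?_, hrj.symm⟩
        simp [splitBlocks, splitKind]
      · obtain ⟨m, hm, rfl⟩ := (hl.2 w).1 (hsub w hw)
        have hmi : m ≠ i := by
          rintro rfl
          rw [hsi] at hw
          exact hnd.1.2 hw
        have hmj : m ≠ j := by
          rintro rfl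
          rw [hsj] at hw
          exact hnd.2.1 hw
        exact ⟨m, (mem_simpleIndices_split hx hj hmj hmi).2 hm,
          (simpleRefl_split hx hj hD hmj hmi).symm⟩
    · rintro ⟨m, hm, rfl⟩
      by_cases hmi : m = i
      · exact Or.inl (hmi ▸ hri)
      by_cases hmj : m = j
      · exact Or.inr (Or.inl (hmj ▸ hrj))
      right
      right
      rw [simpleRefl_split hx hj hD hmj hmi]
      have h1 : simpleRefl b t x m ∈ l :=
        (hl.2 _).2 ⟨m, (mem_simpleIndices_split hx hj hmj hmi).1 hm, rfl⟩
      rcases List.mem_cons.1 (hp.mem_iff.2 h1) with h2 | h2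
      · rw [← hsi] at h2
        exact absurd (hinj h2) hmi
      · rcases List.mem_cons.1 h2 with h3 | h3
        · rw [← hsj] at h3
          exact absurd (hinj h3) hmj
        · exact h3

omit hx hj in
theorem blockType_eq_add (b : Fin n → ι) (t : ι → Kind) {k : ι} (hk : k ∈ Finset.univ.image b)
    (κ : Kind) :
    blockType b t κ = (if t k = κ then {(fiber b k).card} else 0) +
      ((((Finset.univ.image b).erase k).filter fun k => t k = κ).val.map
        fun k => (fiber b k).card) := by
  rw [blockType]
  conv_lhs => rw [← Finset.insert_erase hk]
  rw [Finset.filter_insert]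
  split_ifs with h
  · rw [Finset.insert_val_of_notMem (by simp), Multiset.map_cons, Multiset.singleton_add]
  · rw [zero_add]

-- Compared with `blockType_eq_add`, the block of `j` is replaced by blocks of sizes `1` and `card -
-- 1` of kind `B`. The partner `i` keeps the second one nonempty, so that it is counted.
omit hx hj in
theorem blockType_split (i : Fin n) (hij : i ≠ j) (hb : b i = b j) (κ : Kind) :
    blockType (splitBlocks b j) (splitKind t (b j)) κ =
      (if Kind.B = κ then {1, (fiber b (b j)).card - 1} else 0) +
        ((((Finset.univ.image b).erase (b j)).filter fun k => t k = κ).val.map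
          fun k => (fiber b k).card) := by
  have h1 : (none : Option ι) ∈ Finset.univ.image (splitBlocks b j) := by
    rw [Finset.mem_image]
    exact ⟨j, Finset.mem_univ _, by simp [splitBlocks]⟩
  have hf1 : fiber (splitBlocks b j) none = {j} := by
    ext m
    rw [mem_fiber, Finset.mem_singleton, splitBlocks]
    split_ifs with h <;> simp [h]
  have hf2 : ∀ k, k ≠ b j → fiber (splitBlocks b j) (some k) = fiber b k := by
    intro k hk
    ext m
    rw [mem_fiber, mem_fiber, splitBlocks]
    split_ifs with h
    · subst h
      simp [hk.symm]
    · simp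
  have hf3 : fiber (splitBlocks b j) (some (b j)) = (fiber b (b j)).erase j := by
    ext m
    rw [mem_fiber, Finset.mem_erase, mem_fiber, splitBlocks]
    split_ifs with h <;> simp [h]
  have himg : (Finset.univ.image (splitBlocks b j)).erase none =
      (Finset.univ.image b).map Function.Embedding.some := by
    ext k
    rw [Finset.mem_erase, Finset.mem_image, Finset.mem_map]
    constructor
    · rintro ⟨hk, m, -, rfl⟩
      have hm : m ≠ j := by
        rintro rfl
        simp [splitBlocks] at hk
      exact ⟨b m, by simp, (splitBlocks_of_ne hm).symm⟩
    · rintro ⟨k, hk, rfl⟩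
      obtain ⟨m, -, rfl⟩ := Finset.mem_image.1 hk
      refine ⟨by simp, ?_⟩
      by_cases hm : m = j
      · exact ⟨i, Finset.mem_univ _, by rw [splitBlocks_of_ne hij, hm, hb]; rfl⟩
      · exact ⟨m, Finset.mem_univ _, splitBlocks_of_ne hm⟩
  have hins : Finset.univ.image b = insert (b j) ((Finset.univ.image b).erase (b j)) :=
    (Finset.insert_erase (by simp)).symm
  rw [blockType_eq_add _ _ h1, himg.trans (congrArg _ hins), hf1, Finset.map_insert, Finset.filter_insert]
  have hrest : ((((Finset.univ.image b).erase (b j)).map Function.Embedding.some).filter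
      fun k => splitKind t (b j) k = κ) =
      (((Finset.univ.image b).erase (b j)).filter fun k => t k = κ).map Function.Embedding.some := by
    rw [Finset.filter_map]
    congr 1
    refine Finset.filter_congr fun k hk => ?_
    simp [splitKind, (Finset.mem_erase.1 hk).1]
  have hmap : ((((Finset.univ.image b).erase (b j)).filter fun k => t k = κ).map
      Function.Embedding.some).val.map (fun k => (fiber (splitBlocks b j) k).card) =
      ((((Finset.univ.image b).erase (b j)).filter fun k => t k = κ).val.map
          fun k => (fiber b k).card) := by
    rw [Finset.map_val, Multiset.map_map]
    refine Multiset.map_congr rfl fun k hk => ?_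
    have hk' := (Finset.mem_filter (s := (Finset.univ.image b).erase (b j)).1 hk).1
    simp only [Function.comp, Function.Embedding.some_apply]
    rw [hf2 k (Finset.mem_erase.1 hk').1]
  rw [hrest]
  have hkind : splitKind t (b j) (Function.Embedding.some (b j)) = Kind.B := by
    simp [splitKind]
  rw [hkind]
  simp only [splitKind, Finset.card_singleton]
  split_ifs with h
  · rw [Finset.insert_val_of_notMem (by simp), Multiset.map_cons, hmap]
    simp only [Function.Embedding.some_apply]
    rw [hf3, Finset.card_erase_of_mem (by simp)]
    simp
  · rw [hmap]

/-- The product of the simple reflections, in any order, has the expected signed cycle type. -/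
theorem cycleType_prod_of_isSimpleList (N : ℕ) :
    -- The index type is quantified inside the induction because splitting a block replaces `ι` by
    -- `Option ι`. The heights `x` stay the same.
    ∀ {ι : Type} [DecidableEq ι] {b : Fin n → ι} {t : ι → Kind} {l : List (SignedPerm n)},
      InjOnBlocks b x → (∀ i, t (b i) = Kind.D → ∃ j, i ≠ j ∧ b i = b j) →
      IsSimpleList b t x l → (blockType b t Kind.D).card = N →
      l.prod.cycleType = (blockType b t Kind.A,
        blockType b t Kind.B + (blockType b t Kind.D).map (fun k => k - 1) +
          Multiset.replicate (blockType b t Kind.D).card 1) := by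
  induction N with
  | zero =>
    intro ι _ b t l hx hD hl hN
    rw [Multiset.card_eq_zero] at hN
    have hnD : ∀ i, t (b i) ≠ Kind.D := by
      intro i hi
      have h : (fiber b (b i)).card ∈ blockType b t Kind.D :=
        Multiset.mem_map_of_mem _ (by simp [hi])
      rw [hN] at h
      exact Multiset.notMem_zero _ h
    rw [cycleType_of_forall_ne_D hx hnD hl, hN]
    simp
  | succ N ih =>
    intro ι _ b t l hx hD hl hN
    obtain ⟨s, hs⟩ := Multiset.card_pos_iff_exists_mem.1 (by rw [hN]; exact Nat.succ_pos N)
    simp only [blockType, Multiset.mem_map, Finset.mem_val, Finset.mem_filter, Finset.mem_image,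
      Finset.mem_univ, true_and] at hs
    obtain ⟨_, ⟨⟨i, rfl⟩, hi⟩, -⟩ := hs
    obtain ⟨j, hbj, hj⟩ := exists_last b x i
    have hjD : t (b j) = Kind.D := by rw [hbj, hi]
    obtain ⟨p, hjp, hbp⟩ := hD j hjD
    obtain ⟨l', hl', hc⟩ := hl.exists_split hx hj hD hjD
    obtain ⟨g, hg⟩ := isConj_iff.1 hc
    have h1 := fun κ => blockType_eq_add b t (show b j ∈ Finset.univ.image b by simp) κ
    have h2 := blockType_split (t := t) p hjp.symm hbp.symm
    have hA := (h2 Kind.A).trans ((congrArg (· + _) (by simp [hjD])).trans (h1 Kind.A).symm)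
    have hB1 := h1 Kind.B
    have hB2 := h2 Kind.B
    have hD1 := h1 Kind.D
    have hD2 := h2 Kind.D
    simp only [hjD, if_true, reduceCtorEq, if_false, zero_add] at hB1 hB2 hD1 hD2
    rw [← hB1] at hB2
    rw [← hD2] at hD1
    have hcard : (blockType (splitBlocks b j) (splitKind t (b j)) Kind.D).card = N := by
      rw [hD1, Multiset.card_add, Multiset.card_singleton] at hN
      omega
    have h := ih (injOnBlocks_split hx j) (exists_ne_split hD) hl' hcard
    rw [← hg, cycleType_conj] at h
    rw [h, hA, hB2, hD1]
    congr 1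
    simp only [Multiset.card_add, Multiset.card_singleton, Multiset.map_add, Multiset.map_singleton,
      Multiset.replicate_add, Multiset.replicate_one, Multiset.insert_eq_cons,
      ← Multiset.singleton_add]
    abel

end block

end SignedPerm

/-! ### Coxeter elements of reflection subgroups and the class map -/

namespace RPartition

open SignedPerm

variable {n : ℕ}

theorem exists_isCoxeterElement {p : RPartition 3 n} (hp : ∀ k ∈ p.parts 2, 1 < k) :
    ∃ c, IsCoxeterElement p.subgroup c :=
  exists_isCoxeterElement_blockSubgroup (exists_ne_index_of_kind_eq_D hp)

theorem cycleType_of_isCoxeterElement {p : RPartition 3 n} (hp : ∀ k ∈ p.parts 2, 1 < k)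
    {c : SignedPerm n} (hc : IsCoxeterElement p.subgroup c) :
    c.cycleType = (p.parts 0,
      p.parts 1 + (p.parts 2).map (fun k => k - 1) + Multiset.replicate (p.parts 2).card 1) := by
  have hD := exists_ne_index_of_kind_eq_D hp
  obtain ⟨x, l, g, hx, hl, hprod⟩ := hc.exists_isSimpleList hD
  have h := cycleType_prod_of_isSimpleList _ hx hD hl rfl
  rw [hprod, cycleType_conj, blockType_eq, blockType_eq, blockType_eq] at h
  exact h

/-- Both elements are conjugate to Coxeter elements of the same `W_λ`, whose cycle type depends on
`λ` only. -/
theorem isConj_of_isCoxeterElement {R R' : Subgroup (SignedPerm n)}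
    (hR : IsReflectionSubgroup R) (h : ConjSubgroups R R') {c c' : SignedPerm n}
    (hc : IsCoxeterElement R c) (hc' : IsCoxeterElement R' c') : IsConj c c' := by
  obtain ⟨p, ⟨hp, hRp⟩, -⟩ := existsUnique_conjSubgroups hR
  obtain ⟨g', hg'⟩ := conjSubgroups_trans (conjSubgroups_symm h) hRp
  obtain ⟨g, hg⟩ := hRp
  have h1 := hc.conj g
  have h2 := hc'.conj g'
  rw [← hg] at h1
  rw [← hg'] at h2
  refine isConj_of_cycleType_eq ?_
  rw [← cycleType_conj g c, ← cycleType_conj g' c', cycleType_of_isCoxeterElement hp h1,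
    cycleType_of_isCoxeterElement hp h2]

theorem exists_isCoxeterElement_of_isReflectionSubgroup {R : Subgroup (SignedPerm n)}
    (hR : IsReflectionSubgroup R) : ∃ c, IsCoxeterElement R c := by
  obtain ⟨p, ⟨hp, hRp⟩, -⟩ := existsUnique_conjSubgroups hR
  obtain ⟨g, hg⟩ := conjSubgroups_symm hRp
  obtain ⟨c, hc⟩ := exists_isCoxeterElement hp
  exact ⟨g * c * g⁻¹, hg ▸ hc.conj g⟩

/-- The class of the Coxeter elements of a reflection subgroup. -/
noncomputable def coxeterClass (n : ℕ) : ReflectionClasses n → ConjClasses (SignedPerm n) :=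
  Quotient.lift
    (fun R => ConjClasses.mk (exists_isCoxeterElement_of_isReflectionSubgroup R.2).choose)
    fun R R' h => ConjClasses.mk_eq_mk_iff_isConj.2 (isConj_of_isCoxeterElement R.2 h
      (exists_isCoxeterElement_of_isReflectionSubgroup R.2).choose_spec
      (exists_isCoxeterElement_of_isReflectionSubgroup R'.2).choose_spec)

theorem isCoxeterClassMap_coxeterClass (n : ℕ) : IsCoxeterClassMap (coxeterClass n) := fun R =>
  ⟨exists_isCoxeterElement_of_isReflectionSubgroup R.2, fun _ hc =>
    ConjClasses.mk_eq_mk_iff_isConj.2 (isConj_of_isCoxeterElement R.2 ⟨1, by ext x; simp⟩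
      (exists_isCoxeterElement_of_isReflectionSubgroup R.2).choose_spec hc)⟩

/-- For given `w`, take the positive cycle lengths as `λ^1`, the negative ones as `λ^2`, and `λ^3 =
∅`. -/
theorem surjective_coxeterClass (n : ℕ) : Function.Surjective (coxeterClass n) := by
  intro C
  obtain ⟨w, rfl⟩ := ConjClasses.exists_rep C
  let p : RPartition 3 n := ofBlocks (cyc w) (cycKind w)
  have hp2 : p.parts 2 = 0 := blockType_cyc_D w
  have hp : ∀ k ∈ p.parts 2, 1 < k := by simp [hp2]
  obtain ⟨c, hc⟩ := exists_isCoxeterElement hp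
  refine ⟨Quotient.mk _ ⟨p.subgroup, isReflectionSubgroup_blockSubgroup⟩, ?_⟩
  rw [(isCoxeterClassMap_coxeterClass n _).2 c hc]
  refine ConjClasses.mk_eq_mk_iff_isConj.2 (isConj_of_cycleType_eq ?_)
  rw [cycleType_of_isCoxeterElement hp hc, hp2, cycleType_eq]
  simp only [Multiset.map_zero, Multiset.card_zero, Multiset.replicate_zero, add_zero]
  rfl

/-- The triple partition `((1, …, 1), ∅, (2))`. -/
def oneD {n : ℕ} (hn : 2 ≤ n) : RPartition 3 n where
  parts := ![Multiset.replicate (n - 2) 1, 0, {2}]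
  parts_pos := by
    intro j i hi
    fin_cases j
    · rw [Multiset.eq_of_mem_replicate hi]
      exact one_pos
    · exact absurd hi (Multiset.notMem_zero i)
    · rw [Multiset.mem_singleton.1 hi]
      exact two_pos
  parts_sum := by
    simp [Fin.sum_univ_three]
    omega

/-- The triple partition `((1, …, 1), (1, 1), ∅)`. -/
def twoB {n : ℕ} (hn : 2 ≤ n) : RPartition 3 n where
  parts := ![Multiset.replicate (n - 2) 1, Multiset.replicate 2 1, 0]
  parts_pos := by
    intro j i hi
    fin_cases j
    · rw [Multiset.eq_of_mem_replicate hi]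
      exact one_pos
    · rw [Multiset.eq_of_mem_replicate hi]
      exact one_pos
    · exact absurd hi (Multiset.notMem_zero i)
  parts_sum := by
    simp [Fin.sum_univ_three]
    omega

/-- `W(D_2)` and `W(B_1) × W(B_1)` are not conjugate, but the Coxeter elements of both have two
negative cycles of length `1`. -/
theorem not_injective_coxeterClass {n : ℕ} (hn : 2 ≤ n) :
    ¬ Function.Injective (coxeterClass n) := by
  intro hinj
  have hp : ∀ k ∈ (oneD hn).parts 2, 1 < k := by simp [oneD]
  have hq : ∀ k ∈ (twoB hn).parts 2, 1 < k := by simp [twoB]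
  obtain ⟨c, hc⟩ := exists_isCoxeterElement hp
  obtain ⟨d, hd⟩ := exists_isCoxeterElement hq
  have h := @hinj (Quotient.mk _ ⟨(oneD hn).subgroup, isReflectionSubgroup_blockSubgroup⟩)
    (Quotient.mk _ ⟨(twoB hn).subgroup, isReflectionSubgroup_blockSubgroup⟩) (by
      rw [(isCoxeterClassMap_coxeterClass n _).2 c hc, (isCoxeterClassMap_coxeterClass n _).2 d hd]
      refine ConjClasses.mk_eq_mk_iff_isConj.2 (isConj_of_cycleType_eq ?_)
      rw [cycleType_of_isCoxeterElement hp hc, cycleType_of_isCoxeterElement hq hd]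
      simp [oneD, twoB, Multiset.replicate_succ])
  have h1 : ConjSubgroups (oneD hn).subgroup (twoB hn).subgroup := Quotient.exact h
  have h2 := congrArg (fun p : RPartition 3 n => p.parts 1) (eq_of_conjSubgroups hp hq h1)
  simp [oneD, twoB, Multiset.replicate_succ] at h2

end RPartition

theorem theorem3p2 (n : ℕ) (hn : 2 ≤ n) :
    -- the `W_λ` with `λ^3 > 1` are reflection subgroups with the stated parabolic closure and
    -- the stated Coxeter elements
    (∀ p : RPartition 3 n, (∀ k ∈ p.parts 2, 1 < k) →
      SignedPerm.IsReflectionSubgroup p.subgroup ∧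
      SignedPerm.ConjSubgroups (SignedPerm.parabolicClosure (p.subgroup : Set (SignedPerm n)))
        p.closure.subgroup ∧
      (∃ c, SignedPerm.IsCoxeterElement p.subgroup c) ∧
      ∀ c, SignedPerm.IsCoxeterElement p.subgroup c →
        c.cycleType =
          (p.parts 0,
            p.parts 1 + (p.parts 2).map (fun k => k - 1) +
              Multiset.replicate (p.parts 2).card 1)) ∧
    -- each class of reflection subgroups contains exactly one of them
    (∀ R : Subgroup (SignedPerm n), SignedPerm.IsReflectionSubgroup R →
      ∃! p : RPartition 3 n, (∀ k ∈ p.parts 2, 1 < k) ∧ SignedPerm.ConjSubgroups R p.subgroup) ∧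
    -- the map from classes of reflection subgroups to classes of Coxeter elements
    ∃ f : SignedPerm.ReflectionClasses n → ConjClasses (SignedPerm n),
      SignedPerm.IsCoxeterClassMap f ∧ Function.Surjective f ∧ ¬ Function.Injective f := by
  refine ⟨fun p hp => ⟨SignedPerm.isReflectionSubgroup_blockSubgroup,
    RPartition.conjSubgroups_parabolicClosure hp, RPartition.exists_isCoxeterElement hp,
    fun c hc => RPartition.cycleType_of_isCoxeterElement hp hc⟩,
    fun R hR => RPartition.existsUnique_conjSubgroups hR, RPartition.coxeterClass n,
    RPartition.isCoxeterClassMap_coxeterClass n, RPartition.surjective_coxeterClass n,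
    RPartition.not_injective_coxeterClass hn⟩
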